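/- Let $G$ be a simple complex Lie group with simple complex Lie algebra $\mathfrak g$ (everything below depends only on $\mathfrak g$), of type $A_r$ ($r\ge 1$), $B_r$ ($r\ge 2$), $C_r$ ($r\ge 2$), $D_r$ ($r\ge 3$), $E_6$, $E_7$, $E_8$, $F_4$ or $G_2$, and let $k\ge 0$ be an integer (the level). Fix a Cartan subalgebra and a base of the root system of $\mathfrak g$. Let $r$ be the rank, $\theta$ the highest root, $\rho$ the half sum of the positive roots, $\gamma=1+\mathrm{ht}(\theta)$ the Coxeter number and $g=1+\mathrm{ht}(\theta^\vee)$ the dual Coxeter number, where heights are taken with respect to the simple roots and the simple coroots respectively. Let $\langle\cdot,\cdot\rangle$ be the fundamental quadratic form, i.e. the Weyl-invariant bilinear form on the weight space with $\langle\theta,\theta\rangle=2$, and let $\Delta=\det(\langle\omega_i,\omega_j\rangle)$ be its determinant in the basis of fundamental weights $\omega_i$. Put $q=\exp(i\pi/(g+k))$ and $[x]_q=\dfrac{q^x-q^{-x}}{q-q^{-1}}$, where $q^x=\exp(i\pi x/(g+k))$. The simple objects of the fusion category $\mathcal A_k(G)$ are the irreducible representations of $\mathfrak g$ whose highest weight $n=\sum_i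 c_i\omega_i$ ($c_i\in\mathbb Z_{\ge0}$) has level $\langle n,\theta\rangle\le k$. The quantum dimension of $n$ is $$\mathrm{qdim}(n)=\prod_{\alpha>0}\frac{[\langle n+\rho,\alpha\rangle]_q}{[\langle\rho,\alpha\rangle]_q},$$ the product being over the positive roots, and the global dimension is $|\mathcal A_k(G)|=\sum_n \mathrm{qdim}(n)^2$, the sum being over the simple objects. The quantum Lie superfactorial $\mathrm{sf}_G[q]$ is defined as follows, with $[s]!_q=\prod_{j=1}^s[j]_q$. - If $G$ is of type $A$, $D$ or $E$: $\mathrm{sf}_G[q]=\prod_{s\in\mathcal E}[s]!_q$, where $\mathcal E$ is the multiset of exponents of $G$, namely $\{1,2,\dots,r\}$ for $A_r$, $\{1,3,5,\dots,2r-3;\,r-1\}$ for $D_r$, $\{1,4,5,7,8,11\}$ for $E_6$, $\{1,5,7,9,11,13,17\}$ for $E_7$ and $\{1,7,11,13,17,19,23,29\}$ for $E_8$. - $\mathrm{sf}_{B_r}[q]=\prod_{s\in\{1,3,\dots,2r-1\}}\Big([\tfrac s2]_q\prod_{j=1}^{s-1}[j]_q\Big)$. - $\mathrm{sf}_{C_r}[q]=\prod_{s\in\{1,3,\dots,2r-1\}}\Big([\tfrac{s+1}2]_q\prod_{1\le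 j\le s,\ j\ne(s+1)/2}[\tfrac j2]_q\Big)$. - $\mathrm{sf}_{F_4}[q]=[\tfrac12]_q^2[1]_q^3[\tfrac32]_q[2]_q^3[\tfrac52]_q^2[3]_q^3[\tfrac72]_q[4]_q^2[\tfrac92]_q[5]_q^2[\tfrac{11}2]_q[6]_q[7]_q[8]_q$. - $\mathrm{sf}_{G_2}[q]=[\tfrac53]_q[\tfrac43]_q[3]_q[2]_q[1]_q[\tfrac13]_q$. **Theorem.** The set of simple objects of $\mathcal A_k(G)$ is finite, and $$|\mathcal A_k(G)|=\sum_n\mathrm{qdim}(n)^2=\frac{(g+k)^r}{2^{r\gamma}\,\Delta\,\left(\sin\frac{\pi}{g+k}\right)^{r\gamma}\,\left(\mathrm{sf}_G[q]\right)^2}.$$ -/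

import Mathlib

noncomputable section

namespace GlobalDim

/-! ### Types of simple Lie algebras -/

/-- The types `A_r` (`r ≥ 1`), `B_r` (`r ≥ 2`), `C_r` (`r ≥ 2`), `D_r` (`r ≥ 3`), `E₆`, `E₇`, `E₈`,
`F₄`, `G₂` of simple Lie groups. -/
inductive DynkinType : Type
  | A (r : ℕ) (hr : 1 ≤ r)
  | B (r : ℕ) (hr : 2 ≤ r)
  | C (r : ℕ) (hr : 2 ≤ r)
  | D (r : ℕ) (hr : 3 ≤ r)
  | E₆
  | E₇
  | E₈
  | F₄
  | G₂

namespace DynkinType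

/-- The number of vertices of the Dynkin diagram. -/
def rank : DynkinType → ℕ
  | A r _ => r
  | B r _ => r
  | C r _ => r
  | D r _ => r
  | E₆ => 6
  | E₇ => 7
  | E₈ => 8
  | F₄ => 4
  | G₂ => 2

/-- The Cartan matrix `⟨α_i, α_j^∨⟩` of a given type. -/
def cartanMatrix : (X : DynkinType) → Matrix (Fin X.rank) (Fin X.rank) ℤ
  | A r _ => CartanMatrix.A r
  | B r _ => CartanMatrix.B r
  | C r _ => CartanMatrix.C r
  | D r _ => CartanMatrix.D r
  | E₆ => CartanMatrix.E₆
  | E₇ => CartanMatrix.E₇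
  | E₈ => CartanMatrix.E₈
  | F₄ => CartanMatrix.F₄
  | G₂ => CartanMatrix.G₂

/-- The multiset of exponents of a given type; in type `D_r` it is
`{1, 3, 5, …, 2r - 3; r - 1}`. -/
def exponents : DynkinType → Multiset ℕ
  | A r _ => (Multiset.range r).map fun i => i + 1
  | B r _ => (Multiset.range r).map fun i => 2 * i + 1
  | C r _ => (Multiset.range r).map fun i => 2 * i + 1
  | D r _ => (r - 1) ::ₘ (Multiset.range (r - 1)).map fun i => 2 * i + 1
  | E₆ => {1, 4, 5, 7, 8, 11}
  | E₇ => {1, 5, 7, 9, 11, 13, 17}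
  | E₈ => {1, 7, 11, 13, 17, 19, 23, 29}
  | F₄ => {1, 5, 7, 11}
  | G₂ => {1, 5}

end DynkinType

/-! ### Quantum numbers and quantum Lie superfactorials -/

/-- The `q`-number `[x]_q = (q ^ x - q ^ (-x)) / (q - q⁻¹)`, for an arbitrary complex number `x`
(powers are taken with the principal branch of the logarithm of `q`). -/
def qNum (q x : ℂ) : ℂ :=
  (q ^ x - q ^ (-x)) / (q - q⁻¹)

/-- The quantum factorial `[s]!_q = [1]_q [2]_q ⋯ [s]_q`. -/
def qFactorial (q : ℂ) (s : ℕ) : ℂ :=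
  ∏ n ∈ Finset.Icc 1 s, qNum q n

/-- The modified quantum factorial used in type `B`: `[s/2]_q [s-1]_q [s-2]_q ⋯ [2]_q [1]_q`. -/
def qFactorialB (q : ℂ) (s : ℕ) : ℂ :=
  qNum q (s / 2) * qFactorial q (s - 1)

/-- The modified quantum factorial used in type `C`, for odd `s`: the product of the `q`-numbers
`[j/2]_q` for `1 ≤ j ≤ s`, except that the middle factor, `j = (s+1)/2`, is replaced
by `[j]_q`. -/
def qFactorialC (q : ℂ) (s : ℕ) : ℂ :=
  ∏ j ∈ Finset.Icc 1 s, if 2 * j = s + 1 then qNum q j else qNum q (j / 2)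

/-- The quantum Lie superfactorial `sf_G[q]`, for `G` of a given type. -/
def superfactorial (X : DynkinType) (q : ℂ) : ℂ :=
  match X with
  | .B r hr => ((DynkinType.B r hr).exponents.map (qFactorialB q)).prod
  | .C r hr => ((DynkinType.C r hr).exponents.map (qFactorialC q)).prod
  | .F₄ =>
      qNum q (1 / 2) ^ 2 * qNum q 1 ^ 3 * qNum q (3 / 2) * qNum q 2 ^ 3 * qNum q (5 / 2) ^ 2 *
        qNum q 3 ^ 3 * qNum q (7 / 2) * qNum q 4 ^ 2 * qNum q (9 / 2) * qNum q 5 ^ 2 *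
        qNum q (11 / 2) * qNum q 6 * qNum q 7 * qNum q 8
  | .G₂ =>
      qNum q (5 / 3) * qNum q (4 / 3) * qNum q 3 * qNum q 2 * qNum q 1 * qNum q (1 / 3)
  | X => (X.exponents.map (qFactorial q)).prod

/-! ### Numerical data attached to an irreducible root system with a base -/

theorem nonempty_of_isIrreducible {ι M N : Type*} [AddCommGroup M] [Module ℂ M]
    [AddCommGroup N] [Module ℂ N] (P : RootPairing ι ℂ M N) [P.IsRootSystem] [P.IsIrreducible] :
    Nonempty ι := by
  by_contra h
  rw [not_nonempty_iff] at h
  have h1 := RootPairing.IsRootSystem.span_root_eq_top (P := P)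
  rw [Set.range_eq_empty, Submodule.span_empty] at h1
  have : Nontrivial M := RootPairing.IsIrreducible.nontrivial P
  exact bot_ne_top h1

section RootSystem

variable {ι M N : Type*} [Fintype ι] [AddCommGroup M] [Module ℂ M] [AddCommGroup N] [Module ℂ N]

/-- The root system with base `b` has type `X`: its Cartan matrix is that of `X`, up to a
numbering of the simple roots. -/
def HasType {P : RootPairing ι ℂ M N} [P.IsCrystallographic] (b : P.Base) (X : DynkinType) :
    Prop :=
  ∃ e : b.support ≃ Fin X.rank, ∀ i j, b.cartanMatrix i j = X.cartanMatrix (e i) (e j)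

variable {P : RootPairing ι ℂ M N} [P.IsRootSystem] [P.IsIrreducible] (b : P.Base)

theorem exists_height_max : ∃ θ : ι, ∀ i, b.height i ≤ b.height θ :=
  haveI := nonempty_of_isIrreducible P
  Finite.exists_max b.height

/-- (The index of) the highest root `θ`: the root of greatest height. -/
def highestRoot : ι :=
  (exists_height_max b).choose

/-- The Coxeter number `γ`: one plus the height of the highest root. -/
def coxeterNumber : ℕ :=
  (b.height (highestRoot b) + 1).toNat

/-- The dual Coxeter number `g`: one plus the height, with respect to the simple coroots, of the
coroot of the highest root. -/
def dualCoxeterNumber : ℕ :=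
  (b.flip.height (highestRoot b) + 1).toNat

/-- The fundamental quadratic form: the invariant bilinear form `⟨·, ·⟩` on the weight space,
normalized by `⟨θ, θ⟩ = 2`, where `θ` is the highest root. -/
def fundForm : LinearMap.BilinForm ℂ M :=
  (2 / P.RootForm (P.root (highestRoot b)) (P.root (highestRoot b))) • P.RootForm

/-- The fundamental weights `ω_i`: the basis of the weight space dual to the simple coroots. -/
def fundWeight (i : b.support) : M :=
  P.toLinearMap.toPerfPair.symm (b.toCoweightBasis.coord i)

/-- The determinant `Δ` of the fundamental quadratic form, in the basis of fundamental weights. -/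
def fundDet : ℂ :=
  open Classical in
  (Matrix.of fun i j : b.support => fundForm b (fundWeight b i) (fundWeight b j)).det

/-- The (indices of the) positive roots. -/
def posRoots : Finset ι :=
  open Classical in
  Finset.univ.filter fun i => b.IsPos i

/-- The Weyl vector `ρ`: the half sum of the positive roots. -/
def weylVector : M :=
  (2⁻¹ : ℂ) • ∑ i ∈ posRoots b, P.root i

/-- The dominant integral weights, i.e. the highest weights of the (finite dimensional)
irreducible representations: the combinations of the fundamental weights with coefficients
in `ℕ`. -/
def dominantWeights : Set M :=
  {n | ∃ c : b.support → ℕ, n = ∑ i, c i • fundWeight b i}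

/-- The simple objects of `A_k(G)`: the irreducible representations, identified with their highest
weights `n`, whose level `⟨n, θ⟩` is an integer smaller than or equal to `k`. -/
def simpleObjects (k : ℕ) : Set M :=
  {n | n ∈ dominantWeights b ∧
    ∃ l : ℕ, fundForm b n (P.root (highestRoot b)) = l ∧ l ≤ k}

/-- The root of unity `q = exp(iπ/(g+k))`. -/
def rootOfUnity (k : ℕ) : ℂ :=
  Complex.exp (Complex.I * Real.pi / (dualCoxeterNumber b + k))

/-- The quantum dimension at level `k` of the representation with highest weight `n`, given by the
quantum Weyl formula. -/
def qdim (k : ℕ) (n : M) : ℂ :=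
  ∏ α ∈ posRoots b,
    qNum (rootOfUnity b k) (fundForm b (n + weylVector b) (P.root α)) /
      qNum (rootOfUnity b k) (fundForm b (weylVector b) (P.root α))

/-- The global dimension `|A_k(G)|`: the sum of the squares of the quantum dimensions of the
simple objects. -/
def globalDim (k : ℕ) : ℂ :=
  ∑ᶠ n ∈ simpleObjects b k, qdim b k n ^ 2

end RootSystem

end GlobalDim

end

noncomputable section

set_option linter.unusedSectionVars false

namespace GlobalDim

open Module

/-! ### Root lengths and the normalized invariant form -/

variable {ι M N : Type*} [Fintype ι] [AddCommGroup M] [Module ℂ M] [AddCommGroup N] [Module ℂ N]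
variable {P : RootPairing ι ℂ M N} [P.IsRootSystem] [P.IsIrreducible] [P.IsCrystallographic]
  [P.IsReduced] (b : P.Base)

/-! Put κ = g + k and let S(x) be the product over all roots α of |2 sin(π⟨x,α⟩/κ)| (`sinProd`). The
quantum Weyl formula gives qdim(n)² = S(n + ρ)/S(ρ) (`qdim_sq`). Since ⟨ρ,θ⟩ = g - 1, translation by
ρ identifies the simple objects with the weights in the open alcove ⟨x,α_j⟩ > 0, ⟨x,θ⟩ < κ
(`mem_simpleObjects_iff`). It remains to find the sum of S over the alcove, and S(ρ).

Let Λ be the weight lattice and Q^∨ the coroot lattice, embedded in the weight space by the form.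
The sum of S over the finite group Λ/κQ^∨ is computed in two ways. First, S is invariant under the
affine Weyl group and vanishes on its mirrors; this group carries every weight into the closed
alcove, and only the identity maps a point of the open alcove into the open alcove. So the sum is
|W| times the sum over the alcove (`sum_sinProd_quotient`). Secondly, S = |D|² for the Weyl
denominator D, which is a signed sum of the exponentials of wρ, w in W (`weylDenom_eq_sum_weyl`).
These give distinct characters of Λ/κQ^∨ because ρ lies in the alcove, so orthogonality yields |W|
times the order of the group (`sum_sinProd_weightQuotient`). Hence the alcove sum is the order of
Λ/κQ^∨, which is κ^r/Δ (`card_weightQuotient_mul_fundDet`).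

Finally, S(ρ) is a power of 2 sin(π/κ), with the number of roots as exponent, times the squared
product of the [⟨ρ,α⟩] over the positive roots. The number of roots is rγ, by a Schur type argument
(`two_mul_card_posRoots`), and the product is the superfactorial, by explicit realizations of the
positive roots in each type (`prod_rePair_eq_superfactorial`). -/

/-- The squared length, with respect to the canonical form, of a root. -/
def lengthSq (P : RootPairing ι ℂ M N) [P.IsCrystallographic] (i : ι) : ℤ :=
  ∑ j, P.pairingIn ℤ i j ^ 2

theorem pairing_eq_intCast (i j : ι) : P.pairing i j = (P.pairingIn ℤ i j : ℂ) := by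
  rw [← P.algebraMap_pairingIn ℤ]; simp

theorem rootForm_root_self_eq (i : ι) :
    P.RootForm (P.root i) (P.root i) = (lengthSq P i : ℂ) := by
  simp [RootPairing.rootForm_root_self, lengthSq, pairing_eq_intCast, sq]

theorem lengthSq_pos (i : ι) : 0 < lengthSq P i := by
  refine Finset.sum_pos' (fun j _ => sq_nonneg _) ⟨i, Finset.mem_univ _, ?_⟩
  have : P.pairingIn ℤ i i = 2 := by simp
  rw [this]; norm_num

theorem lengthSq_reflectionPerm (i j : ι) :
    lengthSq P (P.reflectionPerm j i) = lengthSq P i := by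
  have h : ((lengthSq P (P.reflectionPerm j i) : ℤ) : ℂ) = (lengthSq P i : ℤ) := by
    rw [← rootForm_root_self_eq, ← rootForm_root_self_eq, P.root_reflectionPerm,
      P.rootForm_reflection_reflection_apply]
  exact_mod_cast h

/-- The canonical form identifies the coroot of α with 2α/(α,α). -/
theorem two_mul_rootForm_root (x : M) (i : ι) :
    2 * P.RootForm x (P.root i) = lengthSq P i * P.coroot' i x := by
  have h := congrArg (P.toLinearMap x) (P.rootForm_self_smul_coroot i)
  rw [rootForm_root_self_eq, map_smul, map_nsmul, P.toLinearMap_apply_apply_Polarization] at h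
  rw [← (P.rootForm_symmetric).eq] 
  simpa using h.symm

/-- Half of the squared length of a root, in the normalization in which the highest root has
squared length two. -/
def halfNorm (i : ι) : ℝ := lengthSq P i / lengthSq P (highestRoot b)

theorem halfNorm_pos (i : ι) : 0 < halfNorm b i :=
  div_pos (by exact_mod_cast lengthSq_pos i)
    (by exact_mod_cast lengthSq_pos (P := P) (highestRoot b))

theorem halfNorm_ne_zero (i : ι) : halfNorm b i ≠ 0 := (halfNorm_pos b i).ne'

theorem halfNorm_highestRoot : halfNorm b (highestRoot b) = 1 :=
  div_self (by exact_mod_cast (lengthSq_pos (P := P) (highestRoot b)).ne')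

theorem halfNorm_reflectionPerm (i j : ι) :
    halfNorm b (P.reflectionPerm j i) = halfNorm b i := by
  simp [halfNorm, lengthSq_reflectionPerm]

theorem fundForm_root (x : M) (i : ι) :
    fundForm b x (P.root i) = halfNorm b i * P.coroot' i x := by
  have h := two_mul_rootForm_root (P := P) x i
  have h0 : ((lengthSq P (highestRoot b) : ℤ) : ℂ) ≠ 0 := by
    exact_mod_cast (lengthSq_pos (P := P) (highestRoot b)).ne'
  simp only [fundForm, LinearMap.smul_apply, smul_eq_mul, rootForm_root_self_eq, halfNorm]
  push_cast
  field_simp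
  linear_combination h

theorem fundForm_comm (x y : M) : fundForm b x y = fundForm b y x := by
  simp only [fundForm, LinearMap.smul_apply]
  congr 1
  exact (P.rootForm_symmetric.eq y x).symm

theorem fundForm_reflection (i : ι) (x y : M) :
    fundForm b (P.reflection i x) (P.reflection i y) = fundForm b x y := by
  simp [fundForm]

/-- Symmetry of the form: the half norms symmetrize the matrix of pairings. -/
theorem halfNorm_mul_pairing (i j : ι) :
    halfNorm b i * (P.pairingIn ℤ j i : ℝ) = halfNorm b j * P.pairingIn ℤ i j := by
  have h := fundForm_comm b (P.root j) (P.root i)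
  rw [fundForm_root, fundForm_root] at h
  simp only [RootPairing.root_coroot'_eq_pairing, pairing_eq_intCast] at h
  exact_mod_cast h

/-- The real part of `⟨x, α_i⟩`. -/
def rePair (i : ι) (x : M) : ℝ := (fundForm b x (P.root i)).re

@[simp] theorem rePair_add (i : ι) (x y : M) :
    rePair b i (x + y) = rePair b i x + rePair b i y := by
  simp [rePair]

@[simp] theorem rePair_sub (i : ι) (x y : M) :
    rePair b i (x - y) = rePair b i x - rePair b i y := by
  simp [rePair]

theorem rePair_real_smul (i : ι) (c : ℝ) (x : M) :
    rePair b i ((c : ℂ) • x) = c * rePair b i x := by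
  simp [rePair]

theorem rePair_eq (i : ι) (x : M) : rePair b i x = halfNorm b i * (P.coroot' i x).re := by
  rw [rePair, fundForm_root, Complex.re_ofReal_mul]

theorem rePair_root (i j : ι) : rePair b i (P.root j) = halfNorm b i * P.pairingIn ℤ j i := by
  rw [rePair_eq, RootPairing.root_coroot'_eq_pairing, pairing_eq_intCast, Complex.intCast_re]

theorem rePair_root_comm (i j : ι) : rePair b i (P.root j) = rePair b j (P.root i) := by
  rw [rePair_root, rePair_root, halfNorm_mul_pairing]

theorem rePair_reflection (i j : ι) (x : M) :
    rePair b i (P.reflection j x) = rePair b (P.reflectionPerm j i) x := by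
  rw [rePair, rePair, P.root_reflectionPerm, ← fundForm_reflection b j, P.reflection_same]

theorem rePair_neg_index (i : ι) (x : M) :
    rePair b (P.reflectionPerm i i) x = -rePair b i x := by
  simp [rePair]


/-! ### Coefficients on the simple roots -/

/-- The coefficients of a root with respect to the simple roots. -/
def coef (i : ι) (j : b.support) : ℤ := (b.exists_root_eq_sum_int i).choose j

theorem root_eq_sum_coef (i : ι) : P.root i = ∑ j : b.support, coef b i j • P.root j := by
  have h := (b.exists_root_eq_sum_int i).choose_spec.2.2
  conv_lhs => rw [h]
  exact (Finset.sum_coe_sort b.support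
    fun j => (b.exists_root_eq_sum_int i).choose j • P.root j).symm

theorem height_eq_sum_coef (i : ι) : b.height i = ∑ j : b.support, coef b i j := by
  rw [RootPairing.Base.height]
  exact (Finset.sum_coe_sort b.support fun j => (b.exists_root_eq_sum_int i).choose j).symm

/-- The coefficients come from a choice; linear independence is what allows them to be computed. -/
theorem coef_unique {i : ι} {c : b.support → ℤ}
    (h : P.root i = ∑ j : b.support, c j • P.root j) : c = coef b i := by
  have := (b.linearIndepOn_root.restrict_scalars' ℤ)
  have := Fintype.linearIndependent_iffₛ.mp this c (coef b i)
    (h.symm.trans (root_eq_sum_coef b i))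
  exact funext this

theorem coef_nonneg {i : ι} (hi : b.IsPos i) (j : b.support) : 0 ≤ coef b i j := by
  have h := (b.exists_root_eq_sum_int i).choose_spec.2.1
  rcases h with h | h
  · exact h.le j
  · exfalso
    have h1 := height_eq_sum_coef b i
    have h2 : b.height i ≤ 0 := by
      rw [h1]; exact Finset.sum_nonpos fun j _ => h.le j
    exact absurd hi (not_lt.mpr h2)


theorem rePair_eq_sum_coef (i : ι) (x : M) :
    rePair b i x = ∑ j : b.support, coef b i j * rePair b j x := by
  have h := congrArg (fundForm b x) (root_eq_sum_coef b i)
  rw [map_sum] at h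
  rw [rePair, h, Complex.re_sum]
  simp [rePair]

/-! ### The highest root -/

theorem height_le_highestRoot (i : ι) : b.height i ≤ b.height (highestRoot b) :=
  (exists_height_max b).choose_spec i

theorem exists_mem_support : Nonempty b.support := by
  have := nonempty_of_isIrreducible P
  exact b.support_nonempty.to_subtype

theorem isPos_highestRoot : b.IsPos (highestRoot b) := by
  obtain ⟨j⟩ := exists_mem_support b
  have := height_le_highestRoot b j
  rw [RootPairing.Base.height_one_of_mem_support j.2] at this
  exact lt_of_lt_of_le one_pos this

theorem height_reflectionPerm (i : ι) (j : b.support) :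
    b.height (P.reflectionPerm j i) = b.height i - P.pairingIn ℤ i j := by
  have h : P.root (P.reflectionPerm j i) = P.root i + (-P.pairingIn ℤ i j) • P.root j := by
    rw [P.root_reflectionPerm, P.reflection_apply_root, pairing_eq_intCast, neg_smul,
      Int.cast_smul_eq_zsmul, sub_eq_add_neg]
  rw [b.height_add_zsmul h, RootPairing.Base.height_one_of_mem_support j.2]
  simp; ring

/-- Otherwise a simple reflection would increase the height of θ. -/
theorem pairingIn_highestRoot_nonneg (j : b.support) : 0 ≤ P.pairingIn ℤ (highestRoot b) j := by
  have := height_le_highestRoot b (P.reflectionPerm j (highestRoot b))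
  rw [height_reflectionPerm] at this
  lia

theorem pairingIn_eq_sum_coef (i j : ι) :
    P.pairingIn ℤ i j = ∑ k : b.support, coef b i k * P.pairingIn ℤ k j := by
  have h := congrArg (P.coroot' j) (root_eq_sum_coef b i)
  rw [map_sum] at h
  simp only [map_zsmul, RootPairing.root_coroot'_eq_pairing, pairing_eq_intCast,
    zsmul_eq_mul] at h
  exact_mod_cast h

/-- Connectedness of the Dynkin diagram. If α_j is absent from θ but has a neighbour that occurs in
θ, then ⟨θ, α_j^∨⟩ is a sum of nonpositive terms, one of them negative, against dominance. So the
support of θ is closed under adjacency. -/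
theorem coef_highestRoot_pos (j : b.support) : 0 < coef b (highestRoot b) j := by
  have hpos := isPos_highestRoot b
  obtain ⟨i, hi⟩ : ∃ i, 0 < coef b (highestRoot b) i := by
    by_contra! h
    have h1 := height_eq_sum_coef b (highestRoot b)
    have h2 : ∑ j : b.support, coef b (highestRoot b) j ≤ 0 := Finset.sum_nonpos fun j _ => h j
    rw [RootPairing.Base.isPos_iff] at hpos
    lia
  refine b.induction_on_cartanMatrix (fun j => 0 < coef b (highestRoot b) j) hi ?_
  intro i j hi hij
  by_contra hj
  have hj0 : coef b (highestRoot b) j = 0 := le_antisymm (not_lt.mp hj) (coef_nonneg b hpos j)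
  have hij' : b.cartanMatrix i j ≠ 0 := by rwa [ne_eq, b.cartanMatrix_apply_eq_zero_iff_symm]
  have hne : i ≠ j := by rintro rfl; exact hj hi
  have h1 := pairingIn_highestRoot_nonneg b j
  rw [pairingIn_eq_sum_coef b] at h1
  refine absurd h1 (not_le.mpr ?_)
  refine Finset.sum_neg' (fun k _ => ?_) ⟨i, Finset.mem_univ _, ?_⟩
  · by_cases hk : k = j
    · rw [hk, hj0, zero_mul]
    · exact mul_nonpos_of_nonneg_of_nonpos (coef_nonneg b hpos k)
        (b.cartanMatrix_le_zero_of_ne k j hk)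
  · exact mul_neg_of_pos_of_neg hi (lt_of_le_of_ne (b.cartanMatrix_le_zero_of_ne i j hne) hij')

theorem pairingIn_highestRoot_pos_of_dominant {i : ι}
    (h : ∀ j : b.support, 0 ≤ P.pairingIn ℤ i j) : 0 < P.pairingIn ℤ (highestRoot b) i := by
  have hnn : ∀ j : b.support, 0 ≤ P.pairingIn ℤ j i := fun j => by
    by_contra hlt
    rw [not_le, P.pairingIn_lt_zero_iff] at hlt
    exact absurd (h j) (not_le.mpr hlt)
  obtain ⟨j, hj, hj'⟩ := b.exists_mem_support_pos_pairingIn_ne_zero i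
  rw [pairingIn_eq_sum_coef b]
  refine Finset.sum_pos' (fun k _ => mul_nonneg (coef_highestRoot_pos b k).le (hnn k))
    ⟨⟨j, hj⟩, Finset.mem_univ _, mul_pos (coef_highestRoot_pos b _) ?_⟩
  exact lt_of_le_of_ne (hnn ⟨j, hj⟩) (Ne.symm hj')

/-- A root which pairs non-negatively with the simple coroots is `θ`, or differs from it by a
positive root. -/
theorem eq_highestRoot_or_of_dominant {i : ι} (h : ∀ j : b.support, 0 ≤ P.pairingIn ℤ i j) :
    i = highestRoot b ∨
      ∃ k, b.IsPos k ∧ P.root (highestRoot b) = P.root i + P.root k := by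
  by_cases hi : i = highestRoot b
  · exact Or.inl hi
  right
  have hpos := pairingIn_highestRoot_pos_of_dominant b h
  obtain ⟨k, hk⟩ := P.root_sub_root_mem_of_pairingIn_pos hpos (Ne.symm hi)
  refine ⟨k, ?_, by rw [hk]; abel⟩
  rw [RootPairing.Base.isPos_iff', b.height_sub hk]
  linarith [height_le_highestRoot b i]

theorem rePair_nonneg_of_isPos {x : M} (hx : ∀ j : b.support, 0 ≤ rePair b j x) {i : ι}
    (hi : b.IsPos i) : 0 ≤ rePair b i x := by
  rw [rePair_eq_sum_coef]
  exact Finset.sum_nonneg fun j _ =>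
    mul_nonneg (by exact_mod_cast coef_nonneg b hi j) (hx j)

theorem rePair_highestRoot (i : ι) : rePair b i (P.root (highestRoot b)) =
    P.pairingIn ℤ i (highestRoot b) := by
  rw [rePair_root_comm, rePair_root, halfNorm_highestRoot, one_mul]

/-- As long as some simple coroot pairs negatively with the root, reflecting in it raises the
height, keeps the length, and adds a nonnegative multiple of a simple root. Heights are bounded by
that of θ, so the process stops at a dominant root. -/
theorem exists_dominant (i : ι) : ∃ j : ι, (∀ k : b.support, 0 ≤ P.pairingIn ℤ j k) ∧
    halfNorm b j = halfNorm b i ∧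
    ∀ x : M, (∀ j : b.support, 0 ≤ rePair b j x) → rePair b i x ≤ rePair b j x := by
  obtain ⟨n, hn⟩ : ∃ n, (b.height (highestRoot b) - b.height i).toNat = n := ⟨_, rfl⟩
  induction n using Nat.strong_induction_on generalizing i with
  | _ n ih =>
    by_cases h : ∀ k : b.support, 0 ≤ P.pairingIn ℤ i k
    · exact ⟨i, h, rfl, fun _ _ => le_rfl⟩
    push Not at h
    obtain ⟨k, hk⟩ := h
    have h1 := height_reflectionPerm b i k
    have h2 := height_le_highestRoot b (P.reflectionPerm k i)
    obtain ⟨j, hj1, hj2, hj3⟩ := ih _ (by lia) (P.reflectionPerm k i) rfl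
    refine ⟨j, hj1, by rw [hj2, halfNorm_reflectionPerm], fun x hx => le_trans ?_ (hj3 x hx)⟩
    rw [rePair, rePair, P.root_reflectionPerm, P.reflection_apply_root, pairing_eq_intCast,
      map_sub, map_smul, Complex.sub_re, smul_eq_mul, ← Complex.ofReal_intCast,
      Complex.re_ofReal_mul]
    have : (P.pairingIn ℤ i k : ℝ) < 0 := by exact_mod_cast hk
    have := mul_nonpos_of_nonpos_of_nonneg this.le (hx k)
    rw [rePair] at this
    linarith

theorem rePair_le_highestRoot {x : M} (hx : ∀ j : b.support, 0 ≤ rePair b j x) (i : ι) :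
    rePair b i x ≤ rePair b (highestRoot b) x := by
  obtain ⟨j, hj1, -, hj3⟩ := exists_dominant b i
  refine (hj3 x hx).trans ?_
  rcases eq_highestRoot_or_of_dominant b hj1 with rfl | ⟨k, hk, hk'⟩
  · exact le_rfl
  · have : rePair b (highestRoot b) x = rePair b j x + rePair b k x := by
      simp [rePair, hk']
    linarith [rePair_nonneg_of_isPos b hx hk]

/-- The highest root is long: for a dominant root β, two uses of maximality give ⟨β,β⟩ ≤ ⟨β,θ⟩ ≤
⟨θ,θ⟩ = 2. -/
theorem halfNorm_le_one (i : ι) : halfNorm b i ≤ 1 := by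
  obtain ⟨j, hj1, hj2, -⟩ := exists_dominant b i
  rw [← hj2]
  have hdom : ∀ l : b.support, 0 ≤ rePair b l (P.root j) := fun l => by
    rw [rePair_root]
    exact mul_nonneg (halfNorm_pos b _).le (by exact_mod_cast hj1 l)
  have h1 := rePair_le_highestRoot b hdom j
  have hdom' : ∀ l : b.support, 0 ≤ rePair b l (P.root (highestRoot b)) := fun l => by
    rw [rePair_root]
    exact mul_nonneg (halfNorm_pos b _).le (by exact_mod_cast pairingIn_highestRoot_nonneg b l)
  have h2 := rePair_le_highestRoot b hdom' j
  rw [rePair_root_comm] at h2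
  have h3 : rePair b j (P.root j) = halfNorm b j * 2 := by rw [rePair_root]; simp
  have h4 : rePair b (highestRoot b) (P.root (highestRoot b)) = 2 := by rw [rePair_highestRoot]; simp
  linarith

theorem abs_pairingIn_highestRoot_le_one {i : ι} (h : i ≠ highestRoot b)
    (h' : P.root i ≠ -P.root (highestRoot b)) : |P.pairingIn ℤ i (highestRoot b)| ≤ 1 := by
  have h1 := halfNorm_mul_pairing b i (highestRoot b)
  rw [halfNorm_highestRoot, one_mul] at h1
  have h2 := halfNorm_le_one b i
  have h3 := P.pairingIn_pairingIn_mem_set_of_isCrystal_of_isRed'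
    (i := i) (j := highestRoot b) (by simpa using h) h'
  have h4 : |P.pairingIn ℤ i (highestRoot b)| ≤ |P.pairingIn ℤ (highestRoot b) i| := by
    have : (|P.pairingIn ℤ i (highestRoot b)| : ℝ) ≤ |(P.pairingIn ℤ (highestRoot b) i : ℝ)| := by
      rw [← h1, abs_mul, abs_of_pos (halfNorm_pos b i)]
      exact mul_le_of_le_one_left (abs_nonneg _) h2
    exact_mod_cast this
  simp only [Set.mem_insert_iff, Set.mem_singleton_iff, Prod.mk.injEq] at h3
  -- Of the possible pairs of Cartan integers, those that survive the comparison `h4` of absolute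
  -- values have the pairing with θ^∨ in {-1, 0, 1}.
  rcases h3 with h3 | h3 | h3 | h3 | h3 | h3 | h3 | h3 | h3 | h3 | h3 <;>
    simp [h3.1, h3.2] at h4 ⊢

/-- The inverse of half of the squared length of a root is an integer. -/
theorem exists_halfNorm_inv (i : ι) : ∃ n : ℤ, (halfNorm b i)⁻¹ = n := by
  obtain ⟨j, hj1, hj2, -⟩ := exists_dominant b i
  rw [← hj2]
  by_cases hj : j = highestRoot b
  · exact ⟨1, by rw [hj, halfNorm_highestRoot]; simp⟩
  have h1 := pairingIn_highestRoot_pos_of_dominant b hj1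
  have h2 := h1
  rw [P.zero_lt_pairingIn_iff'] at h2
  -- A dominant root β other than θ has ⟨β,θ^∨⟩ = 1, so the symmetrization relation exhibits the
  -- inverse of its half norm as ⟨θ,β^∨⟩.
  have h3 : P.pairingIn ℤ j (highestRoot b) = 1 := by
    have := abs_le.mp (abs_pairingIn_highestRoot_le_one b hj fun h => by
      rw [RootPairing.root_eq_neg_iff] at h
      rw [h] at h2
      simp at h2)
    lia
  refine ⟨P.pairingIn ℤ (highestRoot b) j, ?_⟩
  have h4 := halfNorm_mul_pairing b j (highestRoot b)
  rw [halfNorm_highestRoot, h3] at h4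
  rw [inv_eq_iff_eq_inv]
  exact eq_inv_of_mul_eq_one_left (by simpa using h4)

/-! ### The Weyl vector -/

theorem mem_posRoots {i : ι} : i ∈ posRoots b ↔ b.IsPos i := by
  simp [posRoots]

theorem reflectionPerm_ne {i : ι} {j : ι} (hi : b.IsPos i) (hj : b.IsPos j) :
    P.reflectionPerm j i ≠ j := by
  intro h
  have h1 : P.reflectionPerm j (P.reflectionPerm j i) = i := P.reflectionPerm_self j i
  rw [h] at h1
  have h2 := b.height_reflectionPerm_self j
  rw [RootPairing.Base.isPos_iff] at hi hj
  have h3 : b.height (P.reflectionPerm j j) = -b.height j := h2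
  rw [h1] at h3
  lia

/-- The simple reflection s_j permutes the positive roots other than α_j and changes the sign of
their pairings with α_j^∨. These cancel, and α_j alone contributes 2/2. -/
theorem coroot'_weylVector (j : b.support) : P.coroot' j (weylVector b) = 1 := by
  classical
  have hj : (j : ι) ∈ posRoots b := (mem_posRoots b).mpr (RootPairing.Base.isPos_of_mem_support j.2)
  have h0 : ∑ i ∈ (posRoots b).erase j, P.coroot' j (P.root i) = 0 := by
    refine Finset.sum_involution (fun i _ => P.reflectionPerm j i) ?_ ?_ ?_ ?_
    · intro i _
      rw [P.root_reflectionPerm, P.coroot'_reflection]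
      simp
    · intro i _ hi h
      have h1 : P.coroot' j (P.root (P.reflectionPerm j i)) = -P.coroot' j (P.root i) := by
        rw [P.root_reflectionPerm, P.coroot'_reflection]; simp
      rw [h] at h1
      exact hi (self_eq_neg.mp h1)
    · intro i hi
      rw [Finset.mem_erase, mem_posRoots] at hi ⊢
      exact ⟨reflectionPerm_ne b hi.2 (RootPairing.Base.isPos_of_mem_support j.2),
        hi.2.reflectionPerm j.2 hi.1⟩
    · intro i _
      simp
  rw [weylVector, map_smul, map_sum, ← Finset.add_sum_erase _ _ hj, h0]
  simp

theorem rePair_weylVector (j : b.support) : rePair b j (weylVector b) = halfNorm b j := by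
  rw [rePair_eq, coroot'_weylVector]; simp

theorem rePair_weylVector_pos (j : b.support) : 0 < rePair b j (weylVector b) := by
  rw [rePair_weylVector]; exact halfNorm_pos b j

theorem coroot'_weylVector_eq (i : ι) :
    P.coroot' i (weylVector b) = (b.flip.height i : ℂ) := by
  have h := root_eq_sum_coef b.flip i
  have h2 := congrArg (P.toLinearMap (weylVector b)) h
  rw [map_sum] at h2
  rw [height_eq_sum_coef b.flip]
  push_cast
  refine h2.trans (Finset.sum_congr rfl fun j _ => ?_)
  rw [map_zsmul, zsmul_eq_mul]
  have := coroot'_weylVector b j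
  simp only [LinearMap.flip_apply] at this
  erw [this]; simp

/-- The pairing of ρ with θ^∨ is the height of θ^∨, and it is nonnegative, so the truncation to ℕ in
the definition loses nothing. -/
theorem dualCoxeterNumber_eq :
    (dualCoxeterNumber b : ℝ) = rePair b (highestRoot b) (weylVector b) + 1 := by
  have h1 : rePair b (highestRoot b) (weylVector b) = b.flip.height (highestRoot b) := by
    rw [rePair_eq, coroot'_weylVector_eq, halfNorm_highestRoot]; simp
  have h2 : 0 ≤ rePair b (highestRoot b) (weylVector b) :=
    rePair_nonneg_of_isPos b (fun j => (rePair_weylVector_pos b j).le) (isPos_highestRoot b)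
  rw [h1] at h2 ⊢
  have h3 : 0 ≤ b.flip.height (highestRoot b) := by exact_mod_cast h2
  rw [dualCoxeterNumber]
  have : ((b.flip.height (highestRoot b) + 1).toNat : ℤ) = b.flip.height (highestRoot b) + 1 :=
    Int.toNat_of_nonneg (by lia)
  exact_mod_cast this

theorem coxeterNumber_eq : (coxeterNumber b : ℤ) = b.height (highestRoot b) + 1 :=
  Int.toNat_of_nonneg (by have := isPos_highestRoot b; rw [RootPairing.Base.isPos_iff] at this; lia)

/-! ### An exchange argument -/

section Exchange

variable {G R J : Type*} [Group G]

theorem exists_list_of_mem_closure_range {s : J → G} (hs : ∀ j, s j * s j = 1) {g : G}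
    (hg : g ∈ Subgroup.closure (Set.range s)) : ∃ l : List J, g = (l.map s).prod := by
  induction hg using Subgroup.closure_induction with
  | mem x hx => obtain ⟨j, rfl⟩ := hx; exact ⟨[j], by simp⟩
  | one => exact ⟨[], rfl⟩
  | mul x y _ _ hx hy =>
    obtain ⟨l, rfl⟩ := hx
    obtain ⟨l', rfl⟩ := hy
    exact ⟨l ++ l', by simp⟩
  | inv x _ hx =>
    obtain ⟨l, rfl⟩ := hx
    refine ⟨l.reverse, ?_⟩
    rw [List.prod_inv_reverse, List.map_map, List.map_reverse]
    congr 2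
    exact List.map_congr_left fun j _ => inv_eq_of_mul_eq_one_left (hs j)

variable (act : G →* Equiv.Perm R) (pos : R → Prop) (s : J → G) (a : J → R)

-- The exchange condition. Applying the word to a_j letter by letter from the right, positivity is
-- first lost at some letter i, which can only happen at the root a_i. The part of the word after
-- that letter then conjugates s_j into s_i, and the two copies of s_i cancel.
include act pos in
theorem exists_shorter_word (hs : ∀ j, s j * s j = 1) (hapos : ∀ j, pos (a j))
    (hperm : ∀ j r, pos r → r ≠ a j → pos (act (s j) r))
    (hconj : ∀ g ∈ Subgroup.closure (Set.range s), ∀ i j, act g (a i) = a j → g * s i = s j * g)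
    (l : List J) (j : J) (hl : ¬pos (act (l.map s).prod (a j))) :
    ∃ l' : List J, l'.length < l.length ∧ (l.map s).prod * s j = (l'.map s).prod := by
  induction l with
  | nil => exact absurd (hapos j) (by simpa using hl)
  | cons i t ih =>
    rw [List.map_cons, List.prod_cons, map_mul, Equiv.Perm.mul_apply] at hl
    by_cases ht : pos (act (t.map s).prod (a j))
    · have h1 : act (t.map s).prod (a j) = a i := by
        by_contra hne
        exact hl (hperm i _ ht hne)
      have h2 : (t.map s).prod ∈ Subgroup.closure (Set.range s) := by
        refine Subgroup.list_prod_mem _ fun x hx => Subgroup.subset_closure ?_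
        obtain ⟨k, -, rfl⟩ := List.mem_map.mp hx
        exact ⟨k, rfl⟩
      refine ⟨t, by simp, ?_⟩
      rw [List.map_cons, List.prod_cons, mul_assoc, hconj _ h2 j i h1, ← mul_assoc, hs, one_mul]
    · obtain ⟨t', ht', h⟩ := ih ht
      exact ⟨i :: t', by simpa using ht', by simp [mul_assoc, h]⟩

/-- A product of simple reflections which preserves positivity is trivial. -/
theorem eq_one_of_forall_pos (neg : R → R) (hneg : ∀ r, pos (neg r) ↔ ¬pos r)
    (hs : ∀ j, s j * s j = 1) (hsa : ∀ j, act (s j) (a j) = neg (a j))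
    (hapos : ∀ j, pos (a j))
    (hcomm : ∀ g ∈ Subgroup.closure (Set.range s), ∀ r, act g (neg r) = neg (act g r))
    (hperm : ∀ j r, pos r → r ≠ a j → pos (act (s j) r))
    (hconj : ∀ g ∈ Subgroup.closure (Set.range s), ∀ i j, act g (a i) = a j → g * s i = s j * g)
    {g : G} (hg : g ∈ Subgroup.closure (Set.range s)) (hpos : ∀ r, pos r → pos (act g r)) :
    g = 1 := by
  obtain ⟨l, rfl⟩ := exists_list_of_mem_closure_range hs hg
  obtain ⟨n, hn⟩ : ∃ n, l.length = n := ⟨_, rfl⟩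
  induction n using Nat.strong_induction_on generalizing l with
  | _ n ih =>
    rcases l.eq_nil_or_concat with rfl | ⟨t, j, rfl⟩
    · simp
    · have ht : (t.map s).prod ∈ Subgroup.closure (Set.range s) := by
        refine Subgroup.list_prod_mem _ fun x hx => Subgroup.subset_closure ?_
        obtain ⟨k, -, rfl⟩ := List.mem_map.mp hx
        exact ⟨k, rfl⟩
      have h1 := hpos (a j) (hapos j)
      have h2 : ((t ++ [j]).map s).prod = (t.map s).prod * s j := by simp
      simp only [List.concat_eq_append] at h1 hn hg hpos ⊢
      -- The last letter negates a_j while the whole word keeps it positive, so the rest of the word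
      -- makes a_j negative. The exchange condition applies and rewrites the word as a shorter one.
      rw [h2, map_mul, Equiv.Perm.mul_apply, hsa, hcomm _ ht, hneg] at h1
      obtain ⟨t', ht', h3⟩ := exists_shorter_word act pos s a hs hapos hperm hconj t j h1
      rw [h2, h3] at hg hpos ⊢
      refine ih _ ?_ t' hg hpos rfl
      rw [List.length_append] at hn
      lia

end Exchange

/-! ### The affine Weyl group -/

variable (κ : ℕ)

/-- The value at `x` of the affine function `⟨x, α_i⟩ + m κ`, for the affine root `(i, m)`. -/
def affVal (a : ι × ℤ) (x : M) : ℝ := rePair b a.1 x + a.2 * κ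

/-- The element `κ α_i^∨` of the weight space, for the identification of the weight space with its
dual given by the fundamental form. -/
def coweight (i : ι) : M := ((κ / halfNorm b i : ℝ) : ℂ) • P.root i

/-- The affine reflection whose mirror is the zero set of the affine root `(i, m)`. -/
def affRefl (a : ι × ℤ) : Equiv.Perm M :=
  Function.Involutive.toPerm
    (fun x => P.reflection a.1 x - a.2 • coweight b κ a.1)
    (by intro x; simp [coweight])

theorem affRefl_apply (a : ι × ℤ) (x : M) :
    affRefl b κ a x = P.reflection a.1 x - a.2 • coweight b κ a.1 := rfl

theorem pairingIn_reflectionPerm_left (i j k : ι) : P.pairingIn ℤ (P.reflectionPerm j i) k =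
    P.pairingIn ℤ i k - P.pairingIn ℤ i j * P.pairingIn ℤ j k := by
  have h : P.pairing (P.reflectionPerm j i) k =
      P.pairing i k - P.pairing i j * P.pairing j k := by
    rw [← P.root_coroot'_eq_pairing, P.root_reflectionPerm, P.reflection_apply_root]
    simp
  simp only [pairing_eq_intCast] at h
  exact_mod_cast h

theorem pairingIn_reflectionPerm_right (i j k : ι) :
    P.pairingIn ℤ i (P.reflectionPerm j k) = P.pairingIn ℤ (P.reflectionPerm j i) k := by
  have h := P.pairing_reflectionPerm j i k
  simp only [pairing_eq_intCast] at h
  exact_mod_cast h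

/-- The action of an affine reflection on affine roots. -/
def affReflIdx (a : ι × ℤ) : Equiv.Perm (ι × ℤ) :=
  Function.Involutive.toPerm
    (fun c => (P.reflectionPerm a.1 c.1, c.2 - a.2 * P.pairingIn ℤ c.1 a.1)) (by
      intro c
      ext
      · simp
      · simp [pairingIn_reflectionPerm_left]; ring)

theorem affReflIdx_apply (a c : ι × ℤ) : affReflIdx (P := P) a c =
    (P.reflectionPerm a.1 c.1, c.2 - a.2 * P.pairingIn ℤ c.1 a.1) := rfl

theorem rePair_coweight (i k : ι) :
    rePair b k (coweight b κ i) = κ * P.pairingIn ℤ k i := by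
  rw [coweight, rePair_real_smul, rePair_root, ← halfNorm_mul_pairing]
  field_simp [halfNorm_ne_zero b i]

/-- The action on indices is defined so that evaluation of affine roots at points is invariant under
the simultaneous action. -/
theorem affVal_affRefl (a c : ι × ℤ) (x : M) :
    affVal b κ (affReflIdx (P := P) a c) (affRefl b κ a x) = affVal b κ c x := by
  have h : a.2 • coweight b κ a.1 = ((a.2 : ℝ) : ℂ) • coweight b κ a.1 := by
    simp [Int.cast_smul_eq_zsmul]
  rw [affVal, affVal, affReflIdx_apply, affRefl_apply, rePair_sub, rePair_reflection, h,
    rePair_real_smul, rePair_coweight]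
  simp [pairingIn_reflectionPerm_left]
  ring

theorem coweight_reflectionPerm (i k : ι) :
    coweight b κ (P.reflectionPerm i k) = P.reflection i (coweight b κ k) := by
  rw [coweight, coweight, map_smul, halfNorm_reflectionPerm, P.root_reflectionPerm]

theorem coroot'_coweight (i k : ι) : P.coroot' k (coweight b κ i) =
    ((κ / halfNorm b k : ℝ) : ℂ) * P.pairingIn ℤ k i := by
  have h := halfNorm_mul_pairing b i k
  rw [coweight, map_smul, P.root_coroot'_eq_pairing, pairing_eq_intCast, smul_eq_mul]
  have : (κ / halfNorm b i : ℝ) * P.pairingIn ℤ i k = (κ / halfNorm b k : ℝ) * P.pairingIn ℤ k i := by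
    have := halfNorm_ne_zero b i
    have := halfNorm_ne_zero b k
    field_simp
    linear_combination -(κ : ℝ) * h
  exact_mod_cast this

theorem reflection_coweight (i k : ι) : P.reflection k (coweight b κ i) =
    coweight b κ i - P.pairingIn ℤ k i • coweight b κ k := by
  rw [P.reflection_apply, coroot'_coweight, ← Int.cast_smul_eq_zsmul ℂ, coweight, coweight,
    smul_smul, mul_comm]

/-- An affine reflection, together with its action on affine roots. -/
def affReflPair (a : ι × ℤ) : Equiv.Perm M × Equiv.Perm (ι × ℤ) :=
  (affRefl b κ a, affReflIdx (P := P) a)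

theorem affReflPair_mul_self (a : ι × ℤ) : affReflPair b κ a * affReflPair b κ a = 1 := by
  refine Prod.ext (Equiv.ext fun x => ?_) (Equiv.ext fun x => ?_)
  · exact (affRefl b κ a).left_inv x
  · exact (affReflIdx (P := P) a).left_inv x

/-- Carrying both actions lets the exchange argument run on affine roots while its conclusion also
concerns the transformations of the weight space. -/
theorem affReflPair_conj (a c : ι × ℤ) :
    affReflPair b κ a * affReflPair b κ c * affReflPair b κ a =
      affReflPair b κ (affReflIdx (P := P) a c) := by
  refine Prod.ext (Equiv.ext fun x => ?_) (Equiv.ext fun ⟨l, q⟩ => ?_)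
  · change affRefl b κ a (affRefl b κ c (affRefl b κ a x)) = affRefl b κ (affReflIdx a c) x
    simp only [affRefl_apply, affReflIdx_apply, P.reflection_reflectionPerm, map_sub, map_zsmul,
      coweight_reflectionPerm, LinearEquiv.mul_apply, reflection_coweight b κ a.1 c.1]
    have : P.reflection a.1 (coweight b κ a.1) = - coweight b κ a.1 := by simp [coweight]
    rw [this]
    have h : P.reflection a.1 (coweight b κ c.1) =
      coweight b κ c.1 - P.pairingIn ℤ a.1 c.1 • coweight b κ a.1 := reflection_coweight b κ _ _
    rw [h]
    module
  · change affReflIdx (P := P) a (affReflIdx (P := P) c (affReflIdx (P := P) a (l, q))) =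
      affReflIdx (P := P) (affReflIdx (P := P) a c) (l, q)
    simp only [affReflIdx_apply, pairingIn_reflectionPerm_left, pairingIn_reflectionPerm_right]
    refine Prod.ext (P.root.injective ?_) ?_
    · simp [P.reflection_reflectionPerm]
    · simp
      ring

variable (κ : ℕ)

/-! ### Simple affine roots and generation by simple reflections -/

/-- The simple affine roots: the simple roots, and `κ - θ`. -/
def simpleAff : Option b.support → ι × ℤ
  | none => (P.reflectionPerm (highestRoot b) (highestRoot b), 1)
  | some j => (j, 0)

/-- Positivity of affine roots. -/
def AffPos (a : ι × ℤ) : Prop := 0 < a.2 ∨ (a.2 = 0 ∧ b.IsPos a.1)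

/-- The negative of an affine root. -/
def affNeg (a : ι × ℤ) : ι × ℤ := (P.reflectionPerm a.1 a.1, -a.2)

theorem isPos_neg_iff (i : ι) : b.IsPos (P.reflectionPerm i i) ↔ ¬b.IsPos i :=
  RootPairing.Base.IsPos.neg_iff_not b i

theorem height_neg (i : ι) : b.height (P.reflectionPerm i i) = -b.height i :=
  b.height_reflectionPerm_self i

theorem affPos_affNeg (a : ι × ℤ) : AffPos b (affNeg (P := P) a) ↔ ¬AffPos b a := by
  simp only [AffPos, affNeg, isPos_neg_iff]
  rcases lt_trichotomy a.2 0 with h | h | h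
  · simp [h, h.ne, h.le]
  · simp [h]
  · simp [h, h.ne', h.le]

theorem affPos_simpleAff (j : Option b.support) : AffPos b (simpleAff b j) := by
  cases j with
  | none => left; simp [simpleAff]
  | some j => right; exact ⟨rfl, RootPairing.Base.isPos_of_mem_support j.2⟩

theorem affReflIdx_self (a : ι × ℤ) : affReflIdx (P := P) a a = affNeg (P := P) a := by
  rw [affReflIdx_apply, affNeg]
  simp; ring

theorem affReflIdx_affNeg (a c : ι × ℤ) :
    affReflIdx (P := P) a (affNeg (P := P) c) = affNeg (P := P) (affReflIdx (P := P) a c) := by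
  simp only [affReflIdx_apply, affNeg, pairingIn_reflectionPerm_left]
  refine Prod.ext (P.root.injective ?_) ?_
  · change P.root (P.reflectionPerm a.1 (P.reflectionPerm c.1 c.1)) =
      P.root (P.reflectionPerm (P.reflectionPerm a.1 c.1) (P.reflectionPerm a.1 c.1))
    rw [P.root_reflectionPerm (P.reflectionPerm a.1 c.1), P.reflection_apply_self]
    simp
  · simp; ring

theorem neg_le_height (i : ι) : -b.height (highestRoot b) ≤ b.height i := by
  have := height_le_highestRoot b (P.reflectionPerm i i)
  rw [height_neg] at this
  lia

theorem pairingIn_highestRoot_nonneg_of_isPos {i : ι} (hi : b.IsPos i) :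
    0 ≤ P.pairingIn ℤ i (highestRoot b) := by
  have h := rePair_nonneg_of_isPos b (x := P.root (highestRoot b)) (fun j => by
    rw [rePair_highestRoot]
    have h1 := pairingIn_highestRoot_nonneg b j
    have h2 : ¬P.pairingIn ℤ j (highestRoot b) < 0 := by
      rw [P.pairingIn_lt_zero_iff]; lia
    exact_mod_cast not_lt.mp h2) hi
  rw [rePair_highestRoot] at h
  exact_mod_cast h

/-- For the affine simple root (-θ, 1), reflection sends (α, m) to (s_θ α, m + ⟨α,θ^∨⟩). Apart from
α = ±θ the shift is at most one in absolute value, since θ is long. So a positive m can drop at most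
to zero, and then the new root is α + θ, which is positive because no height lies below that of -θ.
-/
theorem affPos_affReflIdx_simpleAff (j : Option b.support) (a : ι × ℤ) (ha : AffPos b a)
    (hne : a ≠ simpleAff b j) : AffPos b (affReflIdx (P := P) (simpleAff b j) a) := by
  obtain ⟨i, m⟩ := a
  cases j with
  | some j =>
    rw [affReflIdx_apply]
    simp only [AffPos, simpleAff, zero_mul, sub_zero] at ha ⊢
    refine ha.imp_right fun ⟨h1, h2⟩ => ⟨h1, h2.reflectionPerm j.2 ?_⟩
    rintro rfl
    exact hne (by simp [simpleAff, h1])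
  | none =>
    have hθ := isPos_highestRoot b
    rw [affReflIdx_apply]
    simp only [simpleAff, one_mul, pairingIn_reflectionPerm_right]
    have hr : P.reflectionPerm (P.reflectionPerm (highestRoot b) (highestRoot b)) i =
        P.reflectionPerm (highestRoot b) i := P.root.injective (by
      simp [P.reflection_apply]; module)
    rw [hr]
    have hp : P.pairingIn ℤ (P.reflectionPerm (highestRoot b) i) (highestRoot b) =
        -P.pairingIn ℤ i (highestRoot b) := by
      rw [pairingIn_reflectionPerm_left]; simp; ring
    rw [hp, sub_neg_eq_add]
    by_cases h1 : i = highestRoot b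
    · subst h1
      left
      have : 0 ≤ m := by rcases ha with h | h <;> [exact h.le; exact h.1.ge]
      simp; lia
    by_cases h2 : P.root i = -P.root (highestRoot b)
    · rw [RootPairing.root_eq_neg_iff] at h2
      subst h2
      have h3 : ¬b.IsPos (P.reflectionPerm (highestRoot b) (highestRoot b)) := by
        rw [isPos_neg_iff, not_not]; exact hθ
      have h4 : 0 < m := by
        rcases ha with h | h
        · exact h
        · exact absurd h.2 h3
      -- Level one at -θ is the excluded simple root itself. Level two goes to (θ, 0), and higher
      -- levels stay positive.
      have h5 : m ≠ 1 := by rintro rfl; exact hne rfl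
      simp only [AffPos, P.reflectionPerm_self]
      simp only [RootPairing.pairingIn_reflectionPerm_self_left, RootPairing.pairingIn_same]
      by_cases h6 : m = 2
      · right; exact ⟨by lia, hθ⟩
      · left; lia
    have h3 := abs_le.mp (abs_pairingIn_highestRoot_le_one b h1 h2)
    have hh : b.height (P.reflectionPerm (highestRoot b) i) =
        b.height i - P.pairingIn ℤ i (highestRoot b) * b.height (highestRoot b) := by
      have h : P.root (P.reflectionPerm (highestRoot b) i) =
          P.root i + (-P.pairingIn ℤ i (highestRoot b)) • P.root (highestRoot b) := by
        rw [P.root_reflectionPerm, P.reflection_apply_root, pairing_eq_intCast, neg_smul,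
          Int.cast_smul_eq_zsmul, sub_eq_add_neg]
      rw [b.height_add_zsmul h, smul_eq_mul]; ring
    have h4 := neg_le_height b i
    simp only [AffPos] at ha ⊢
    rw [RootPairing.Base.isPos_iff', hh]
    rcases ha with hm | ⟨hm, hi⟩
    · by_cases h5 : m + P.pairingIn ℤ i (highestRoot b) = 0
      · right
        have : P.pairingIn ℤ i (highestRoot b) = -1 := by lia
        rw [this]
        exact ⟨by lia, by lia⟩
      · left; lia
    · have h5 := pairingIn_highestRoot_nonneg_of_isPos b hi
      by_cases h6 : P.pairingIn ℤ i (highestRoot b) = 0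
      · right
        rw [h6]
        rw [RootPairing.Base.isPos_iff] at hi
        exact ⟨by lia, by lia⟩
      · left; lia

/-- The subgroup generated by the simple affine reflections. -/
def simpleAffGroup : Subgroup (Equiv.Perm M × Equiv.Perm (ι × ℤ)) :=
  Subgroup.closure (Set.range fun j => affReflPair b κ (simpleAff b j))

/-- The height of an affine root. -/
def affHeight (a : ι × ℤ) : ℤ := b.height a.1 + a.2 * (b.height (highestRoot b) + 1)

theorem affHeight_pos {a : ι × ℤ} (ha : AffPos b a) : 0 < affHeight b a := by
  have h1 := isPos_highestRoot b
  rw [RootPairing.Base.isPos_iff] at h1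
  have h2 := neg_le_height b a.1
  rcases ha with h | ⟨h, h'⟩
  · have : b.height (highestRoot b) + 1 ≤ a.2 * (b.height (highestRoot b) + 1) :=
      le_mul_of_one_le_left (by lia) h
    rw [affHeight]; lia
  · rw [affHeight, h]; simpa [RootPairing.Base.isPos_iff] using h'

/-- The weight ht θ + 1 given to the level makes every simple affine root have affine height one. -/
theorem affHeight_affReflIdx (j : Option b.support) (a : ι × ℤ) :
    affHeight b (affReflIdx (P := P) (simpleAff b j) a) =
      affHeight b a - P.pairingIn ℤ a.1 (simpleAff b j).1 := by
  have h : P.root (P.reflectionPerm (simpleAff b j).1 a.1) =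
      P.root a.1 + (-P.pairingIn ℤ a.1 (simpleAff b j).1) • P.root (simpleAff b j).1 := by
    rw [P.root_reflectionPerm, P.reflection_apply_root, pairing_eq_intCast, neg_smul,
      Int.cast_smul_eq_zsmul, sub_eq_add_neg]
  rw [affReflIdx_apply, affHeight, affHeight, b.height_add_zsmul h]
  cases j with
  | none => simp only [simpleAff, height_neg, smul_eq_mul]; ring
  | some j =>
    simp only [simpleAff, RootPairing.Base.height_one_of_mem_support j.2, smul_eq_mul]
    ring

/-- Otherwise the pairing with θ is nonnegative, yet it is a positive combination of nonpositive
pairings with the simple roots. All of these vanish, although a root pairs nontrivially with some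
simple root. -/
theorem exists_pairingIn_simpleAff_pos (i : ι) :
    ∃ j, 0 < P.pairingIn ℤ i (simpleAff b j).1 := by
  by_contra! h
  have h0 : 0 ≤ P.pairingIn ℤ i (highestRoot b) := by
    have := h none
    rw [simpleAff, RootPairing.pairingIn_reflectionPerm_self_right] at this
    lia
  have h1 : (0 : ℝ) ≤ rePair b (highestRoot b) (P.root i) := by
    rw [rePair_root, halfNorm_highestRoot]; simpa using h0
  have h2 : ∀ j : b.support, (coef b (highestRoot b) j : ℝ) * rePair b j (P.root i) ≤ 0 := fun j => by
    refine mul_nonpos_of_nonneg_of_nonpos (by exact_mod_cast (coef_highestRoot_pos b j).le) ?_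
    rw [rePair_root]
    exact mul_nonpos_of_nonneg_of_nonpos (halfNorm_pos b _).le (by exact_mod_cast h (some j))
  rw [rePair_eq_sum_coef] at h1
  have h3 := (Finset.sum_eq_zero_iff_of_nonpos fun j _ => h2 j).mp
    (le_antisymm (Finset.sum_nonpos fun j _ => h2 j) h1)
  obtain ⟨j, hj, hj'⟩ := b.exists_mem_support_pos_pairingIn_ne_zero i
  have h4 := h3 ⟨j, hj⟩ (Finset.mem_univ _)
  have h5 : (coef b (highestRoot b) ⟨j, hj⟩ : ℝ) ≠ 0 := by
    exact_mod_cast (coef_highestRoot_pos b _).ne'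
  rw [mul_eq_zero, or_iff_right h5, rePair_root, mul_eq_zero,
    or_iff_right (halfNorm_ne_zero b _)] at h4
  apply hj'
  have h6 : P.pairingIn ℤ i j = 0 := by exact_mod_cast h4
  first
    | exact h6
    | (rw [P.pairingIn_eq_zero_iff]; exact h6)

theorem affReflPair_affNeg (a : ι × ℤ) :
    affReflPair b κ (affNeg (P := P) a) = affReflPair b κ a := by
  rw [← affReflIdx_self, ← affReflPair_conj, affReflPair_mul_self, one_mul]

/-- Descent on the affine height: conjugating by a suitable simple reflection keeps the affine root
positive and lowers its height, until it becomes simple. -/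
theorem affReflPair_mem (a : ι × ℤ) : affReflPair b κ a ∈ simpleAffGroup b κ := by
  wlog ha : AffPos b a generalizing a
  · rw [← affReflPair_affNeg]
    exact this _ ((affPos_affNeg b a).mpr ha)
  obtain ⟨n, hn⟩ : ∃ n, (affHeight b a).toNat = n := ⟨_, rfl⟩
  induction n using Nat.strong_induction_on generalizing a with
  | _ n ih =>
    obtain ⟨j, hj⟩ := exists_pairingIn_simpleAff_pos b a.1
    have hmem : affReflPair b κ (simpleAff b j) ∈ simpleAffGroup b κ :=
      Subgroup.subset_closure ⟨j, rfl⟩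
    by_cases h : a = simpleAff b j
    · rw [h]; exact hmem
    have h1 := affPos_affReflIdx_simpleAff b j a ha h
    have h2 := affHeight_affReflIdx b j a
    have h3 := affHeight_pos b h1
    have h4 := ih _ (by lia) _ h1 rfl
    rw [← affReflPair_conj] at h4
    have h5 := mul_mem (mul_mem hmem h4) hmem
    have h6 := affReflPair_mul_self b κ (simpleAff b j)
    simp only [mul_assoc] at h5
    rwa [h6, ← mul_assoc, h6, one_mul, mul_one] at h5

theorem conj_affReflPair {g : Equiv.Perm M × Equiv.Perm (ι × ℤ)} (hg : g ∈ simpleAffGroup b κ)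
    (c : ι × ℤ) : g * affReflPair b κ c * g⁻¹ = affReflPair b κ (g.2 c) := by
  induction hg using Subgroup.closure_induction generalizing c with
  | mem x hx =>
    obtain ⟨j, rfl⟩ := hx
    have : (affReflPair b κ (simpleAff b j))⁻¹ = affReflPair b κ (simpleAff b j) :=
      inv_eq_of_mul_eq_one_left (affReflPair_mul_self b κ _)
    simp only [this, affReflPair_conj]
    rfl
  | one => simp
  | mul x y _ _ hx hy =>
    rw [Prod.snd_mul, Equiv.Perm.mul_apply, ← hx, ← hy]
    group
  | inv x _ hx =>
    have h := hx (x⁻¹.2 c)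
    have h' : x.2 (x⁻¹.2 c) = c := by simp
    rw [h'] at h
    rw [← h]
    group

theorem simpleAffGroup_affNeg {g : Equiv.Perm M × Equiv.Perm (ι × ℤ)}
    (hg : g ∈ simpleAffGroup b κ) (c : ι × ℤ) :
    g.2 (affNeg (P := P) c) = affNeg (P := P) (g.2 c) := by
  induction hg using Subgroup.closure_induction generalizing c with
  | mem x hx =>
    obtain ⟨j, rfl⟩ := hx
    exact affReflIdx_affNeg _ _
  | one => simp
  | mul x y _ _ hx hy => simp [hx, hy]
  | inv x _ hx =>
    have h := hx (x⁻¹.2 c)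
    apply x.2.injective
    rw [h]
    simp

theorem affVal_simpleAffGroup {g : Equiv.Perm M × Equiv.Perm (ι × ℤ)}
    (hg : g ∈ simpleAffGroup b κ) (c : ι × ℤ) (x : M) :
    affVal b κ (g.2 c) (g.1 x) = affVal b κ c x := by
  induction hg using Subgroup.closure_induction generalizing c x with
  | mem y hy =>
    obtain ⟨j, rfl⟩ := hy
    exact affVal_affRefl b κ _ c x
  | one => simp
  | mul y z _ _ hy hz => simp [hy, hz]
  | inv y _ hy =>
    have h := hy (y⁻¹.2 c) (y⁻¹.1 x)
    have h1 : y.2 (y⁻¹.2 c) = c := by simp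
    have h2 : y.1 (y⁻¹.1 x) = x := by simp
    rw [h1, h2] at h
    exact h.symm

theorem eq_one_of_forall_affPos {g : Equiv.Perm M × Equiv.Perm (ι × ℤ)}
    (hg : g ∈ simpleAffGroup b κ) (hpos : ∀ c, AffPos b c → AffPos b (g.2 c)) : g = 1 :=
  eq_one_of_forall_pos (MonoidHom.snd _ _) (AffPos b)
    (fun j => affReflPair b κ (simpleAff b j)) (simpleAff b) (affNeg (P := P)) (affPos_affNeg b)
    (fun _ => affReflPair_mul_self b κ _) (fun _ => affReflIdx_self _) (affPos_simpleAff b)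
    (fun _ hg r => simpleAffGroup_affNeg b κ hg r) (affPos_affReflIdx_simpleAff b)
    (fun g hg i j h => by
      have h1 := conj_affReflPair b κ hg (simpleAff b i)
      rw [mul_inv_eq_iff_eq_mul] at h1
      rw [h1]
      exact congrArg (affReflPair b κ · * g) h) hg hpos

/-! ### The alcove and freeness of the action -/

/-- The open fundamental alcove. -/
def alcove : Set M := {x | (∀ j : b.support, 0 < rePair b j x) ∧ rePair b (highestRoot b) x < κ}

-- At positive level, the value is at least κ minus the pairing of x with the opposite root, and
-- that pairing is at most ⟨x,θ⟩ < κ because x is dominant.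
variable {κ} in
theorem affVal_pos_of_affPos {x : M} (hx : x ∈ alcove b κ) {a : ι × ℤ} (ha : AffPos b a) :
    0 < affVal b κ a x := by
  have hx0 : ∀ j : b.support, 0 ≤ rePair b j x := fun j => (hx.1 j).le
  rcases ha with h | ⟨h, h'⟩
  · have h1 := rePair_le_highestRoot b hx0 (P.reflectionPerm a.1 a.1)
    rw [rePair_neg_index] at h1
    have h2 : (κ : ℝ) ≤ a.2 * κ :=
      le_mul_of_one_le_left (Nat.cast_nonneg _) (by exact_mod_cast h)
    have := hx.2
    rw [affVal]; linarith
  · rw [affVal, h, rePair_eq_sum_coef]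
    have h1 : 0 < ∑ j : b.support, coef b a.1 j := by rw [← height_eq_sum_coef]; exact h'
    obtain ⟨j, hj⟩ : ∃ j, 0 < coef b a.1 j := by
      by_contra! hc
      exact absurd h1 (not_lt.mpr (Finset.sum_nonpos fun j _ => hc j))
    have h2 := Finset.sum_pos' (s := Finset.univ)
      (f := fun j : b.support => (coef b a.1 j : ℝ) * rePair b j x)
      (fun k _ => mul_nonneg (by exact_mod_cast coef_nonneg b h' k) (hx0 k))
      ⟨j, Finset.mem_univ _, mul_pos (by exact_mod_cast hj) (hx.1 j)⟩
    simpa using h2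

theorem affVal_affNeg (a : ι × ℤ) (x : M) : affVal b κ (affNeg (P := P) a) x = -affVal b κ a x := by
  simp [affVal, affNeg, rePair_neg_index]; ring

variable {κ} in
theorem affVal_pos_iff {x : M} (hx : x ∈ alcove b κ) {a : ι × ℤ} :
    0 < affVal b κ a x ↔ AffPos b a := by
  refine ⟨fun h => ?_, affVal_pos_of_affPos b hx⟩
  by_contra ha
  have := affVal_pos_of_affPos b hx ((affPos_affNeg b a).mpr ha)
  rw [affVal_affNeg] at this
  linarith

/-- The affine Weyl group. -/
def affineWeyl : Subgroup (Equiv.Perm M) := Subgroup.closure (Set.range (affRefl b κ))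

theorem exists_pair_of_mem_affineWeyl {f : Equiv.Perm M} (hf : f ∈ affineWeyl b κ) :
    ∃ g ∈ simpleAffGroup b κ, g.1 = f := by
  have : affineWeyl b κ ≤ (simpleAffGroup b κ).map (MonoidHom.fst _ _) := by
    rw [affineWeyl, Subgroup.closure_le]
    rintro _ ⟨a, rfl⟩
    exact ⟨affReflPair b κ a, affReflPair_mem b κ a, rfl⟩
  exact this hf

variable {κ} in
/-- The affine Weyl group acts freely on the alcoves. -/
theorem eq_one_of_mem_alcove {f : Equiv.Perm M} (hf : f ∈ affineWeyl b κ) {x : M}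
    (hx : x ∈ alcove b κ) (hfx : f x ∈ alcove b κ) : f = 1 := by
  obtain ⟨g, hg, rfl⟩ := exists_pair_of_mem_affineWeyl b κ hf
  -- At a point of the alcove the sign of an affine root tells whether it is positive. Since both x
  -- and its image lie there, the element preserves positivity.
  have := eq_one_of_forall_affPos b κ hg fun c hc => by
    rw [← affVal_pos_iff b hfx, affVal_simpleAffGroup b κ hg]
    exact affVal_pos_of_affPos b hx hc
  rw [this]; rfl

/-! ### Weights -/

variable (P) in
/-- The weight lattice. -/
def weightLattice : AddSubgroup M where
  carrier := {x | ∀ i, ∃ n : ℤ, P.coroot' i x = n}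
  zero_mem' i := ⟨0, by simp⟩
  add_mem' hx hy i := by
    obtain ⟨m, hm⟩ := hx i
    obtain ⟨n, hn⟩ := hy i
    exact ⟨m + n, by rw [map_add, hm, hn]; push_cast; rfl⟩
  neg_mem' hx i := by
    obtain ⟨m, hm⟩ := hx i
    exact ⟨-m, by rw [map_neg, hm]; push_cast; rfl⟩

theorem root_mem_weightLattice (i : ι) : P.root i ∈ weightLattice P := fun j =>
  ⟨P.pairingIn ℤ i j, by rw [P.root_coroot'_eq_pairing, pairing_eq_intCast]⟩

theorem weylVector_mem_weightLattice : weylVector b ∈ weightLattice P := fun j =>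
  ⟨b.flip.height j, coroot'_weylVector_eq b j⟩

/-- This is where the normalization ⟨θ,θ⟩ = 2 matters: the inverses of the half norms are integers.
-/
theorem coweight_mem_weightLattice (κ : ℕ) (i : ι) : coweight b κ i ∈ weightLattice P := fun j => by
  obtain ⟨n, hn⟩ := exists_halfNorm_inv b j
  refine ⟨κ * n * P.pairingIn ℤ j i, ?_⟩
  rw [coroot'_coweight, div_eq_mul_inv, hn]
  push_cast
  rfl

theorem reflection_mem_weightLattice (i : ι) {x : M} (hx : x ∈ weightLattice P) :
    P.reflection i x ∈ weightLattice P := fun j => by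
  rw [P.coroot'_reflection]
  exact hx _

theorem affRefl_mem_weightLattice (κ : ℕ) (a : ι × ℤ) {x : M} (hx : x ∈ weightLattice P) :
    affRefl b κ a x ∈ weightLattice P :=
  sub_mem (reflection_mem_weightLattice a.1 hx)
    (zsmul_mem (coweight_mem_weightLattice b κ a.1) _)

theorem eq_zero_of_coroot' {x : M} (h : ∀ j : b.support, P.coroot' j x = 0) : x = 0 := by
  apply P.toPerfPair.injective
  rw [map_zero]
  refine b.toCoweightBasis.ext fun j => ?_
  rw [b.toCoweightBasis_apply]
  exact h j

theorem coroot'_fundWeight [DecidableEq b.support] (i j : b.support) :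
    P.coroot' i (fundWeight b j) = if i = j then 1 else 0 := by
  have h : P.coroot' i (fundWeight b j) = P.toPerfPair (fundWeight b j) (P.coroot i) := rfl
  rw [h, fundWeight, LinearEquiv.apply_symm_apply, ← b.toCoweightBasis_apply,
    Module.Basis.coord_apply, Module.Basis.repr_self, Finsupp.single_apply]

theorem eq_sum_fundWeight (x : M) : x = ∑ j : b.support, P.coroot' j x • fundWeight b j := by
  classical
  rw [← sub_eq_zero]
  refine eq_zero_of_coroot' b fun j => ?_
  simp [-LinearMap.flip_apply, coroot'_fundWeight]

/-- Every coroot is an integral combination of simple coroots. -/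
theorem coroot'_mem_of_support {x : M} (h : ∀ j : b.support, ∃ n : ℤ, P.coroot' j x = n) :
    x ∈ weightLattice P := by
  intro i
  choose n hn using h
  refine ⟨∑ j : b.support, coef b.flip i j * n j, ?_⟩
  have h := congrArg (P.toLinearMap x) (root_eq_sum_coef b.flip i)
  rw [map_sum] at h
  refine h.trans ?_
  push_cast
  refine Finset.sum_congr rfl fun j _ => ?_
  rw [map_zsmul, zsmul_eq_mul]
  exact congrArg (_ * ·) (hn j)

theorem fundWeight_mem_weightLattice (j : b.support) : fundWeight b j ∈ weightLattice P := by
  classical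
  refine coroot'_mem_of_support b fun i => ?_
  rw [coroot'_fundWeight]
  exact ⟨if i = j then 1 else 0, by split_ifs <;> simp⟩

/-! ### Moving a weight to the fundamental alcove -/

/-- The canonical form at (x, x) is the sum of the squares of the pairings with all coroots. Its
integrality makes squared distances between weights available for descent. -/
theorem exists_rootForm_eq_nat {x : M} (hx : x ∈ weightLattice P) :
    ∃ n : ℕ, P.RootForm x x = n := by
  choose c hc using hx
  refine ⟨∑ i, (c i).natAbs ^ 2, ?_⟩
  rw [P.rootForm_apply_apply]
  push_cast
  refine Finset.sum_congr rfl fun i _ => ?_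
  rw [hc, ← sq]
  rw [← Int.cast_natCast, ← Int.cast_pow, ← Int.cast_pow, Int.natAbs_sq]

/-- On weights the pairing is already real, so passing to its real part loses nothing. -/
theorem rePair_mul_eq {x : M} (hx : x ∈ weightLattice P) (i : ι) :
    (rePair b i x : ℂ) = halfNorm b i * P.coroot' i x := by
  obtain ⟨n, hn⟩ := hx i
  rw [rePair_eq, hn]
  simp

/-- The change in squared distance has the sign of the product of the values at x and y. So
reflecting x in a mirror that separates it from y brings it closer to y. -/
theorem rootForm_affRefl_sub (κ : ℕ) (a : ι × ℤ) {x y : M} (hx : x ∈ weightLattice P)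
    (hy : y ∈ weightLattice P) :
    P.RootForm (affRefl b κ a x - y) (affRefl b κ a x - y) = P.RootForm (x - y) (x - y) +
      (lengthSq P a.1 * affVal b κ a x * affVal b κ a y / halfNorm b a.1 ^ 2 : ℝ) := by
  have hd : (halfNorm b a.1 : ℂ) ≠ 0 := by exact_mod_cast halfNorm_ne_zero b a.1
  have h1 : affRefl b κ a x - y =
      (x - y) - ((affVal b κ a x : ℂ) / halfNorm b a.1) • P.root a.1 := by
    rw [affRefl_apply, P.reflection_apply, affVal]
    push_cast
    rw [rePair_mul_eq b hx, coweight, ← Int.cast_smul_eq_zsmul ℂ, smul_smul]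
    have : (halfNorm b a.1 * P.coroot' a.1 x + a.2 * κ) / (halfNorm b a.1 : ℂ) =
        P.coroot' a.1 x + a.2 * (κ / halfNorm b a.1 : ℝ) := by
      push_cast; field_simp
    rw [this]
    module
  have h2 := two_mul_rootForm_root (P := P) (x - y) a.1
  have h3 := rootForm_root_self_eq (P := P) a.1
  have h4 : P.RootForm (P.root a.1) (x - y) = P.RootForm (x - y) (P.root a.1) :=
    P.rootForm_symmetric.eq (x - y) (P.root a.1) |>.symm
  have h5 : P.coroot' a.1 (x - y) =
      ((affVal b κ a x : ℂ) - affVal b κ a y) / halfNorm b a.1 := by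
    rw [affVal, affVal, map_sub]
    push_cast
    rw [rePair_mul_eq b hx, rePair_mul_eq b hy]
    field_simp
    ring
  rw [h5] at h2
  rw [h1]
  generalize x - y = z at h2 h4 ⊢
  simp only [map_sub, map_smul, LinearMap.sub_apply, LinearMap.smul_apply, smul_eq_mul]
  push_cast
  linear_combination -((affVal b κ a x : ℂ) / halfNorm b a.1) * h2 -
    ((affVal b κ a x : ℂ) / halfNorm b a.1) * h4 +
    ((affVal b κ a x : ℂ) / halfNorm b a.1) ^ 2 * h3

variable {κ : ℕ}

/-- While x is on the wrong side of a wall of the alcove, reflecting in that wall brings it closer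
to ρ. The squared distance to ρ is a natural number, so this ends. -/
theorem exists_mem_closed_alcove (hκ : weylVector b ∈ alcove b κ) {x : M}
    (hx : x ∈ weightLattice P) :
    ∃ f ∈ affineWeyl b κ, f x ∈ weightLattice P ∧
      ∀ j, 0 ≤ affVal b κ (simpleAff b j) (f x) := by
  obtain ⟨n, hn⟩ := exists_rootForm_eq_nat (sub_mem hx (weylVector_mem_weightLattice b))
  induction n using Nat.strong_induction_on generalizing x with
  | _ n ih =>
    by_cases h : ∀ j, 0 ≤ affVal b κ (simpleAff b j) x
    · exact ⟨1, one_mem _, hx, h⟩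
    push Not at h
    obtain ⟨j, hj⟩ := h
    have hx' := affRefl_mem_weightLattice b κ (simpleAff b j) hx
    obtain ⟨m, hm⟩ := exists_rootForm_eq_nat (sub_mem hx' (weylVector_mem_weightLattice b))
    have h1 := rootForm_affRefl_sub b κ (simpleAff b j) hx (weylVector_mem_weightLattice b)
    rw [hm, hn] at h1
    have h2 : (m : ℝ) = n + (lengthSq P (simpleAff b j).1 * affVal b κ (simpleAff b j) x *
      affVal b κ (simpleAff b j) (weylVector b) / halfNorm b (simpleAff b j).1 ^ 2 : ℝ) := by
      exact_mod_cast h1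
    have h3 := affVal_pos_of_affPos b hκ (affPos_simpleAff b j)
    have h4 : (0 : ℝ) < lengthSq P (simpleAff b j).1 := by exact_mod_cast lengthSq_pos _
    have h5 : (m : ℝ) < n := by
      rw [h2]
      have := div_neg_of_neg_of_pos (mul_neg_of_neg_of_pos (mul_neg_of_pos_of_neg h4 hj) h3)
        (pow_pos (halfNorm_pos b (simpleAff b j).1) 2)
      linarith
    obtain ⟨f, hf, h6, h7⟩ := ih m (by exact_mod_cast h5) hx' hm
    exact ⟨f * affRefl b κ (simpleAff b j),
      mul_mem hf (Subgroup.subset_closure ⟨_, rfl⟩), h6, h7⟩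

/-- The product of the sines `|2 sin (π⟨x, α⟩ / κ)|`, over all roots. -/
def sinProd (κ : ℕ) (x : M) : ℝ := ∏ i, |2 * Real.sin (Real.pi * rePair b i x / κ)|

theorem abs_sin_sub_int_mul_pi (x : ℝ) (n : ℤ) :
    |Real.sin (x - n * Real.pi)| = |Real.sin x| := by
  rw [Real.sin_sub_int_mul_pi, abs_mul, abs_zpow]; simp

/-- The linear part permutes the roots and the translation moves each argument by an integral
multiple of π, which the absolute values absorb. -/
theorem sinProd_affRefl (hκ : κ ≠ 0) (a : ι × ℤ) (x : M) :
    sinProd b κ (affRefl b κ a x) = sinProd b κ x := by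
  refine Fintype.prod_equiv (P.reflectionPerm a.1) _ _ fun i => ?_
  have hκ' : (κ : ℝ) ≠ 0 := by exact_mod_cast hκ
  have h : a.2 • coweight b κ a.1 = ((a.2 : ℝ) : ℂ) • coweight b κ a.1 := by
    simp [Int.cast_smul_eq_zsmul]
  rw [affRefl_apply, rePair_sub, rePair_reflection, h, rePair_real_smul, rePair_coweight]
  have : Real.pi * (rePair b (P.reflectionPerm a.1 i) x - a.2 * (κ * P.pairingIn ℤ i a.1)) / κ =
      Real.pi * rePair b (P.reflectionPerm a.1 i) x / κ -
        ((a.2 * P.pairingIn ℤ i a.1 : ℤ) : ℝ) * Real.pi := by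
    push_cast; field_simp
  rw [this, abs_mul, abs_mul, abs_sin_sub_int_mul_pi]

theorem sinProd_affineWeyl (hκ : κ ≠ 0) {f : Equiv.Perm M} (hf : f ∈ affineWeyl b κ) (x : M) :
    sinProd b κ (f x) = sinProd b κ x := by
  induction hf using Subgroup.closure_induction generalizing x with
  | mem y hy => obtain ⟨a, rfl⟩ := hy; exact sinProd_affRefl b hκ a x
  | one => rfl
  | mul y z _ _ hy hz => rw [Equiv.Perm.mul_apply, hy, hz]
  | inv y _ hy =>
    have h : y (y⁻¹ x) = x := by simp
    rw [← hy, h]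

theorem sinProd_eq_zero (hκ : κ ≠ 0) {a : ι × ℤ} {x : M} (h : affVal b κ a x = 0) :
    sinProd b κ x = 0 := by
  refine Finset.prod_eq_zero (Finset.mem_univ a.1) ?_
  have hκ' : (κ : ℝ) ≠ 0 := by exact_mod_cast hκ
  have h1 : Real.pi * rePair b a.1 x / κ = ((-a.2 : ℤ) : ℝ) * Real.pi := by
    have : rePair b a.1 x = -(a.2 * κ) := by rw [affVal] at h; linarith
    rw [this]; push_cast; field_simp
  rw [h1, Real.sin_int_mul_pi]; simp

theorem mem_alcove_iff {x : M} :
    x ∈ alcove b κ ↔ ∀ j, 0 < affVal b κ (simpleAff b j) x := by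
  refine ⟨fun hx j => affVal_pos_of_affPos b hx (affPos_simpleAff b j), fun h => ⟨fun j => ?_, ?_⟩⟩
  · simpa [affVal, simpleAff] using h (some j)
  · have := h none
    simp only [affVal, simpleAff, rePair_neg_index] at this
    push_cast at this
    linarith

/-- A weight whose image in the closed alcove lies on a wall has vanishing sine product, by
invariance. -/
theorem exists_mem_alcove (hκ : weylVector b ∈ alcove b κ) (hκ' : κ ≠ 0) {x : M}
    (hx : x ∈ weightLattice P) (h : sinProd b κ x ≠ 0) :
    ∃ f ∈ affineWeyl b κ, f x ∈ weightLattice P ∧ f x ∈ alcove b κ := by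
  obtain ⟨f, hf, h1, h2⟩ := exists_mem_closed_alcove b hκ hx
  refine ⟨f, hf, h1, (mem_alcove_iff b).mpr fun j => lt_of_le_of_ne (h2 j) fun h3 => h ?_⟩
  rw [← sinProd_affineWeyl b hκ' hf, sinProd_eq_zero b hκ' h3.symm]

/-- Every simple root occurs in θ with coefficient at least one, so the bound ⟨x,θ⟩ < κ bounds each
fundamental coordinate. -/
theorem finite_alcove_weights : (alcove b κ ∩ weightLattice P : Set M).Finite := by
  classical
  obtain ⟨B, hB⟩ : ∃ B : ℤ, ∀ j : b.support, κ / halfNorm b j ≤ B := by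
    have := exists_mem_support b
    obtain ⟨j, hj⟩ := Finite.exists_max fun j : b.support => κ / halfNorm b j
    obtain ⟨B, hB⟩ := exists_int_gt (κ / halfNorm b j)
    exact ⟨B, fun i => (hj i).trans hB.le⟩
  refine ((Set.finite_Icc (0 : b.support → ℤ) (fun _ => B)).image
    fun c => ∑ j, (c j : ℂ) • fundWeight b j).subset ?_
  rintro x ⟨hx, hx'⟩
  choose c hc using hx'
  have hr : ∀ i, rePair b i x = halfNorm b i * c i := fun i => by rw [rePair_eq, hc]; simp
  refine ⟨fun j => c j, ⟨fun j => ?_, fun j => ?_⟩, ?_⟩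
  · have := hx.1 j
    rw [hr, mul_pos_iff_of_pos_left (halfNorm_pos b j)] at this
    exact_mod_cast this.le
  · have h1 := hx.2
    rw [rePair_eq_sum_coef] at h1
    have h2 : rePair b j x ≤ ∑ i : b.support, coef b (highestRoot b) i * rePair b i x := by
      refine le_trans ?_ (Finset.single_le_sum (fun i _ => mul_nonneg
        (by exact_mod_cast (coef_highestRoot_pos b i).le) (hx.1 i).le) (Finset.mem_univ j))
      exact le_mul_of_one_le_left (hx.1 j).le (by exact_mod_cast coef_highestRoot_pos b j)
    have h3 : (c j : ℝ) ≤ κ / halfNorm b j := by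
      rw [le_div_iff₀ (halfNorm_pos b j), mul_comm, ← hr]
      exact h2.trans h1.le
    exact_mod_cast h3.trans (hB j)
  · conv_rhs => rw [eq_sum_fundWeight b x]
    simp only [hc]

/-! ### The Weyl group -/

variable (P) in
/-- The Weyl group, as a group of automorphisms of the weight space. -/
def weyl : Subgroup (M ≃ₗ[ℂ] M) := Subgroup.closure (Set.range P.reflection)

theorem reflection_mem_weyl (i : ι) : P.reflection i ∈ weyl P := Subgroup.subset_closure ⟨i, rfl⟩

theorem weyl_mem_weightLattice_iff {w : M ≃ₗ[ℂ] M} (hw : w ∈ weyl P) (x : M) :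
    w x ∈ weightLattice P ↔ x ∈ weightLattice P := by
  induction hw using Subgroup.closure_induction generalizing x with
  | mem y hy =>
    obtain ⟨i, rfl⟩ := hy
    refine ⟨fun h => ?_, reflection_mem_weightLattice i⟩
    simpa using reflection_mem_weightLattice i h
  | one => rfl
  | mul y z _ _ hy hz => rw [LinearEquiv.mul_apply, hy, hz]
  | inv y _ hy =>
    have h : y (y⁻¹ x) = x := LinearEquiv.apply_symm_apply y x
    rw [← hy, h]

theorem weyl_root_mem {w : M ≃ₗ[ℂ] M} (hw : w ∈ weyl P) (x : M) :
    w x ∈ Set.range P.root ↔ x ∈ Set.range P.root := by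
  induction hw using Subgroup.closure_induction generalizing x with
  | mem y hy =>
    obtain ⟨i, rfl⟩ := hy
    refine ⟨fun h => ?_, fun h => P.mapsTo_reflection_root i h⟩
    simpa using P.mapsTo_reflection_root i h
  | one => rfl
  | mul y z _ _ hy hz => rw [LinearEquiv.mul_apply, hy, hz]
  | inv y _ hy =>
    have h : y (y⁻¹ x) = x := LinearEquiv.apply_symm_apply y x
    rw [← hy, h]

instance finite_weyl : Finite (weyl P) := by
  have : Finite (Set.range P.root) := Set.finite_range _
  refine Finite.of_injective (β := ι → Set.range P.root)
    (fun w i => ⟨w.1 (P.root i), (weyl_root_mem w.2 _).mpr ⟨i, rfl⟩⟩) fun w w' h => ?_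
  refine Subtype.ext (LinearEquiv.toLinearMap_injective ?_)
  refine LinearMap.ext_on_range RootPairing.IsRootSystem.span_root_eq_top (v := P.root) fun i => ?_
  exact congrArg Subtype.val (congrFun h i)

variable (κ : ℕ)

/-- The lattice generated by the elements `κ α^∨`. -/
def coweightLattice : AddSubgroup M := AddSubgroup.closure (Set.range (coweight b κ))

theorem coweight_mem (i : ι) : coweight b κ i ∈ coweightLattice b κ :=
  AddSubgroup.subset_closure ⟨i, rfl⟩

theorem coweightLattice_le : coweightLattice b κ ≤ weightLattice P := by
  rw [coweightLattice, AddSubgroup.closure_le]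
  rintro _ ⟨i, rfl⟩
  exact coweight_mem_weightLattice b κ i

theorem reflection_mem_coweightLattice (i : ι) {x : M} (hx : x ∈ coweightLattice b κ) :
    P.reflection i x ∈ coweightLattice b κ := by
  induction hx using AddSubgroup.closure_induction with
  | mem y hy =>
    obtain ⟨j, rfl⟩ := hy
    rw [reflection_coweight]
    exact sub_mem (coweight_mem b κ j) (zsmul_mem (coweight_mem b κ i) _)
  | zero => rw [map_zero]; exact zero_mem _
  | add y z _ _ hy hz => rw [map_add]; exact add_mem hy hz
  | neg y _ hy => rw [map_neg]; exact neg_mem hy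

theorem weyl_mem_coweightLattice_iff {w : M ≃ₗ[ℂ] M} (hw : w ∈ weyl P) (x : M) :
    w x ∈ coweightLattice b κ ↔ x ∈ coweightLattice b κ := by
  induction hw using Subgroup.closure_induction generalizing x with
  | mem y hy =>
    obtain ⟨i, rfl⟩ := hy
    refine ⟨fun h => ?_, reflection_mem_coweightLattice b κ i⟩
    simpa using reflection_mem_coweightLattice b κ i h
  | one => rfl
  | mul y z _ _ hy hz => rw [LinearEquiv.mul_apply, hy, hz]
  | inv y _ hy =>
    have h : y (y⁻¹ x) = x := LinearEquiv.apply_symm_apply y x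
    rw [← hy, h]

theorem weyl_toEquiv_mem_affineWeyl {w : M ≃ₗ[ℂ] M} (hw : w ∈ weyl P) :
    (w.toEquiv : Equiv.Perm M) ∈ affineWeyl b κ := by
  induction hw using Subgroup.closure_induction with
  | mem y hy =>
    obtain ⟨i, rfl⟩ := hy
    refine Subgroup.subset_closure ⟨(i, 0), Equiv.ext fun x => ?_⟩
    rw [affRefl_apply]
    simp
  | one => exact one_mem _
  | mul y z _ _ hy hz => exact mul_mem hy hz
  | inv y _ hy => exact inv_mem hy

theorem addRight_mem_affineWeyl {t : M} (ht : t ∈ coweightLattice b κ) :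
    Equiv.addRight t ∈ affineWeyl b κ := by
  induction ht using AddSubgroup.closure_induction with
  | mem y hy =>
    obtain ⟨i, rfl⟩ := hy
    -- A translation is the product of the reflections in two parallel mirrors.
    have h : Equiv.addRight (coweight b κ i) = affRefl b κ (i, -1) * affRefl b κ (i, 0) := by
      ext x
      simp [affRefl_apply]
    rw [h]
    exact mul_mem (Subgroup.subset_closure ⟨_, rfl⟩) (Subgroup.subset_closure ⟨_, rfl⟩)
  | zero =>
    have h : Equiv.addRight (0 : M) = 1 := by ext x; simp
    rw [h]; exact one_mem _
  | add y z _ _ hy hz =>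
    have h : Equiv.addRight (y + z) = Equiv.addRight z * Equiv.addRight y := by
      ext x; simp [add_assoc]
    rw [h]; exact mul_mem hz hy
  | neg y _ hy =>
    have h : Equiv.addRight (-y) = (Equiv.addRight y)⁻¹ := by
      ext x; simp [Equiv.Perm.inv_def]
    rw [h]; exact inv_mem hy

/-- The affine Weyl group consists of Weyl group elements followed by translations in κQ^∨, because
W preserves this lattice. -/
theorem exists_weyl_of_mem_affineWeyl {f : Equiv.Perm M} (hf : f ∈ affineWeyl b κ) :
    ∃ w ∈ weyl P, ∃ t ∈ coweightLattice b κ, ∀ x, f x = w x + t := by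
  induction hf using Subgroup.closure_induction with
  | mem y hy =>
    obtain ⟨a, rfl⟩ := hy
    exact ⟨_, reflection_mem_weyl a.1, -(a.2 • coweight b κ a.1),
      neg_mem (zsmul_mem (coweight_mem b κ _) _), fun x => by rw [affRefl_apply, sub_eq_add_neg]⟩
  | one => exact ⟨1, one_mem _, 0, zero_mem _, fun x => by simp⟩
  | mul y z _ _ hy hz =>
    obtain ⟨w, hw, t, ht, h⟩ := hy
    obtain ⟨w', hw', t', ht', h'⟩ := hz
    refine ⟨w * w', mul_mem hw hw', w t' + t,
      add_mem ((weyl_mem_coweightLattice_iff b κ hw t').mpr ht') ht, fun x => ?_⟩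
    rw [Equiv.Perm.mul_apply, h', h, map_add, LinearEquiv.mul_apply, add_assoc]
  | inv y _ hy =>
    obtain ⟨w, hw, t, ht, h⟩ := hy
    have hw' := inv_mem hw
    refine ⟨w⁻¹, hw', -(w⁻¹ t),
      neg_mem ((weyl_mem_coweightLattice_iff b κ hw' t).mpr ht), fun x => ?_⟩
    apply y.injective
    have h1 : ∀ x, w (w⁻¹ x) = x := LinearEquiv.apply_symm_apply w
    have h2 : y (y⁻¹ x) = x := Equiv.apply_symm_apply y x
    rw [h2, h (w⁻¹ x + -(w⁻¹ t)), map_add, map_neg, h1, h1]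
    simp

variable {κ}

/-- Elements of the Weyl group are determined by their action on a point of the alcove, up to
translations in the lattice of the elements `κ α^∨`. -/
theorem weyl_free {w w' : M ≃ₗ[ℂ] M} (hw : w ∈ weyl P) (hw' : w' ∈ weyl P) {x y : M}
    (hx : x ∈ alcove b κ) (hy : y ∈ alcove b κ) (h : w x - w' y ∈ coweightLattice b κ) :
    w = w' ∧ x = y := by
  have h1 : ∀ x, w'⁻¹ (w' x) = x := LinearEquiv.symm_apply_apply w'
  have h1' : ∀ x, w' (w'⁻¹ x) = x := LinearEquiv.apply_symm_apply w'
  set t := w'⁻¹ (w x - w' y) with ht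
  have h2 : t ∈ coweightLattice b κ := (weyl_mem_coweightLattice_iff b κ (inv_mem hw') _).mpr h
  have h3 := mul_mem (addRight_mem_affineWeyl b κ (neg_mem h2))
    (weyl_toEquiv_mem_affineWeyl b κ (mul_mem (inv_mem hw') hw))
  have h4 : ∀ z, (Equiv.addRight (-t) * ((w'⁻¹ * w).toEquiv : Equiv.Perm M)) z =
      w'⁻¹ (w z) - t := fun z => by simp [sub_eq_add_neg]
  have h5 : w'⁻¹ (w x) - t = y := by rw [ht, map_sub, h1]; abel
  -- The affine map z ↦ w'⁻¹ w z - t sends x to y, both in the alcove, so it is the identity. Its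
  -- value at 0 then gives t = 0.
  have h6 := eq_one_of_mem_alcove b h3 hx (by rw [h4, h5]; exact hy)
  rw [Equiv.ext_iff] at h6
  simp only [h4, Equiv.Perm.one_apply] at h6
  have h7 : t = 0 := by simpa using h6 0
  refine ⟨LinearEquiv.ext fun z => ?_, ?_⟩
  · have := h6 z
    rw [h7, sub_zero] at this
    rw [← h1' (w z), this]
  · rw [← h5, h6]

/-! ### Unfolding the alcove sum over the finite quotient -/

variable (κ) in
/-- The finite quotient of the weight lattice by the lattice generated by the `κ α^∨`. -/
abbrev WeightQuotient : Type _ :=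
  weightLattice P ⧸ (coweightLattice b κ).addSubgroupOf (weightLattice P)

theorem out_sub_mem (x : weightLattice P) :
    ((Quotient.out (QuotientAddGroup.mk x : WeightQuotient b κ) : weightLattice P) : M) - x ∈
      coweightLattice b κ := by
  have h := QuotientAddGroup.mk_out_eq_add ((coweightLattice b κ).addSubgroupOf (weightLattice P)) x
  obtain ⟨t, ht⟩ := h
  rw [ht]
  simpa using AddSubgroup.mem_addSubgroupOf.mp t.2

theorem sinProd_eq_of_sub_mem (hκ : κ ≠ 0) {x y : M} (h : x - y ∈ coweightLattice b κ) :
    sinProd b κ x = sinProd b κ y := by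
  have := sinProd_affineWeyl b hκ (addRight_mem_affineWeyl b κ h) y
  rw [← this]
  simp

/-- The map (w, x) ↦ class of w x, for x a weight of the alcove, is injective by freeness. A class
on which the sine product does not vanish can be moved into the alcove, hence is in its image. -/
theorem sum_sinProd_quotient (hρ : weylVector b ∈ alcove b κ) (hκ : κ ≠ 0)
    [Fintype (WeightQuotient b κ)] :
    ∑ x : WeightQuotient b κ, sinProd b κ (Quotient.out x : weightLattice P) =
      Nat.card (weyl P) * ∑ x ∈ (finite_alcove_weights b (κ := κ)).toFinset, sinProd b κ x := by
  classical
  have := Fintype.ofFinite (weyl P)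
  set A := (finite_alcove_weights b (κ := κ)).toFinset with hA
  have hA' : ∀ {x}, x ∈ A ↔ x ∈ alcove b κ ∧ x ∈ weightLattice P := by
    intro x; rw [hA, Set.Finite.mem_toFinset]; rfl
  let φ : weyl P × A → WeightQuotient b κ := fun p =>
    QuotientAddGroup.mk ⟨p.1.1 p.2.1, (weyl_mem_weightLattice_iff p.1.2 _).mpr (hA'.mp p.2.2).2⟩
  have hφ : Function.Injective φ := by
    rintro ⟨⟨w, hw⟩, ⟨x, hx⟩⟩ ⟨⟨w', hw'⟩, ⟨y, hy⟩⟩ h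
    have h1 := QuotientAddGroup.eq.mp h.symm
    rw [AddSubgroup.mem_addSubgroupOf] at h1
    have h2 : -(w' y) + w x ∈ coweightLattice b κ := h1
    rw [neg_add_eq_sub] at h2
    obtain ⟨rfl, rfl⟩ := weyl_free b hw hw' (hA'.mp hx).1 (hA'.mp hy).1 h2
    rfl
  have h1 : ∑ p : weyl P × A, sinProd b κ p.2.1 =
      ∑ x : WeightQuotient b κ, sinProd b κ (Quotient.out x : weightLattice P) := by
    refine Fintype.sum_of_injective φ hφ _ _ (fun x hx => ?_) fun p => ?_
    · by_contra h
      apply hx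
      obtain ⟨f, hf, h1, h2⟩ := exists_mem_alcove b hρ hκ (Quotient.out x : weightLattice P).2 h
      obtain ⟨w, hw, t, ht, hwt⟩ := exists_weyl_of_mem_affineWeyl b κ hf
      refine ⟨(⟨w⁻¹, inv_mem hw⟩, ⟨f _, hA'.mpr ⟨h2, h1⟩⟩), ?_⟩
      refine Eq.trans (QuotientAddGroup.eq.mpr ?_) (QuotientAddGroup.out_eq' x)
      rw [AddSubgroup.mem_addSubgroupOf]
      have h3 : ∀ x, w⁻¹ (w x) = x := LinearEquiv.symm_apply_apply w
      have h4 := neg_mem ((weyl_mem_coweightLattice_iff b κ (inv_mem hw) t).mpr ht)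
      have h5 : -(w⁻¹ (f (Quotient.out x : weightLattice P))) +
          (Quotient.out x : weightLattice P) = -(w⁻¹ t) := by
        rw [hwt, map_add, h3]; abel
      rw [← h5] at h4
      exact h4
    · refine (sinProd_eq_of_sub_mem b hκ (out_sub_mem b _)).trans ?_ |>.symm
      exact sinProd_affineWeyl b hκ (weyl_toEquiv_mem_affineWeyl b κ p.1.2) _
  rw [← h1, Fintype.sum_prod_type]
  simp only [Finset.sum_const, Finset.card_univ, nsmul_eq_mul, Nat.card_eq_fintype_card]
  rw [← Finset.sum_coe_sort A]

/-! ### The Weyl denominator -/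

/-- The factor `e^{α/2} - e^{-α/2}` of the Weyl denominator. -/
def denomFactor (P : RootPairing ι ℂ M N) (i : ι) : AddMonoidAlgebra ℤ M :=
  AddMonoidAlgebra.single ((2⁻¹ : ℂ) • P.root i) 1 -
    AddMonoidAlgebra.single (-((2⁻¹ : ℂ) • P.root i)) 1

/-- The Weyl denominator. -/
def weylDenom : AddMonoidAlgebra ℤ M := ∏ i ∈ posRoots b, denomFactor P i

theorem denomFactor_neg (i : ι) : denomFactor P (P.reflectionPerm i i) = -denomFactor P i := by
  simp [denomFactor]

theorem mapDomain_denomFactor (i j : ι) :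
    AddMonoidAlgebra.mapDomainRingHom ℤ (P.reflection j : M →+ M) (denomFactor P i) =
      denomFactor P (P.reflectionPerm j i) := by
  rw [denomFactor, map_sub]
  simp [denomFactor, P.root_reflectionPerm]

/-- The simple reflection permutes the factors of the other positive roots and negates the factor of
its own root. -/
theorem mapDomain_weylDenom (j : b.support) :
    AddMonoidAlgebra.mapDomainRingHom ℤ (P.reflection j : M →+ M) (weylDenom b) =
      -weylDenom b := by
  classical
  have hj : (j : ι) ∈ posRoots b := (mem_posRoots b).mpr (RootPairing.Base.isPos_of_mem_support j.2)
  have hmem : ∀ i ∈ (posRoots b).erase j, P.reflectionPerm j i ∈ (posRoots b).erase j := by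
    intro i hi
    rw [Finset.mem_erase, mem_posRoots] at hi ⊢
    exact ⟨reflectionPerm_ne b hi.2 (RootPairing.Base.isPos_of_mem_support j.2),
      hi.2.reflectionPerm j.2 hi.1⟩
  rw [weylDenom, map_prod]
  simp only [mapDomain_denomFactor]
  rw [← Finset.mul_prod_erase _ _ hj, ← Finset.mul_prod_erase _ (denomFactor P) hj,
    denomFactor_neg, neg_mul]
  congr 2
  exact Finset.prod_bij' (fun i _ => P.reflectionPerm j i) (fun i _ => P.reflectionPerm j i)
    hmem hmem (fun i _ => P.reflectionPerm_self j i) (fun i _ => P.reflectionPerm_self j i)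
    fun i _ => rfl

theorem coeff_weylDenom_reflection (j : b.support) (x : M) :
    (weylDenom b).coeff (P.reflection j x) = -(weylDenom b).coeff x := by
  have h := congrArg (fun f => AddMonoidAlgebra.coeff f (P.reflection j x)) (mapDomain_weylDenom b j)
  have h2 := Finsupp.mapDomain_apply (P.reflection j).injective (weylDenom b).coeff x
  simp only [AddMonoidAlgebra.coeff_neg, Finsupp.neg_apply] at h
  rw [← neg_eq_iff_eq_neg.mpr h]
  congr 1

/-- Expand the product: s is the set of the roots for which the term with -α/2 is taken. -/
theorem weylDenom_eq_sum : weylDenom b = ∑ s ∈ (posRoots b).powerset,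
    AddMonoidAlgebra.single (weylVector b - ∑ i ∈ s, P.root i) ((-1) ^ s.card) := by
  classical
  simp only [weylDenom, denomFactor]
  rw [Finset.prod_sub]
  refine Finset.sum_congr rfl fun s hs => ?_
  rw [AddMonoidAlgebra.prod_single, AddMonoidAlgebra.prod_single]
  have h1 : (-1 : AddMonoidAlgebra ℤ M) ^ s.card = AddMonoidAlgebra.single 0 ((-1) ^ s.card) := by
    rw [show (-1 : AddMonoidAlgebra ℤ M) = AddMonoidAlgebra.single 0 (-1) by
      rw [AddMonoidAlgebra.single_neg]; rfl, AddMonoidAlgebra.single_pow]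
    simp
  rw [h1, AddMonoidAlgebra.single_mul_single, AddMonoidAlgebra.single_mul_single]
  simp only [Finset.prod_const_one, mul_one, zero_add]
  congr 1
  rw [weylVector, ← Finset.sum_sdiff (Finset.mem_powerset.mp hs), smul_add, Finset.smul_sum,
    Finset.smul_sum, Finset.sum_neg_distrib, ← Finset.smul_sum, ← Finset.smul_sum,
    ← sub_eq_add_neg]
  have : ∑ i ∈ s, P.root i = (2⁻¹ : ℂ) • ∑ i ∈ s, P.root i + (2⁻¹ : ℂ) • ∑ i ∈ s, P.root i := by
    rw [← add_smul]; norm_num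
  rw [this]
  simp only [← this]
  nth_rw 3 [this]
  abel

theorem exists_of_coeff_weylDenom_ne_zero {x : M} (h : (weylDenom b).coeff x ≠ 0) :
    ∃ s ⊆ posRoots b, x = weylVector b - ∑ i ∈ s, P.root i := by
  classical
  by_contra! hc
  apply h
  rw [weylDenom_eq_sum, AddMonoidAlgebra.coeff_sum, Finsupp.finsetSum_apply]
  refine Finset.sum_eq_zero fun s hs => ?_
  rw [AddMonoidAlgebra.coeff_single, Finsupp.single_apply, if_neg]
  exact fun e => hc s (Finset.mem_powerset.mp hs) e.symm

/-- Each positive root pairs strictly positively with ρ. -/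
theorem sum_root_eq_zero {s : Finset ι} (hs : s ⊆ posRoots b) (h : ∑ i ∈ s, P.root i = 0) :
    s = ∅ := by
  have h1 : ∑ i ∈ s, rePair b i (weylVector b) = 0 := by
    have := congrArg (fundForm b (weylVector b)) h
    rw [map_sum, map_zero] at this
    simpa [rePair] using congrArg Complex.re this
  have h2 : ∀ i ∈ s, 0 < rePair b i (weylVector b) := fun i hi => by
    have hi := (mem_posRoots b).mp (hs hi)
    have h0 := rePair_nonneg_of_isPos b (x := weylVector b) (fun j => (rePair_weylVector_pos b j).le) hi
    refine lt_of_le_of_ne h0 fun e => ?_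
    rw [rePair_eq_sum_coef] at e
    have h3 := (Finset.sum_eq_zero_iff_of_nonneg (fun j _ =>
      mul_nonneg (by exact_mod_cast coef_nonneg b hi j) (rePair_weylVector_pos b j).le)).mp e.symm
    have h4 := height_eq_sum_coef b i
    rw [Finset.sum_eq_zero fun j hj => ?_] at h4
    · rw [RootPairing.Base.isPos_iff] at hi; lia
    · have := h3 j hj
      have := (mul_eq_zero.mp this).resolve_right (rePair_weylVector_pos b j).ne'
      exact_mod_cast this
  by_contra hne
  have := Finset.sum_pos h2 (Finset.nonempty_iff_ne_empty.mpr hne)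
  linarith

theorem coeff_weylDenom_weylVector : (weylDenom b).coeff (weylVector b) = 1 := by
  classical
  rw [weylDenom_eq_sum, AddMonoidAlgebra.coeff_sum, Finsupp.finsetSum_apply,
    Finset.sum_eq_single ∅]
  · simp
  · intro s hs hne
    rw [AddMonoidAlgebra.coeff_single, Finsupp.single_apply, if_neg]
    intro e
    exact hne (sum_root_eq_zero b (Finset.mem_powerset.mp hs) (sub_eq_self.mp e))
  · simp

/-- The complex form is not definite; it is so on the vectors whose pairings with the coroots are
real, where it is a positive multiple of a sum of squares. -/
theorem eq_zero_of_fundForm_self_nonpos {x : M} {c : ι → ℝ} (hc : ∀ i, P.coroot' i x = c i)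
    (h : (fundForm b x x).re ≤ 0) : x = 0 := by
  have h2 : P.RootForm x x = ((∑ i, c i ^ 2 : ℝ) : ℂ) := by
    rw [P.rootForm_apply_apply]
    push_cast
    exact Finset.sum_congr rfl fun i _ => by rw [hc, sq]
  have h3 : (fundForm b x x).re = 2 / (lengthSq P (highestRoot b) : ℝ) * ∑ i, c i ^ 2 := by
    rw [fundForm, LinearMap.smul_apply, LinearMap.smul_apply, h2, rootForm_root_self_eq, smul_eq_mul]
    rw [← Complex.ofReal_re (2 / (lengthSq P (highestRoot b) : ℝ) * ∑ i, c i ^ 2)]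
    push_cast
    rfl
  rw [h3] at h
  have h4 : (0 : ℝ) < 2 / (lengthSq P (highestRoot b) : ℝ) :=
    div_pos two_pos (by exact_mod_cast lengthSq_pos _)
  have h7 := (Finset.sum_eq_zero_iff_of_nonneg fun i _ => sq_nonneg (c i)).mp
    (le_antisymm (nonpos_of_mul_nonpos_right h h4) (Finset.sum_nonneg fun i _ => sq_nonneg (c i)))
  refine eq_zero_of_coroot' b fun j => ?_
  rw [hc, pow_eq_zero_iff two_ne_zero |>.mp (h7 j (Finset.mem_univ _))]
  simp

/-- A dominant element of the form `-∑ α`, with `α` positive roots, is zero. -/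
theorem eq_zero_of_dominant_of_eq_neg_sum {x : M} (hx : x ∈ weightLattice P)
    (hd : ∀ j : b.support, 0 ≤ rePair b j x) {s : Finset ι} (hs : s ⊆ posRoots b)
    (h : x = -∑ i ∈ s, P.root i) : x = 0 := by
  choose c hc using hx
  refine eq_zero_of_fundForm_self_nonpos b (c := fun i => c i) (by simpa using hc) ?_
  -- Replacing one argument only, ⟨x,x⟩ = -∑⟨x,α⟩, which dominance makes nonpositive.
  conv_lhs => enter [1, 2]; rw [h]
  rw [map_neg, map_sum, Complex.neg_re, Complex.re_sum, neg_nonpos]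
  exact Finset.sum_nonneg fun i hi => rePair_nonneg_of_isPos b hd ((mem_posRoots b).mp (hs hi))

theorem coeff_weylDenom_reflection' (i : ι) (x : M) :
    (weylDenom b).coeff (P.reflection i x) = -(weylDenom b).coeff x := by
  induction i using b.induction_reflect generalizing x with
  | h₀ i ih => rw [P.reflection_reflectionPerm, LinearEquiv.mul_apply, LinearEquiv.mul_apply,
      ih, ih, ih, neg_neg]
  | h₁ i hi => exact coeff_weylDenom_reflection b ⟨i, hi⟩ x
  | h₂ i j ih hj =>
    have h := fun x => coeff_weylDenom_reflection b ⟨j, hj⟩ x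
    rw [P.reflection_reflectionPerm, LinearEquiv.mul_apply, LinearEquiv.mul_apply, h, ih, h,
      neg_neg]

/-- Only squares of coefficients are needed later, so no sign character of the Weyl group has to be
introduced. -/
theorem abs_coeff_weylDenom_weyl {w : M ≃ₗ[ℂ] M} (hw : w ∈ weyl P) (x : M) :
    ((weylDenom b).coeff (w x)) ^ 2 = ((weylDenom b).coeff x) ^ 2 := by
  induction hw using Subgroup.closure_induction generalizing x with
  | mem z hz =>
    obtain ⟨i, rfl⟩ := hz
    rw [coeff_weylDenom_reflection', neg_sq]
  | one => rfl
  | mul z z' _ _ hz hz' => rw [LinearEquiv.mul_apply, hz, hz']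
  | inv z _ hz =>
    have h : z (z⁻¹ x) = x := LinearEquiv.apply_symm_apply z x
    rw [← hz, h]

/-- In the W-orbit of x, take the point with largest pairing with ρ. It is dominant, and strictly
so, since antisymmetry kills the coefficients on mirrors. Hence its difference with ρ is still
dominant; being minus a sum of positive roots, it vanishes. -/
theorem exists_weyl_of_coeff_weylDenom_ne_zero {x : M} (h : (weylDenom b).coeff x ≠ 0) :
    ∃ w ∈ weyl P, x = w (weylVector b) := by
  obtain ⟨⟨w, hw⟩, hmax⟩ := Finite.exists_max fun w : weyl P => (fundForm b (w.1 x) (weylVector b)).re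
  have hν : (weylDenom b).coeff (w x) ≠ 0 := fun e => h (by
    have := abs_coeff_weylDenom_weyl b hw x
    rw [e] at this
    exact pow_eq_zero_iff two_ne_zero |>.mp (by rw [← this]; simp))
  obtain ⟨s, hs, hs'⟩ := exists_of_coeff_weylDenom_ne_zero b hν
  have hmem : w x ∈ weightLattice P := by
    rw [hs']
    exact sub_mem (weylVector_mem_weightLattice b) (sum_mem fun i _ => root_mem_weightLattice i)
  have hd : ∀ j : b.support, 0 ≤ rePair b j (w x - weylVector b) := fun j => by
    obtain ⟨n, hn⟩ := hmem j
    have h1 : P.reflection j (w x) = w x - (n : ℂ) • P.root j := by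
      rw [P.reflection_apply, hn]
    have h2 := hmax ⟨P.reflection j * w, mul_mem (reflection_mem_weyl _) hw⟩
    simp only [LinearEquiv.mul_apply, h1, map_sub, LinearMap.sub_apply, map_smul,
      LinearMap.smul_apply, Complex.sub_re, smul_eq_mul] at h2
    have h3 : 0 < (fundForm b (P.root j) (weylVector b)).re := by
      rw [fundForm_comm]; exact rePair_weylVector_pos b j
    rw [← Complex.ofReal_intCast, Complex.re_ofReal_mul] at h2
    have h4 : (0 : ℝ) ≤ n := by
      by_contra hc
      nlinarith [mul_pos (neg_pos.mpr (not_le.mp hc)) h3]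
    -- A weight fixed by a simple reflection has a coefficient equal to its own negative.
    have h5 : n ≠ 0 := by
      rintro rfl
      have := coeff_weylDenom_reflection b j (w x)
      rw [h1] at this
      simp only [Int.cast_zero, zero_smul, sub_zero] at this
      exact hν (self_eq_neg.mp this)
    have h6 : (0 : ℤ) ≤ n := by exact_mod_cast h4
    have h7 : (1 : ℝ) ≤ n := by exact_mod_cast (show (1 : ℤ) ≤ n by lia)
    rw [rePair_sub, rePair_weylVector, rePair_eq, hn, Complex.intCast_re]
    nlinarith [halfNorm_pos b j]
  have h0 := eq_zero_of_dominant_of_eq_neg_sum b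
    (sub_mem hmem (weylVector_mem_weightLattice b)) hd hs (by rw [hs']; abel)
  refine ⟨w⁻¹, inv_mem hw, ?_⟩
  rw [← sub_eq_zero.mp h0]
  exact (LinearEquiv.symm_apply_apply w x).symm

theorem weyl_weylVector_injective : Function.Injective fun w : weyl P => w.1 (weylVector b) := by
  -- At level g the Weyl vector is in the alcove because ⟨ρ,θ⟩ = g - 1, so freeness of the affine
  -- action applies to it.
  have hρ : weylVector b ∈ alcove b (dualCoxeterNumber b) := by
    refine ⟨rePair_weylVector_pos b, ?_⟩
    rw [dualCoxeterNumber_eq]; linarith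
  intro w w' h
  refine Subtype.ext (weyl_free b w.2 w'.2 hρ hρ ?_).1
  rw [show w.1 (weylVector b) = w'.1 (weylVector b) from h, sub_self]
  exact zero_mem _

/-- The Weyl denominator formula: the Weyl denominator is a sum, with signs, over the Weyl
group. -/
theorem weylDenom_eq_sum_weyl [Fintype (weyl P)] : weylDenom b =
    ∑ w : weyl P, AddMonoidAlgebra.single (w.1 (weylVector b))
      ((weylDenom b).coeff (w.1 (weylVector b))) := by
  classical
  ext x
  rw [AddMonoidAlgebra.coeff_sum, Finsupp.finsetSum_apply]
  simp only [AddMonoidAlgebra.coeff_single, Finsupp.single_apply]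
  by_cases h : (weylDenom b).coeff x = 0
  · rw [h, Finset.sum_eq_zero]
    intro w _
    split_ifs with e
    · rw [e, h]
    · rfl
  · obtain ⟨w, hw, rfl⟩ := exists_weyl_of_coeff_weylDenom_ne_zero b h
    rw [Finset.sum_eq_single ⟨w, hw⟩]
    · simp
    · intro w' _ hne
      rw [if_neg fun e => hne (weyl_weylVector_injective b e)]
    · simp

theorem coeff_weylDenom_sq (w : weyl P) :
    ((weylDenom b).coeff (w.1 (weylVector b))) ^ 2 = 1 := by
  rw [abs_coeff_weylDenom_weyl b w.2, coeff_weylDenom_weylVector, one_pow]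

/-! ### The index of the lattice of the `κ α^∨` in the weight lattice -/

section Index

variable (κ : ℕ)

theorem coweightLattice_eq_closure :
    coweightLattice b κ = AddSubgroup.closure (Set.range fun j : b.support => coweight b κ j) := by
  refine le_antisymm ?_ (AddSubgroup.closure_mono ?_)
  · rw [coweightLattice, AddSubgroup.closure_le]
    rintro _ ⟨i, rfl⟩
    induction i using b.induction_reflect with
    | h₀ i ih =>
      rw [coweight_reflectionPerm, reflection_coweight]
      exact sub_mem ih (zsmul_mem ih _)
    | h₁ i hi => exact AddSubgroup.subset_closure (Set.mem_range_self (⟨i, hi⟩ : b.support))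
    | h₂ i j ih hj =>
      rw [coweight_reflectionPerm, reflection_coweight]
      exact sub_mem ih (zsmul_mem (AddSubgroup.subset_closure
        (Set.mem_range_self (⟨j, hj⟩ : b.support))) _)
  · rintro _ ⟨j, rfl⟩
    exact ⟨j, rfl⟩

open Classical in
/-- The basis of fundamental weights. -/
def fundWeightBasis : Basis b.support ℂ M := b.toCoweightBasis.dualBasis.map P.toPerfPair.symm

theorem fundWeightBasis_apply (j : b.support) : fundWeightBasis b j = fundWeight b j := by
  simp [fundWeightBasis, fundWeight, Basis.coe_dualBasis]

theorem fundWeightBasis_repr (x : M) (j : b.support) :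
    (fundWeightBasis b).repr x j = P.coroot' j x := by
  classical
  have h := eq_sum_fundWeight b x
  simp only [← fundWeightBasis_apply] at h
  conv_lhs => rw [h]
  rw [Basis.repr_sum_self]

theorem weightLattice_eq_closure :
    weightLattice P = AddSubgroup.closure (Set.range (fundWeightBasis b)) := by
  refine le_antisymm (fun x hx => ?_) ?_
  · rw [eq_sum_fundWeight b x]
    refine sum_mem fun j _ => ?_
    obtain ⟨n, hn⟩ := hx j
    rw [hn, Int.cast_smul_eq_zsmul]
    rw [← fundWeightBasis_apply]
    exact zsmul_mem (AddSubgroup.subset_closure (Set.mem_range_self _)) _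
  · rw [AddSubgroup.closure_le]
    rintro _ ⟨j, rfl⟩
    rw [fundWeightBasis_apply]
    exact fundWeight_mem_weightLattice b j

variable {κ}

/-- The basis of the elements `κ α^∨`, for `α` a simple root. -/
def coweightBasis (hκ : κ ≠ 0) : Basis b.support ℂ M :=
  b.toWeightBasis.isUnitSMul (w := fun j => ((κ / halfNorm b j : ℝ) : ℂ)) fun j => by
    rw [isUnit_iff_ne_zero, Complex.ofReal_ne_zero]
    exact div_ne_zero (by exact_mod_cast hκ) (halfNorm_ne_zero b j)

theorem coweightBasis_apply (hκ : κ ≠ 0) (j : b.support) :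
    coweightBasis b hκ j = coweight b κ j := by
  rw [coweightBasis, Basis.isUnitSMul_apply, b.toWeightBasis_apply, coweight]

theorem fundForm_coweight (x : M) (i : ι) :
    fundForm b x (coweight b κ i) = κ * P.coroot' i x := by
  have := halfNorm_ne_zero b i
  rw [coweight, map_smul, fundForm_root, smul_eq_mul, ← mul_assoc, ← Complex.ofReal_mul,
    div_mul_cancel₀ _ this, Complex.ofReal_natCast]

variable (κ) in
/-- The Gram matrix of the elements `κ α^∨`, divided by `κ`. -/
def coweightMatrix : Matrix b.support b.support ℝ :=
  Matrix.of fun i j => κ / halfNorm b i * P.pairingIn ℤ i j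

theorem coweightMatrix_apply (i j : b.support) :
    (coweightMatrix b κ i j : ℂ) = P.coroot' i (coweight b κ j) := by
  rw [coroot'_coweight, coweightMatrix, Matrix.of_apply]
  push_cast
  rfl

-- The quadratic form of this matrix is ⟨y,y⟩/κ for a real combination y of the κα_j^∨. Its
-- positivity fixes the sign of the determinant in the index computation.
open Matrix in
theorem coweightMatrix_posDef (hκ : κ ≠ 0) : (coweightMatrix b κ).PosDef := by
  have hκ' : (0 : ℝ) < κ := by exact_mod_cast Nat.pos_of_ne_zero hκ
  refine PosDef.of_dotProduct_mulVec_pos ?_ fun x hx => ?_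
  · ext i j
    have := halfNorm_mul_pairing b i j
    have := halfNorm_ne_zero b i
    have := halfNorm_ne_zero b j
    simp only [coweightMatrix, conjTranspose_apply, of_apply, star_trivial]
    field_simp
    linear_combination -(halfNorm_mul_pairing b (j : ι) i)
  · set y : M := ∑ j, (x j : ℂ) • coweight b κ j with hy
    have h1 : ∀ i, P.coroot' i y = ((∑ j, x j * (κ / halfNorm b i * P.pairingIn ℤ i j) : ℝ) : ℂ) := by
      intro i
      rw [hy, map_sum]
      push_cast
      refine Finset.sum_congr rfl fun j _ => ?_
      rw [map_smul, coroot'_coweight, smul_eq_mul]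
      push_cast
      rfl
    have h2 : fundForm b y y = ((κ * (star x ⬝ᵥ coweightMatrix b κ *ᵥ x) : ℝ) : ℂ) := by
      conv_lhs => enter [2]; rw [hy]
      rw [map_sum, dotProduct, Finset.mul_sum]
      push_cast
      refine Finset.sum_congr rfl fun i _ => ?_
      rw [map_smul, fundForm_coweight, h1, mulVec, dotProduct]
      simp only [coweightMatrix, of_apply, smul_eq_mul, star_trivial]
      push_cast
      simp only [Finset.mul_sum]
      refine Finset.sum_congr rfl fun j _ => by ring
    by_contra hc
    have h3 : y = 0 := by
      refine eq_zero_of_fundForm_self_nonpos b h1 ?_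
      rw [h2, Complex.ofReal_re]
      exact mul_nonpos_of_nonneg_of_nonpos hκ'.le (not_lt.mp hc)
    have h4 := (Fintype.linearIndependent_iff.mp (coweightBasis b hκ).linearIndependent)
      (fun j => (x j : ℂ)) (by simpa only [coweightBasis_apply] using h3)
    exact hx (funext fun j => by exact_mod_cast h4 j)

-- The columns of the first matrix are the coordinates of the κα_j^∨ on the fundamental weights.
-- Multiplying its transpose by the Gram matrix of these weights gives the pairings of κα_k^∨ with
-- ω_j, that is, κ times the identity.
open Matrix in
theorem det_coweightMatrix_mul_fundDet [DecidableEq b.support] :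
    ((coweightMatrix b κ).det : ℂ) * fundDet b = κ ^ Fintype.card b.support := by
  have h1 : ((coweightMatrix b κ).map Complex.ofRealHom)ᵀ *
      (Matrix.of fun i j : b.support => fundForm b (fundWeight b i) (fundWeight b j)) =
      (κ : ℂ) • (1 : Matrix b.support b.support ℂ) := by
    ext k j
    rw [Matrix.mul_apply, Matrix.smul_apply, Matrix.one_apply]
    have h := congrArg (fundForm b (fundWeight b j)) (eq_sum_fundWeight b (coweight b κ k))
    rw [fundForm_coweight, coroot'_fundWeight, map_sum] at h
    rw [smul_eq_mul, h]
    refine Finset.sum_congr rfl fun i _ => ?_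
    rw [Matrix.transpose_apply, Matrix.map_apply, Matrix.of_apply, map_smul, smul_eq_mul,
      fundForm_comm]
    congr 1
    exact coweightMatrix_apply b i k
  have h2 := congrArg Matrix.det h1
  rw [Matrix.det_mul, Matrix.det_transpose, Matrix.det_smul, Matrix.det_one, mul_one] at h2
  have h3 : ((coweightMatrix b κ).map Complex.ofRealHom).det = ((coweightMatrix b κ).det : ℂ) :=
    (RingHom.map_det Complex.ofRealHom (coweightMatrix b κ)).symm
  rw [h3] at h2
  rw [← h2, fundDet]
  congr!

/-- The index of a sublattice is the absolute value of the determinant of a change of basis; here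
the determinant is positive. -/
theorem card_weightQuotient (hκ : κ ≠ 0) [DecidableEq b.support] :
    (Nat.card (WeightQuotient b κ) : ℝ) = (coweightMatrix b κ).det := by
  have h₁ : coweightLattice b κ = AddSubgroup.closure (Set.range (coweightBasis b hκ)) := by
    rw [coweightLattice_eq_closure]
    congr 2
    exact funext fun j => (coweightBasis_apply b hκ j).symm
  have h := AddSubgroup.relIndex_eq_natAbs_det _ _ (coweightLattice_le b κ)
    ((coweightBasis b hκ).addSubgroupOfClosure _ h₁)
    ((fundWeightBasis b).addSubgroupOfClosure _ (weightLattice_eq_closure b))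
  set n := ((fundWeightBasis b).addSubgroupOfClosure _ (weightLattice_eq_closure b)).det
    (fun i => ⟨(coweightBasis b hκ).addSubgroupOfClosure _ h₁ i,
      coweightLattice_le b κ (SetLike.coe_mem _)⟩) with hn
  have h2 : (n : ℂ) = ((coweightMatrix b κ).det : ℂ) := by
    have h3 : ((coweightMatrix b κ).map Complex.ofRealHom).det = ((coweightMatrix b κ).det : ℂ) :=
      (RingHom.map_det Complex.ofRealHom (coweightMatrix b κ)).symm
    rw [← h3, hn, Basis.det_apply]
    change algebraMap ℤ ℂ _ = _
    rw [RingHom.map_det]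
    congr 1
    ext i j
    simp only [RingHom.mapMatrix_apply, Matrix.map_apply, Basis.toMatrix_apply]
    refine (Basis.addSubgroupOfClosure_repr_apply _ _ _ _ _).trans ?_
    rw [fundWeightBasis_repr]
    simp only [Basis.addSubgroupOfClosure_apply, coweightBasis_apply]
    exact (coweightMatrix_apply b i j).symm
  have h3 : (n : ℝ) = (coweightMatrix b κ).det := by exact_mod_cast h2
  have h4 : 0 < (coweightMatrix b κ).det := (coweightMatrix_posDef b hκ).det_pos
  rw [← h3] at h4 ⊢
  have h5 : (0 : ℤ) < n := by exact_mod_cast h4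
  have h6 : Nat.card (WeightQuotient b κ) = n.natAbs := h
  rw [h6, ← Int.cast_natCast, Int.natAbs_of_nonneg h5.le]

theorem card_weightQuotient_mul_fundDet (hκ : κ ≠ 0) :
    (Nat.card (WeightQuotient b κ) : ℂ) * fundDet b = κ ^ Fintype.card b.support := by
  classical
  rw [← det_coweightMatrix_mul_fundDet, ← card_weightQuotient b hκ]
  simp

theorem finite_weightQuotient (hκ : κ ≠ 0) : Finite (WeightQuotient b κ) := by
  refine Nat.finite_of_card_ne_zero fun h => ?_
  have := card_weightQuotient_mul_fundDet b hκ
  rw [h, Nat.cast_zero, zero_mul, eq_comm, pow_eq_zero_iff'] at this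
  exact hκ (by exact_mod_cast this.1)

end Index

/-! ### Orthogonality of characters and the sum of the products of sines -/

variable {κ : ℕ}

variable (κ) in
/-- The exponential `exp (2πi ⟨μ, x⟩ / κ)`. -/
def charExp (μ x : M) : ℂ := Complex.exp (2 * Real.pi * Complex.I * fundForm b μ x / κ)

theorem charExp_comm (μ x : M) : charExp b κ μ x = charExp b κ x μ := by
  rw [charExp, fundForm_comm, charExp]

theorem charExp_add_right (μ x y : M) :
    charExp b κ μ (x + y) = charExp b κ μ x * charExp b κ μ y := by
  rw [charExp, charExp, charExp, ← Complex.exp_add, map_add]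
  congr 1
  ring

theorem charExp_add_left (μ ν x : M) :
    charExp b κ (μ + ν) x = charExp b κ μ x * charExp b κ ν x := by
  rw [charExp_comm, charExp_add_right, charExp_comm b x, charExp_comm b x]

theorem charExp_zero_left (x : M) : charExp b κ 0 x = 1 := by simp [charExp]

theorem charExp_zero_right (x : M) : charExp b κ x 0 = 1 := by simp [charExp]

theorem charExp_coweight (hκ : κ ≠ 0) {μ : M} (hμ : μ ∈ weightLattice P) (i : ι) :
    charExp b κ μ (coweight b κ i) = 1 := by
  obtain ⟨n, hn⟩ := hμ i
  have hκ' : (κ : ℂ) ≠ 0 := by exact_mod_cast hκ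
  rw [charExp, fundForm_coweight, hn, Complex.exp_eq_one_iff]
  exact ⟨n, by field_simp⟩

theorem charExp_eq_one (hκ : κ ≠ 0) {μ t : M} (hμ : μ ∈ weightLattice P)
    (ht : t ∈ coweightLattice b κ) : charExp b κ μ t = 1 := by
  induction ht using AddSubgroup.closure_induction with
  | mem y hy => obtain ⟨i, rfl⟩ := hy; exact charExp_coweight b hκ hμ i
  | zero => exact charExp_zero_right b _
  | add y z _ _ hy hz => rw [charExp_add_right, hy, hz, one_mul]
  | neg y _ hy =>
    have := charExp_add_right b (κ := κ) μ y (-y)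
    rw [add_neg_cancel, charExp_zero_right, hy, one_mul] at this
    exact this.symm

theorem charExp_eq_of_sub_mem (hκ : κ ≠ 0) {μ x y : M} (hμ : μ ∈ weightLattice P)
    (h : x - y ∈ coweightLattice b κ) : charExp b κ μ x = charExp b κ μ y := by
  rw [← sub_add_cancel x y, charExp_add_right, charExp_eq_one b hκ hμ h, one_mul]

/-- The lattices Λ and κQ^∨ are dual for the form divided by κ: testing against ω_j shows that the
coordinate of μ on κα_j^∨ is an integer. -/
theorem mem_coweightLattice_of_charExp (hκ : κ ≠ 0) {μ : M}
    (h : ∀ x ∈ weightLattice P, charExp b κ μ x = 1) : μ ∈ coweightLattice b κ := by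
  classical
  have hκ' : (κ : ℂ) ≠ 0 := by exact_mod_cast hκ
  rw [← (coweightBasis b hκ).sum_repr μ]
  refine sum_mem fun j _ => ?_
  have h1 := h _ (fundWeight_mem_weightLattice b j)
  have h2 : fundForm b μ (fundWeight b j) = κ * (coweightBasis b hκ).repr μ j := by
    conv_lhs => rw [← (coweightBasis b hκ).sum_repr μ]
    rw [map_sum, LinearMap.sum_apply, Finset.sum_eq_single j]
    · rw [map_smul, LinearMap.smul_apply, fundForm_comm, coweightBasis_apply, fundForm_coweight,
        coroot'_fundWeight, if_pos rfl, smul_eq_mul, mul_one, mul_comm]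
    · intro i _ hij
      rw [map_smul, LinearMap.smul_apply, fundForm_comm, coweightBasis_apply, fundForm_coweight,
        coroot'_fundWeight, if_neg hij, mul_zero, smul_zero]
    · simp
  rw [charExp, h2, Complex.exp_eq_one_iff] at h1
  obtain ⟨n, hn⟩ := h1
  have h3 : (coweightBasis b hκ).repr μ j = n := by
    have h4 : 2 * (Real.pi : ℂ) * Complex.I ≠ 0 := Complex.two_pi_I_ne_zero
    have h5 : 2 * (Real.pi : ℂ) * Complex.I * (κ * (coweightBasis b hκ).repr μ j) / κ =
      (coweightBasis b hκ).repr μ j * (2 * Real.pi * Complex.I) := by field_simp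
    rw [h5] at hn
    exact mul_right_cancel₀ h4 hn
  rw [h3, coweightBasis_apply, Int.cast_smul_eq_zsmul]
  exact zsmul_mem (coweight_mem b κ _) _

/-- The character of the finite quotient of the weight lattice given by a weight. -/
def weightChar (hκ : κ ≠ 0) (μ : weightLattice P) : AddChar (WeightQuotient b κ) ℂ where
  toFun x := charExp b κ μ (Quotient.out x : weightLattice P)
  map_zero_eq_one' := by
    have h := out_sub_mem b (κ := κ) 0
    exact (charExp_eq_of_sub_mem b hκ μ.2 h).trans (charExp_zero_right b _)
  map_add_eq_mul' x y := by
    rw [← charExp_add_right]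
    refine charExp_eq_of_sub_mem b hκ μ.2 ?_
    have h := out_sub_mem b (κ := κ) (Quotient.out x + Quotient.out y)
    rw [QuotientAddGroup.mk_add, QuotientAddGroup.out_eq', QuotientAddGroup.out_eq'] at h
    exact h

theorem sum_charExp (hκ : κ ≠ 0) {μ : M} (hμ : μ ∈ weightLattice P)
    [Fintype (WeightQuotient b κ)] [Decidable (μ ∈ coweightLattice b κ)] :
    ∑ x : WeightQuotient b κ, charExp b κ μ (Quotient.out x : weightLattice P) =
      if μ ∈ coweightLattice b κ then (Fintype.card (WeightQuotient b κ) : ℂ) else 0 := by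
  classical
  have h := AddChar.sum_eq_ite (weightChar b hκ ⟨μ, hμ⟩)
  refine h.trans ?_
  congr 1
  rw [eq_iff_iff]
  refine ⟨fun h => mem_coweightLattice_of_charExp b hκ fun x hx => ?_, fun h => ?_⟩
  · have h1 := DFunLike.congr_fun h (QuotientAddGroup.mk ⟨x, hx⟩ : WeightQuotient b κ)
    rw [AddChar.zero_apply] at h1
    rw [← h1]
    exact (charExp_eq_of_sub_mem b hκ hμ (out_sub_mem b ⟨x, hx⟩)).symm
  · ext x
    have := charExp_eq_one b hκ (Quotient.out x : weightLattice P).2 h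
    rw [charExp_comm] at this
    exact this

variable (κ) in
/-- The value of the Weyl denominator at `x`. -/
def denomVal (x : M) : ℂ :=
  ∏ i ∈ posRoots b, (charExp b κ ((2⁻¹ : ℂ) • P.root i) x - charExp b κ (-((2⁻¹ : ℂ) • P.root i)) x)

/-- Evaluation of exponentials at x is a ring homomorphism, applied here to the denominator formula.
-/
theorem denomVal_eq_sum [Fintype (weyl P)] (x : M) : denomVal b κ x =
    ∑ w : weyl P, (weylDenom b).coeff (w.1 (weylVector b)) * charExp b κ (w.1 (weylVector b)) x := by
  let F : Multiplicative M →* ℂ :=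
    { toFun := fun μ => charExp b κ μ.toAdd x
      map_one' := charExp_zero_left b x
      map_mul' := fun μ ν => charExp_add_left b _ _ x }
  have h1 : AddMonoidAlgebra.lift ℤ ℂ M F (weylDenom b) = denomVal b κ x := by
    rw [weylDenom, map_prod, denomVal]
    refine Finset.prod_congr rfl fun i _ => ?_
    rw [denomFactor, map_sub, AddMonoidAlgebra.lift_single, AddMonoidAlgebra.lift_single,
      one_smul, one_smul]
    rfl
  rw [← h1, weylDenom_eq_sum_weyl, map_sum]
  refine Finset.sum_congr rfl fun w _ => ?_
  rw [AddMonoidAlgebra.lift_single, zsmul_eq_mul, ← weylDenom_eq_sum_weyl]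
  rfl

theorem sinProd_eq_posRoots (x : M) :
    sinProd b κ x = ∏ i ∈ posRoots b, (2 * Real.sin (Real.pi * rePair b i x / κ)) ^ 2 := by
  classical
  rw [sinProd, ← Finset.prod_mul_prod_compl (posRoots b)]
  have h : ∏ i ∈ (posRoots b)ᶜ, |2 * Real.sin (Real.pi * rePair b i x / κ)| =
      ∏ i ∈ posRoots b, |2 * Real.sin (Real.pi * rePair b i x / κ)| := by
    refine Finset.prod_bij' (fun i _ => P.reflectionPerm i i) (fun i _ => P.reflectionPerm i i)
      ?_ ?_ ?_ ?_ ?_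
    · intro i hi
      rwa [mem_posRoots, isPos_neg_iff, ← mem_posRoots, ← Finset.mem_compl]
    · intro i hi
      rwa [Finset.mem_compl, mem_posRoots, isPos_neg_iff, not_not, ← mem_posRoots]
    · intro i _; exact P.root.injective (by
      simp [P.root_reflectionPerm, P.reflection_reflectionPerm])
    · intro i _; exact P.root.injective (by
      simp [P.root_reflectionPerm, P.reflection_reflectionPerm])
    · intro i _
      rw [rePair_neg_index, mul_neg, neg_div, Real.sin_neg, mul_neg, abs_neg]
  rw [h, ← Finset.prod_mul_distrib]
  exact Finset.prod_congr rfl fun i _ => by rw [← sq, sq_abs]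

theorem denomVal_mul_conj {x : M} (hx : x ∈ weightLattice P) :
    denomVal b κ x * (starRingEnd ℂ) (denomVal b κ x) = sinProd b κ x := by
  rw [sinProd_eq_posRoots, denomVal, map_prod, ← Finset.prod_mul_distrib, Complex.ofReal_prod]
  refine Finset.prod_congr rfl fun i _ => ?_
  have h1 : charExp b κ ((2⁻¹ : ℂ) • P.root i) x - charExp b κ (-((2⁻¹ : ℂ) • P.root i)) x =
      ((2 * Real.sin (Real.pi * rePair b i x / κ) : ℝ) : ℂ) * Complex.I := by
    have h2 : fundForm b (P.root i) x = (rePair b i x : ℂ) := by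
      rw [fundForm_comm, fundForm_root, rePair_mul_eq b hx]
    rw [charExp, charExp, map_neg, map_smul, LinearMap.neg_apply, LinearMap.smul_apply, h2]
    push_cast
    rw [Complex.sin]
    have h3 : 2 * (Real.pi : ℂ) * Complex.I * ((2⁻¹ : ℂ) • (rePair b i x : ℂ)) / κ =
      Real.pi * rePair b i x / κ * Complex.I := by
      rw [smul_eq_mul]; ring
    have h4 : 2 * (Real.pi : ℂ) * Complex.I * -((2⁻¹ : ℂ) • (rePair b i x : ℂ)) / κ =
      -(Real.pi * rePair b i x / κ) * Complex.I := by
      rw [smul_eq_mul]; ring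
    rw [h3, h4]
    linear_combination (Complex.exp (Real.pi * rePair b i x / κ * Complex.I) -
      Complex.exp (-(Real.pi * rePair b i x / κ) * Complex.I)) * Complex.I_sq
  rw [h1, map_mul, Complex.conj_ofReal, Complex.conj_I]
  push_cast
  linear_combination (-(2 * Complex.sin (Real.pi * rePair b i x / κ)) ^ 2) * Complex.I_sq

theorem conj_charExp {μ x : M} (hμ : μ ∈ weightLattice P) (hx : x ∈ weightLattice P) :
    (starRingEnd ℂ) (charExp b κ μ x) = charExp b κ (-μ) x := by
  choose c hc using hμ
  choose d hd using hx
  have h : fundForm b μ x = ((2 / lengthSq P (highestRoot b) * ∑ i, c i * d i : ℝ) : ℂ) := by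
    rw [fundForm, LinearMap.smul_apply, LinearMap.smul_apply, rootForm_root_self_eq,
      P.rootForm_apply_apply]
    push_cast
    rw [smul_eq_mul]
    simp only [hc, hd]
  rw [charExp, charExp, ← Complex.exp_conj, map_neg, LinearMap.neg_apply, h]
  congr 1
  simp [map_ofNat]

/-- Expanding |D|² gives a double sum over W. Off the diagonal, wρ - w'ρ is not in κQ^∨, by freeness
at ρ, so the character sums to zero. Each diagonal term contributes the order of the quotient, the
coefficients being ±1. -/
theorem sum_sinProd_weightQuotient (hρ : weylVector b ∈ alcove b κ) (hκ : κ ≠ 0)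
    [Fintype (WeightQuotient b κ)] :
    ∑ x : WeightQuotient b κ, sinProd b κ (Quotient.out x : weightLattice P) =
      Nat.card (weyl P) * Fintype.card (WeightQuotient b κ) := by
  classical
  have := Fintype.ofFinite (weyl P)
  have hmem : ∀ w : weyl P, w.1 (weylVector b) ∈ weightLattice P := fun w =>
    (weyl_mem_weightLattice_iff w.2 _).mpr (weylVector_mem_weightLattice b)
  apply Complex.ofReal_injective
  push_cast
  simp_rw [← denomVal_mul_conj b (Subtype.mem _), denomVal_eq_sum, map_sum, map_mul,
    map_intCast, conj_charExp b (hmem _) (Subtype.mem _), Finset.sum_mul_sum]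
  rw [Finset.sum_comm, Nat.card_eq_fintype_card, ← Finset.card_univ, ← nsmul_eq_mul,
    ← Finset.sum_const]
  refine Finset.sum_congr rfl fun w _ => ?_
  rw [Finset.sum_comm, Finset.sum_eq_single w]
  · have h1 : ∀ x : M, charExp b κ (w.1 (weylVector b)) x * charExp b κ (-w.1 (weylVector b)) x = 1 :=
      fun x => by rw [← charExp_add_left, add_neg_cancel, charExp_zero_left]
    have h2 := coeff_weylDenom_sq b w
    have h3 : (((weylDenom b).coeff (w.1 (weylVector b)) : ℤ) : ℂ) ^ 2 = 1 := by exact_mod_cast h2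
    rw [Finset.sum_congr rfl fun x _ => ?_, Finset.sum_const, nsmul_eq_mul, mul_one,
      Finset.card_univ]
    rw [mul_mul_mul_comm, h1, mul_one, ← sq, h3]
  · intro w' _ hne
    have h1 : ∀ x : M, charExp b κ (w.1 (weylVector b)) x * charExp b κ (-w'.1 (weylVector b)) x =
        charExp b κ (w.1 (weylVector b) - w'.1 (weylVector b)) x :=
      fun x => by rw [← charExp_add_left, sub_eq_add_neg]
    rw [Finset.sum_congr rfl fun x _ => by rw [mul_mul_mul_comm, h1], ← Finset.mul_sum, sum_charExp b hκ (sub_mem (hmem w) (hmem w')), if_neg, mul_zero]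
    intro h
    exact hne (Subtype.ext (weyl_free b w.2 w'.2 hρ hρ h).1).symm
  · simp

/-- The sum of the products of sines over the weights in the alcove. -/
theorem sum_sinProd_alcove (hρ : weylVector b ∈ alcove b κ) (hκ : κ ≠ 0) :
    ((∑ x ∈ (finite_alcove_weights b (κ := κ)).toFinset, sinProd b κ x : ℝ) : ℂ) * fundDet b =
      κ ^ Fintype.card b.support := by
  have := finite_weightQuotient b hκ
  have := Fintype.ofFinite (WeightQuotient b κ)
  have h1 := sum_sinProd_quotient b hρ hκ
  rw [sum_sinProd_weightQuotient b hρ hκ] at h1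
  have h2 : (Nat.card (weyl P) : ℝ) ≠ 0 := by exact_mod_cast Nat.card_pos.ne'
  rw [← mul_left_cancel₀ h2 h1, ← card_weightQuotient_mul_fundDet b hκ, Nat.card_eq_fintype_card]
  simp

/-! ### The global dimension as a product over the positive roots -/

/-- Since 0 < π/κ ≤ π, the principal logarithm of q is iπ/κ. So complex powers of q have the
intended value also at the fractional exponents of the non simply laced types. -/
theorem qNum_eq {κ : ℕ} (hκ : 2 ≤ κ) (y : ℝ) :
    qNum (Complex.exp (Complex.I * Real.pi / κ)) y =
      ((Real.sin (Real.pi * y / κ) / Real.sin (Real.pi / κ) : ℝ) : ℂ) := by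
  have hκ' : (0 : ℝ) < κ := by exact_mod_cast (show 0 < κ by lia)
  have h0 : Complex.I * Real.pi / κ = ((Real.pi / κ : ℝ) : ℂ) * Complex.I := by push_cast; ring
  have h1 : Complex.log (Complex.exp (Complex.I * Real.pi / κ)) = Complex.I * Real.pi / κ := by
    rw [h0]
    apply Complex.log_exp
    · rw [Complex.im_ofReal_mul, Complex.I_im, mul_one]
      have := div_pos Real.pi_pos hκ'
      linarith [Real.pi_pos]
    · rw [Complex.im_ofReal_mul, Complex.I_im, mul_one]
      exact div_le_self Real.pi_pos.le (by exact_mod_cast (show 1 ≤ κ by lia))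
  have h2 : ∀ z : ℂ, Complex.exp (Complex.I * Real.pi / κ) ^ z =
      Complex.exp (Complex.I * Real.pi / κ * z) := fun z => by
    rw [Complex.cpow_def_of_ne_zero (Complex.exp_ne_zero _), h1]
  have h3 : ∀ z : ℂ, Complex.exp (z * Complex.I) - Complex.exp (-z * Complex.I) =
      2 * Complex.I * Complex.sin z := fun z => by
    rw [Complex.sin]
    linear_combination (Complex.exp (z * Complex.I) - Complex.exp (-z * Complex.I)) * Complex.I_sq
  rw [qNum, h2, h2, ← Complex.exp_neg]
  have h4 : Complex.I * Real.pi / κ * y = Real.pi * y / κ * Complex.I := by ring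
  have h5 : Complex.I * Real.pi / κ * -y = -(Real.pi * y / κ) * Complex.I := by ring
  have h6 : -(Complex.I * Real.pi / κ) = -(Real.pi / κ) * Complex.I := by ring
  have h7 : Complex.I * Real.pi / κ = Real.pi / κ * Complex.I := by ring
  rw [h4, h5, h6, h7, h3, h3, mul_div_mul_left _ _ (mul_ne_zero two_ne_zero Complex.I_ne_zero)]
  push_cast
  rfl

theorem two_le_dualCoxeterNumber : 2 ≤ dualCoxeterNumber b := by
  have h1 := dualCoxeterNumber_eq b
  rw [rePair_eq, coroot'_weylVector_eq, halfNorm_highestRoot, one_mul, Complex.intCast_re] at h1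
  have h2 : 0 ≤ rePair b (highestRoot b) (weylVector b) :=
    rePair_nonneg_of_isPos b (fun j => (rePair_weylVector_pos b j).le) (isPos_highestRoot b)
  rw [rePair_eq, coroot'_weylVector_eq, halfNorm_highestRoot, one_mul, Complex.intCast_re] at h2
  have h3 : 0 ≤ b.flip.height (highestRoot b) := by exact_mod_cast h2
  have h4 := b.flip.height_ne_zero (highestRoot b)
  have h5 : (dualCoxeterNumber b : ℤ) = b.flip.height (highestRoot b) + 1 := by exact_mod_cast h1
  lia

theorem weylVector_mem_alcove (k : ℕ) : weylVector b ∈ alcove b (dualCoxeterNumber b + k) := by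
  refine ⟨rePair_weylVector_pos b, ?_⟩
  have := dualCoxeterNumber_eq b
  push_cast
  have : (0 : ℝ) ≤ k := Nat.cast_nonneg k
  linarith

theorem mem_dominantWeights_iff {n : M} :
    n ∈ dominantWeights b ↔ ∀ j : b.support, ∃ c : ℕ, P.coroot' j n = c := by
  classical
  refine ⟨fun ⟨c, hc⟩ j => ⟨c j, ?_⟩, fun h => ?_⟩
  · rw [hc, map_sum, Finset.sum_eq_single j]
    · rw [map_nsmul, coroot'_fundWeight]; simp
    · intro i _ hij
      rw [map_nsmul, coroot'_fundWeight, if_neg hij.symm, smul_zero]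
    · simp
  · choose c hc using h
    refine ⟨c, (eq_sum_fundWeight b n).trans (Finset.sum_congr rfl fun j _ => ?_)⟩
    rw [hc, Nat.cast_smul_eq_nsmul]

/-- Adding ρ adds one to each fundamental coordinate and g - 1 to the pairing with θ. By
integrality, nonnegative coordinates become positive ones, and level at most k becomes ⟨x,θ⟩ < g +
k. -/
theorem mem_simpleObjects_iff {k : ℕ} {n : M} : n ∈ simpleObjects b k ↔
    n + weylVector b ∈ (alcove b (dualCoxeterNumber b + k) ∩ weightLattice P : Set M) := by
  have hg := dualCoxeterNumber_eq b
  have hθ : ∀ x, fundForm b x (P.root (highestRoot b)) = P.coroot' (highestRoot b) x := fun x => by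
    rw [fundForm_root, halfNorm_highestRoot]; simp
  constructor
  · rintro ⟨hn, l, hl, hlk⟩
    rw [mem_dominantWeights_iff] at hn
    refine ⟨⟨fun j => ?_, ?_⟩, add_mem (coroot'_mem_of_support b fun j => ?_)
      (weylVector_mem_weightLattice b)⟩
    · obtain ⟨c, hc⟩ := hn j
      rw [rePair_add, rePair_eq, hc, Complex.natCast_re]
      exact add_pos_of_nonneg_of_pos (mul_nonneg (halfNorm_pos b j).le (Nat.cast_nonneg c))
        (rePair_weylVector_pos b j)
    · have h1 : rePair b (highestRoot b) n = l := by rw [rePair, hl, Complex.natCast_re]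
      rw [rePair_add, h1]
      push_cast
      have : (l : ℝ) ≤ k := by exact_mod_cast hlk
      linarith
    · obtain ⟨c, hc⟩ := hn j
      exact ⟨c, by rw [hc]; simp⟩
  · rintro ⟨⟨h1, h2⟩, h3⟩
    have hn : n ∈ weightLattice P := by
      have := sub_mem h3 (weylVector_mem_weightLattice b)
      rwa [add_sub_cancel_right] at this
    have hpos : ∀ j : b.support, ∃ c : ℕ, P.coroot' j n = c := fun j => by
      obtain ⟨m, hm⟩ := hn j
      have h4 := h1 j
      rw [rePair_add, rePair_weylVector, rePair_eq, hm, Complex.intCast_re] at h4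
      have h5 : (0 : ℝ) < m + 1 :=
        pos_of_mul_pos_right (b := (m : ℝ) + 1) (by linarith) (halfNorm_pos b j).le
      have h6 : 0 < m + 1 := by exact_mod_cast h5
      obtain ⟨c, rfl⟩ := Int.eq_ofNat_of_zero_le (show 0 ≤ m by lia)
      exact ⟨c, by rw [hm]; simp⟩
    refine ⟨(mem_dominantWeights_iff b).mpr hpos, ?_⟩
    obtain ⟨m, hm⟩ := hn (highestRoot b)
    have h4 : rePair b (highestRoot b) n = m := by rw [rePair, hθ, hm, Complex.intCast_re]
    have h5 : 0 ≤ rePair b (highestRoot b) n := rePair_nonneg_of_isPos b (fun j => by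
      obtain ⟨c, hc⟩ := hpos j
      rw [rePair_eq, hc, Complex.natCast_re]
      exact mul_nonneg (halfNorm_pos b j).le (Nat.cast_nonneg c)) (isPos_highestRoot b)
    rw [h4] at h5
    obtain ⟨l, rfl⟩ := Int.eq_ofNat_of_zero_le (show 0 ≤ m by exact_mod_cast h5)
    refine ⟨l, by rw [hθ, hm]; simp, ?_⟩
    rw [rePair_add, h4] at h2
    push_cast at h2
    have h6 : (l : ℝ) < k + 1 := by linarith
    have h7 : l < k + 1 := by exact_mod_cast h6
    lia

theorem simpleObjects_eq_image (k : ℕ) : simpleObjects b k = (fun x => x - weylVector b) ''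
    (alcove b (dualCoxeterNumber b + k) ∩ weightLattice P : Set M) := by
  ext n
  rw [mem_simpleObjects_iff]
  exact ⟨fun h => ⟨_, h, add_sub_cancel_right _ _⟩, by rintro ⟨x, hx, rfl⟩; simpa using hx⟩

theorem finite_simpleObjects (k : ℕ) : (simpleObjects b k).Finite := by
  rw [simpleObjects_eq_image]
  exact (finite_alcove_weights b).image _

theorem qNum_rootOfUnity (k : ℕ) (y : ℝ) : qNum (rootOfUnity b k) y =
    ((Real.sin (Real.pi * y / (dualCoxeterNumber b + k : ℕ)) /
      Real.sin (Real.pi / (dualCoxeterNumber b + k : ℕ)) : ℝ) : ℂ) := by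
  rw [← qNum_eq (le_add_right (two_le_dualCoxeterNumber b)), rootOfUnity]
  push_cast
  rfl

theorem sin_pi_div_pos (k : ℕ) : 0 < Real.sin (Real.pi / (dualCoxeterNumber b + k : ℕ)) := by
  have h : (2 : ℝ) ≤ (dualCoxeterNumber b + k : ℕ) := by
    exact_mod_cast le_add_right (two_le_dualCoxeterNumber b)
  refine Real.sin_pos_of_pos_of_lt_pi (div_pos Real.pi_pos (by linarith)) ?_
  rw [div_lt_iff₀ (by linarith)]
  nlinarith [Real.pi_pos]

/-- The factors sin(π/κ) cancel between numerator and denominator. Opposite roots contribute equally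
to the sine product, which is therefore a product of squares over the positive roots. -/
theorem qdim_sq {k : ℕ} {x : M} (hx : x ∈ weightLattice P) :
    qdim b k (x - weylVector b) ^ 2 =
      ((sinProd b (dualCoxeterNumber b + k) x /
        sinProd b (dualCoxeterNumber b + k) (weylVector b) : ℝ) : ℂ) := by
  have h : ∀ {y} (_ : y ∈ weightLattice P) (i : ι), fundForm b y (P.root i) = (rePair b i y : ℂ) :=
    fun hy i => by rw [fundForm_root, rePair_mul_eq b hy]
  rw [qdim, sub_add_cancel, ← Finset.prod_pow, sinProd_eq_posRoots, sinProd_eq_posRoots,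
    ← Finset.prod_div_distrib, Complex.ofReal_prod]
  refine Finset.prod_congr rfl fun i _ => ?_
  rw [h hx, h (weylVector_mem_weightLattice b), qNum_rootOfUnity, qNum_rootOfUnity,
    ← Complex.ofReal_div, div_div_div_cancel_right₀ (sin_pi_div_pos b k).ne', ← Complex.ofReal_pow,
    ← div_pow, mul_div_mul_left _ _ two_ne_zero]

theorem sinProd_weylVector (k : ℕ) :
    ((sinProd b (dualCoxeterNumber b + k) (weylVector b) : ℝ) : ℂ) =
      (2 * (Real.sin (Real.pi / (dualCoxeterNumber b + k : ℕ)) : ℂ)) ^ (2 * (posRoots b).card) *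
        (∏ i ∈ posRoots b, qNum (rootOfUnity b k) (rePair b i (weylVector b))) ^ 2 := by
  have h := (sin_pi_div_pos b k).ne'
  rw [pow_mul, ← Finset.prod_const, ← Finset.prod_pow, ← Finset.prod_mul_distrib,
    sinProd_eq_posRoots, Complex.ofReal_prod]
  refine Finset.prod_congr rfl fun i _ => ?_
  rw [qNum_rootOfUnity, ← mul_pow]
  have : (2 * Real.sin (Real.pi * rePair b i (weylVector b) / (dualCoxeterNumber b + k : ℕ))) =
      2 * Real.sin (Real.pi / (dualCoxeterNumber b + k : ℕ)) *
      (Real.sin (Real.pi * rePair b i (weylVector b) / (dualCoxeterNumber b + k : ℕ)) /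
        Real.sin (Real.pi / (dualCoxeterNumber b + k : ℕ))) := by
    field_simp
  rw [this, Complex.ofReal_pow, Complex.ofReal_mul, Complex.ofReal_mul, Complex.ofReal_ofNat]

/-- The global dimension, as a product over the positive roots. -/
theorem globalDim_eq_prod_posRoots (k : ℕ) : globalDim b k =
    ((dualCoxeterNumber b + k : ℕ) : ℂ) ^ Fintype.card b.support /
      (fundDet b * ((2 * (Real.sin (Real.pi / (dualCoxeterNumber b + k : ℕ)) : ℂ)) ^
        (2 * (posRoots b).card) *
        (∏ i ∈ posRoots b, qNum (rootOfUnity b k) (rePair b i (weylVector b))) ^ 2)) := by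
  have hκ : dualCoxeterNumber b + k ≠ 0 := by have := two_le_dualCoxeterNumber b; lia
  have h1 := sum_sinProd_alcove b (weylVector_mem_alcove b k) hκ
  have h2 : fundDet b ≠ 0 := by
    intro h
    rw [h, mul_zero] at h1
    exact pow_ne_zero _ (Nat.cast_ne_zero.mpr hκ) h1.symm
  rw [← sinProd_weylVector, ← div_div, ← h1, mul_div_cancel_right₀ _ h2, ← Complex.ofReal_div,
    globalDim, simpleObjects_eq_image, finsum_mem_image (sub_left_injective.injOn),
    finsum_mem_eq_finite_toFinset_sum _ (finite_alcove_weights b), Finset.sum_div,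
    Complex.ofReal_sum]
  refine Finset.sum_congr rfl fun x hx => ?_
  rw [Set.Finite.mem_toFinset] at hx
  exact qdim_sq b hx.2

/-! ### The number of roots and the Coxeter number -/

/-- The endomorphism `x ↦ ∑ ⟨x, α^∨⟩ α`, the sum being over all roots. -/
def rootSumEnd (P : RootPairing ι ℂ M N) : Module.End ℂ M :=
  ∑ i, (P.coroot' i).smulRight (P.root i)

theorem rootSumEnd_apply (x : M) : rootSumEnd P x = ∑ i, P.coroot' i x • P.root i := by
  simp [rootSumEnd, LinearMap.sum_apply]

theorem rootSumEnd_reflection (j : ι) (x : M) :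
    rootSumEnd P (P.reflection j x) = P.reflection j (rootSumEnd P x) := by
  rw [rootSumEnd_apply, rootSumEnd_apply, map_sum]
  refine Fintype.sum_equiv (P.reflectionPerm j) _ _ fun i => ?_
  rw [P.coroot'_reflection, map_smul, ← P.root_reflectionPerm, P.reflectionPerm_self]

-- Schur's lemma: the endomorphism commutes with the reflections, so an eigenspace is an invariant
-- subspace, and irreducibility makes it everything.
include b in
theorem exists_rootSumEnd_eq : ∃ c : ℂ, ∀ x, rootSumEnd P x = c • x := by
  have : FiniteDimensional ℂ M := b.toWeightBasis.finiteDimensional_of_finite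
  have : Nontrivial M := RootPairing.IsIrreducible.nontrivial P
  obtain ⟨c, hc⟩ := Module.End.exists_eigenvalue (rootSumEnd P)
  refine ⟨c, ?_⟩
  have h := RootPairing.IsIrreducible.eq_top_of_invtSubmodule_reflection (P := P)
    (Module.End.eigenspace (rootSumEnd P) c) (fun i => ?_) hc
  · intro x
    rw [← Module.End.mem_eigenspace_iff, h]
    trivial
  · intro x hx
    rw [Submodule.mem_comap]
    rw [Module.End.mem_eigenspace_iff] at hx ⊢
    have h1 := rootSumEnd_reflection (P := P) i x
    rw [hx, map_smul] at h1
    exact h1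

theorem sum_compl_posRoots {A : Type*} [AddCommMonoid A] [DecidableEq ι] (f : ι → A) :
    ∑ i ∈ (posRoots b)ᶜ, f i = ∑ i ∈ posRoots b, f (P.reflectionPerm i i) := by
  have h : ∀ i : ι, P.reflectionPerm (P.reflectionPerm i i) (P.reflectionPerm i i) = i := fun i =>
    P.root.injective (by simp [P.root_reflectionPerm, P.reflection_reflectionPerm])
  refine Finset.sum_bij' (fun i _ => P.reflectionPerm i i) (fun i _ => P.reflectionPerm i i)
    (fun i hi => ?_) (fun i hi => ?_) (fun i _ => h i) (fun i _ => h i) fun i _ => by rw [h]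
  · rwa [mem_posRoots, isPos_neg_iff, ← mem_posRoots, ← Finset.mem_compl]
  · rwa [Finset.mem_compl, mem_posRoots, isPos_neg_iff, not_not, ← mem_posRoots]

theorem card_posRoots : Fintype.card ι = 2 * (posRoots b).card := by
  classical
  have h := sum_compl_posRoots b fun _ => 1
  rw [Finset.sum_const, Finset.sum_const, smul_eq_mul, smul_eq_mul, mul_one, mul_one] at h
  rw [← Finset.card_add_card_compl (posRoots b), h, two_mul]

/-- The height of a coroot is a positive multiple of the pairing of its root with ρ. -/
theorem isPos_flip_iff (i : ι) : b.flip.IsPos i ↔ b.IsPos i := by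
  have h : ∀ i, b.IsPos i → b.flip.IsPos i := fun i hi => by
    have h1 := rePair_nonneg_of_isPos b (fun j => (rePair_weylVector_pos b j).le) hi
    rw [rePair_eq, coroot'_weylVector_eq, Complex.intCast_re] at h1
    have h2 : (0 : ℝ) ≤ b.flip.height i := nonneg_of_mul_nonneg_right h1 (halfNorm_pos b i)
    have h3 : 0 ≤ b.flip.height i := by exact_mod_cast h2
    have h4 := b.flip.height_ne_zero i
    rw [RootPairing.Base.isPos_iff]
    lia
  refine ⟨fun hi => ?_, h i⟩
  by_contra hc
  have h1 := h _ ((isPos_neg_iff b i).mpr hc)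
  exact (isPos_neg_iff b.flip i).mp h1 hi

/-- The half sum of the positive coroots is the Weyl vector of the dual root system, and it pairs
with a root to give its height. -/
theorem sum_posRoots_pairing_highestRoot :
    ∑ i ∈ posRoots b, P.pairingIn ℤ (highestRoot b) i = 2 * b.height (highestRoot b) := by
  have h1 := coroot'_weylVector_eq b.flip (highestRoot b)
  have h2 : posRoots b.flip = posRoots b := by
    ext i
    rw [mem_posRoots, mem_posRoots, isPos_flip_iff]
  rw [weylVector, h2, map_smul, map_sum] at h1
  have h3 : ∑ i ∈ posRoots b, (P.pairingIn ℤ (highestRoot b) i : ℂ) =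
      2 * (b.height (highestRoot b) : ℂ) := by
    have h4 : (b.flip.flip.height (highestRoot b) : ℂ) = b.height (highestRoot b) := rfl
    rw [← h4, ← h1, smul_eq_mul, ← mul_assoc, mul_inv_cancel₀ two_ne_zero, one_mul]
    exact Finset.sum_congr rfl fun i _ => (pairing_eq_intCast _ _).symm
  exact_mod_cast h3

/-- For a positive root α ≠ θ, the integer ⟨α,θ^∨⟩ is 0 or 1, so the product is just ⟨θ,α^∨⟩; for α
= θ it is 2 more than that. The positive roots thus contribute 2 ht θ + 2 = 2γ, and so do the
negative ones. -/
theorem sum_pairing_highestRoot :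
    ∑ i, P.pairingIn ℤ (highestRoot b) i * P.pairingIn ℤ i (highestRoot b) =
      4 * coxeterNumber b := by
  classical
  have h1 : ∑ i ∈ (posRoots b)ᶜ,
      P.pairingIn ℤ (highestRoot b) i * P.pairingIn ℤ i (highestRoot b) =
      ∑ i ∈ posRoots b, P.pairingIn ℤ (highestRoot b) i * P.pairingIn ℤ i (highestRoot b) :=
    (sum_compl_posRoots b _).trans (Finset.sum_congr rfl fun i _ => by simp)
  have h2 : ∀ i ∈ posRoots b, P.pairingIn ℤ (highestRoot b) i * P.pairingIn ℤ i (highestRoot b) =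
      P.pairingIn ℤ (highestRoot b) i + if i = highestRoot b then 2 else 0 := by
    intro i hi
    rw [mem_posRoots] at hi
    split_ifs with h
    · subst h; simp
    · have h3 := abs_pairingIn_highestRoot_le_one b h fun e => by
        have e' : i = P.reflectionPerm (highestRoot b) (highestRoot b) :=
          P.root.injective (by rw [e]; simp)
        rw [e', isPos_neg_iff] at hi
        exact hi (isPos_highestRoot b)
      have h4 := pairingIn_highestRoot_nonneg_of_isPos b hi
      have h5 := P.pairingIn_eq_zero_iff (S := ℤ) (i := i) (j := highestRoot b)
      rcases abs_le.mp h3 with ⟨-, h6⟩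
      rw [add_zero]
      by_cases h7 : P.pairingIn ℤ i (highestRoot b) = 0
      · rw [h7, h5.mp h7, mul_zero]
      · rw [show P.pairingIn ℤ i (highestRoot b) = 1 by lia, mul_one]
  rw [← Finset.sum_add_sum_compl (posRoots b), h1, Finset.sum_congr rfl h2, Finset.sum_add_distrib,
    sum_posRoots_pairing_highestRoot, Finset.sum_ite_eq', if_pos ((mem_posRoots b).mpr
      (isPos_highestRoot b)), coxeterNumber_eq]
  ring

/-- The number of roots is the product of the rank and the Coxeter number. -/
theorem two_mul_card_posRoots :
    2 * (posRoots b).card = Fintype.card b.support * coxeterNumber b := by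
  have : FiniteDimensional ℂ M := b.toWeightBasis.finiteDimensional_of_finite
  obtain ⟨c, hc⟩ := exists_rootSumEnd_eq b
  -- The scalar is found by evaluating at θ and pairing with θ^∨; comparing traces then counts the
  -- roots, each rank one summand having trace 2.
  have h1 : c = 2 * coxeterNumber b := by
    have h2 := hc (P.root (highestRoot b))
    rw [rootSumEnd_apply] at h2
    have h3 := congrArg (P.coroot' (highestRoot b)) h2
    rw [map_sum, map_smul, P.root_coroot'_eq_pairing, P.pairing_same] at h3
    have h4 := sum_pairing_highestRoot b
    have h5 : ∑ i, P.coroot' (highestRoot b) (P.coroot' i (P.root (highestRoot b)) • P.root i) =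
        ((∑ i, P.pairingIn ℤ (highestRoot b) i * P.pairingIn ℤ i (highestRoot b) : ℤ) : ℂ) := by
      push_cast
      refine Finset.sum_congr rfl fun i _ => ?_
      rw [map_smul, P.root_coroot'_eq_pairing, P.root_coroot'_eq_pairing, pairing_eq_intCast,
        pairing_eq_intCast, smul_eq_mul]
    rw [h5, h4, smul_eq_mul] at h3
    push_cast at h3
    linear_combination -(1 / 2 : ℂ) * h3
  have h2 : LinearMap.trace ℂ M (rootSumEnd P) = 2 * Fintype.card ι := by
    rw [rootSumEnd, map_sum]
    simp [LinearMap.trace_smulRight, -LinearMap.flip_apply, mul_comm]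
  have h3 : rootSumEnd P = c • LinearMap.id := LinearMap.ext hc
  rw [h3, map_smul, LinearMap.trace_id, finrank_eq_card_basis b.toWeightBasis, h1,
    card_posRoots b, smul_eq_mul] at h2
  have h4 : ((coxeterNumber b * Fintype.card b.support : ℕ) : ℂ) = (2 * (posRoots b).card : ℕ) := by
    push_cast
    push_cast at h2
    linear_combination (1 / 2 : ℂ) * h2
  have h5 := Nat.cast_injective h4
  rw [← h5, mul_comm]

/-! ### Explicit models of root systems -/

/-- Induction over the positive roots, through reflections in simple roots. -/
theorem isPos_induction {p : ι → Prop} (h₁ : ∀ j : b.support, p j)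
    (h₂ : ∀ (i : ι) (j : b.support), b.IsPos i → i ≠ j → p i → p (P.reflectionPerm j i))
    {i : ι} (hi : b.IsPos i) : p i := by
  generalize hn : (b.height i).toNat = n
  induction n using Nat.strong_induction_on generalizing i with
  | _ n ih =>
    obtain ⟨j, hj, hj'⟩ := hi.exists_mem_support_pos_pairingIn
    rw [P.zero_lt_pairingIn_iff'] at hj'
    by_cases hij : i = j
    · exact hij ▸ h₁ ⟨j, hj⟩
    · have h3 : b.IsPos (P.reflectionPerm j i) := hi.reflectionPerm hj hij
      have h4 := height_reflectionPerm b i ⟨j, hj⟩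
      have h5 : P.reflectionPerm j i ≠ j := reflectionPerm_ne b hi
        (RootPairing.Base.isPos_of_mem_support hj)
      rw [RootPairing.Base.isPos_iff] at h3
      have h6 := ih _ (by simp only at h4; lia) h3 rfl
      have h7 := h₂ _ ⟨j, hj⟩ h3 h5 h6
      simpa using h7

/-- Half of the squared lengths of the simple roots are determined by the Cartan matrix. -/
theorem halfNorm_eq_of_cartanMatrix {d : b.support → ℝ} (hd : ∀ j, 0 < d j) (hd1 : ∀ j, d j ≤ 1)
    (hd1' : ∃ j, d j = 1) (h : ∀ i j, d i * b.cartanMatrix j i = d j * b.cartanMatrix i j)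
    (j : b.support) : halfNorm b j = d j := by
  obtain ⟨j₁, hj₁⟩ := hd1'
  -- Two symmetrizers of a connected Cartan matrix are proportional.
  have h1 : ∀ j : b.support, halfNorm b j = halfNorm b j₁ * d j := fun j => by
    refine b.induction_on_cartanMatrix (fun j => halfNorm b j = halfNorm b j₁ * d j) (i := j₁)
      (by rw [hj₁, mul_one]) fun i j hi hij => ?_
    have h2 := halfNorm_mul_pairing b (i : ι) j
    have h3 := h i j
    have h4 : (b.cartanMatrix j i : ℝ) ≠ 0 := by exact_mod_cast hij
    have h5 : (b.cartanMatrix i j : ℝ) ≠ 0 := by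
      intro h5
      rw [h5, mul_zero] at h3
      exact mul_ne_zero (hd i).ne' h4 h3
    have h6 : halfNorm b i * b.cartanMatrix j i = halfNorm b j * b.cartanMatrix i j := h2
    rw [hi] at h6
    refine mul_right_cancel₀ h5 ?_
    linear_combination -h6 + halfNorm b j₁ * h3
  -- Every root is conjugate to a simple root, so the length of θ occurs among the simple roots. As
  -- both families have maximum one, the factor of proportionality is one.
  have h2 : ∃ j : b.support, halfNorm b j = 1 := by
    have h3 : ∀ i : ι, ∃ j : b.support, halfNorm b j = halfNorm b i := fun i => by
      induction i using b.induction_reflect with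
      | h₀ i ih => rwa [halfNorm_reflectionPerm]
      | h₁ i hi => exact ⟨⟨i, hi⟩, rfl⟩
      | h₂ i j ih hj => rwa [halfNorm_reflectionPerm]
    obtain ⟨j, hj⟩ := h3 (highestRoot b)
    exact ⟨j, hj.trans (halfNorm_highestRoot b)⟩
  obtain ⟨j₂, hj₂⟩ := h2
  have h3 := h1 j₂
  have h4 := hd1 j₂
  have h5 := halfNorm_le_one b j₁
  have h6 := halfNorm_pos b j₁
  have h7 := hd j₂
  rw [hj₂] at h3
  have h8 : halfNorm b j₁ = 1 := by nlinarith
  rw [h1, h8, one_mul]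

/-- A realization of a Cartan matrix: vectors `root m`, the simple roots, linear forms `coroot m`,
the simple coroots, and a linear form `height`, together with a finite family of vectors, which is
stable enough under the simple reflections for it to be the family of positive roots. The numbers
`halfNorm m` are proportional to the squared lengths of the simple roots. -/
structure RootModel {r : ℕ} (C : Matrix (Fin r) (Fin r) ℤ) (V K : Type*) [AddCommGroup V] where
  /-- The simple roots. -/
  root : Fin r → V
  /-- The simple coroots. -/
  coroot : Fin r → V →+ ℤ
  coroot_root : ∀ m n, coroot n (root m) = C m n
  /-- The halves of the squared lengths of the simple roots. -/
  halfNorm : Fin r → ℝ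
  halfNorm_pos : ∀ m, 0 < halfNorm m
  halfNorm_le_one : ∀ m, halfNorm m ≤ 1
  exists_halfNorm_eq_one : ∃ m, halfNorm m = 1
  halfNorm_mul : ∀ m n, halfNorm m * C n m = halfNorm n * C m n
  /-- The pairing with the Weyl vector. -/
  height : V →+ ℝ
  height_root : ∀ m, height (root m) = halfNorm m
  /-- The set of indices of positive roots. -/
  index : Finset K
  /-- The positive roots. -/
  posRoot : K → V
  injOn : Set.InjOn posRoot index
  exists_root : ∀ m, ∃ k ∈ index, posRoot k = root m
  reflection_mem : ∀ k ∈ index, ∀ m, posRoot k = root m ∨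
    ∃ l ∈ index, posRoot l = posRoot k - coroot m (posRoot k) • root m
  /-- A measure that shows that all positive roots come from simple roots by reflections. -/
  depth : K → ℕ
  exists_lower : ∀ k ∈ index, (∃ m, posRoot k = root m) ∨
    ∃ m, ∃ l ∈ index, depth l < depth k ∧ coroot m (posRoot l) < 0 ∧
      posRoot k = posRoot l - coroot m (posRoot l) • root m

namespace RootModel

variable {r : ℕ} {C : Matrix (Fin r) (Fin r) ℤ} {V K : Type*} [AddCommGroup V]
  (R : RootModel C V K) (e : b.support ≃ Fin r)

/-- The vector that corresponds to a root. -/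
def toModel (i : ι) : V := ∑ j : b.support, coef b i j • R.root (e j)

variable {e} (he : ∀ i j, b.cartanMatrix i j = C (e i) (e j))

include he

theorem coroot_toModel (i : ι) (j : b.support) :
    R.coroot (e j) (R.toModel b e i) = P.pairingIn ℤ i j := by
  rw [toModel, map_sum, pairingIn_eq_sum_coef]
  refine Finset.sum_congr rfl fun k _ => ?_
  rw [map_zsmul, R.coroot_root, ← he, smul_eq_mul]
  rfl

theorem toModel_injective : Function.Injective (R.toModel b e) := by
  intro i i' h
  refine P.root.injective (sub_eq_zero.mp (eq_zero_of_coroot' b fun j => ?_))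
  rw [map_sub, P.root_coroot'_eq_pairing, P.root_coroot'_eq_pairing, pairing_eq_intCast,
    pairing_eq_intCast, ← R.coroot_toModel b he, ← R.coroot_toModel b he, h, sub_self]

omit he in
theorem toModel_support (j : b.support) : R.toModel b e j = R.root (e j) := by
  classical
  have h : (fun k : b.support => if k = j then (1 : ℤ) else 0) = coef b j := by
    refine coef_unique b ?_
    simp
  rw [toModel, ← h]
  simp

theorem toModel_reflectionPerm (i : ι) (j : b.support) :
    R.toModel b e (P.reflectionPerm j i) =
      R.toModel b e i - R.coroot (e j) (R.toModel b e i) • R.root (e j) := by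
  classical
  have h : (fun k : b.support => coef b i k - if k = j then P.pairingIn ℤ i j else 0) =
      coef b (P.reflectionPerm j i) := by
    refine coef_unique b ?_
    rw [P.root_reflectionPerm, P.reflection_apply_root, pairing_eq_intCast]
    conv_lhs => rw [root_eq_sum_coef b i]
    simp only [sub_smul, Finset.sum_sub_distrib]
    simp [Int.cast_smul_eq_zsmul]
  rw [R.coroot_toModel b he, toModel, ← h, toModel]
  simp only [sub_smul, Finset.sum_sub_distrib]
  simp

/-- The image of the positive roots lies in the family because the latter contains the simple roots
and is stable under the reflections that generate positive roots. Conversely, descent on the depth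
reaches each member of the family from a simple root. -/
theorem prod_posRoots_eq (f : V → ℂ) :
    ∏ i ∈ posRoots b, f (R.toModel b e i) = ∏ k ∈ R.index, f (R.posRoot k) := by
  classical
  have h1 : ∀ {i}, b.IsPos i → ∃ k ∈ R.index, R.posRoot k = R.toModel b e i := fun {i} hi => by
    refine isPos_induction b (p := fun i => ∃ k ∈ R.index, R.posRoot k = R.toModel b e i)
      (fun j => ?_) (fun i j _ hij ⟨k, hk, hki⟩ => ?_) hi
    · obtain ⟨k, hk, hk'⟩ := R.exists_root (e j)
      exact ⟨k, hk, by rw [hk', toModel_support]⟩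
    · rcases R.reflection_mem k hk (e j) with h | ⟨l, hl, hl'⟩
      · rw [hki, ← R.toModel_support b] at h
        exact absurd (R.toModel_injective b he h) hij
      · exact ⟨l, hl, by rw [hl', hki, R.toModel_reflectionPerm b he]⟩
  have h2 : ∀ k ∈ R.index, ∃ i, b.IsPos i ∧ R.toModel b e i = R.posRoot k := by
    intro k
    generalize hn : R.depth k = n
    induction n using Nat.strong_induction_on generalizing k with
    | _ n ih =>
      intro hk
      rcases R.exists_lower k hk with ⟨m, hm⟩ | ⟨m, l, hl, hlk, hneg, hkl⟩
      · refine ⟨e.symm m, RootPairing.Base.isPos_of_mem_support (e.symm m).2, ?_⟩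
        rw [R.toModel_support b, hm, e.apply_symm_apply]
      · obtain ⟨i, hi, hil⟩ := ih _ (by lia) l rfl hl
        refine ⟨P.reflectionPerm (e.symm m) i, ?_, ?_⟩
        · refine hi.reflectionPerm (e.symm m).2 ?_
          -- If the reflected root were the simple root itself, its pairing would be 2 rather than
          -- negative.
          rintro rfl
          have h3 := R.coroot_toModel b he (e.symm m) (e.symm m)
          rw [e.apply_symm_apply, hil, P.pairingIn_same] at h3
          lia
        · rw [R.toModel_reflectionPerm b he, e.apply_symm_apply, hil, hkl]
  have h3 : (posRoots b).image (R.toModel b e) = R.index.image R.posRoot := by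
    ext v
    simp only [Finset.mem_image, mem_posRoots]
    exact ⟨fun ⟨i, hi, hv⟩ => hv ▸ h1 hi, fun ⟨k, hk, hv⟩ => hv ▸ h2 k hk⟩
  rw [← Finset.prod_image (g := R.toModel b e) (f := f)
    (R.toModel_injective b he).injOn, h3, Finset.prod_image R.injOn]

theorem rePair_weylVector (i : ι) : rePair b i (weylVector b) = R.height (R.toModel b e i) := by
  have h : ∀ j : b.support, GlobalDim.halfNorm b j = R.halfNorm (e j) :=
    halfNorm_eq_of_cartanMatrix b (fun j => R.halfNorm_pos _) (fun j => R.halfNorm_le_one _)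
      (by obtain ⟨m, hm⟩ := R.exists_halfNorm_eq_one
          exact ⟨e.symm m, by rw [e.apply_symm_apply, hm]⟩)
      fun i j => by rw [he, he, R.halfNorm_mul]
  rw [rePair_eq_sum_coef, toModel, map_sum]
  refine Finset.sum_congr rfl fun j _ => ?_
  rw [GlobalDim.rePair_weylVector, h, map_zsmul, R.height_root, zsmul_eq_mul]

theorem prod_rePair_weylVector (f : ℝ → ℂ) :
    ∏ i ∈ posRoots b, f (rePair b i (weylVector b)) = ∏ k ∈ R.index, f (R.height (R.posRoot k)) := by
  rw [← R.prod_posRoots_eq b he fun v => f (R.height v)]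
  exact Finset.prod_congr rfl fun i _ => by rw [R.rePair_weylVector b he]

end RootModel

/-! ### Root systems given by lists of positive roots -/

section RootList

variable {r : ℕ} (C : Matrix (Fin r) (Fin r) ℤ)

/-- The digits of a natural number in base `16`. -/
def digit (k n : ℕ) : ℕ := k / 16 ^ n % 16

/-- The value of the `m`-th simple coroot at the vector of the digits of `k`. -/
def digitPairing (k : ℕ) (m : Fin r) : ℤ := ∑ n : Fin r, (digit k n : ℤ) * C n m

/-- The image of the vector of the digits of `k` under the `m`-th simple reflection. -/
def digitReflection (k : ℕ) (m : Fin r) : ℕ := (k - digitPairing C k m * 16 ^ (m : ℕ) : ℤ).toNat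

/-- The images of vectors under the simple reflections that increase them. -/
def nextRoots (l : List ℕ) : List ℕ :=
  (l.flatMap fun k => (List.finRange r).filterMap fun m =>
    if digitPairing C k m < 0 then some (digitReflection C k m) else none).dedup

/-- The vectors obtained from the vectors in a list by at most `n` increasing simple
reflections. -/
def rootClosure : ℕ → List ℕ → List ℕ
  | 0, _ => []
  | n + 1, l => l ++ rootClosure n (nextRoots C l)

/-- The list of the positive roots, for a Cartan matrix of finite type. -/
def rootList (n : ℕ) : List ℕ := rootClosure C n ((List.finRange r).map fun m : Fin r => 16 ^ (m : ℕ))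

/-- A list of vectors that is stable enough under the simple reflections for it to be the list of
positive roots. -/
abbrev IsRootList (L : List ℕ) : Prop :=
  (∀ m, C m m = 2) ∧ (∀ m n : Fin r, digit (16 ^ (m : ℕ)) n = if n = m then 1 else 0) ∧
  (∀ m : Fin r, 16 ^ (m : ℕ) ∈ L) ∧
  (∀ k ∈ L, (∑ n : Fin r, digit k n * 16 ^ (n : ℕ)) = k) ∧
  (∀ k ∈ L, ∀ m : Fin r, k = 16 ^ (m : ℕ) ∨ (digitReflection C k m ∈ L ∧
    ∀ n : Fin r, (digit (digitReflection C k m) n : ℤ) =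
      digit k n - if n = m then digitPairing C k m else 0)) ∧
  (∀ k ∈ L, ∃ m : Fin r, k = 16 ^ (m : ℕ) ∨ (0 < digitPairing C k m ∧ digitReflection C k m < k))

/-- The pairing of the vector of the digits of `k` with the Weyl vector, multiplied by the common
denominator of the numbers in `d`. -/
def digitHeight (d : Fin r → ℕ) (k : ℕ) : ℕ := ∑ m : Fin r, digit k m * d m

/-- The vector of the digits of a natural number. -/
def digitVector (r k : ℕ) : Fin r → ℤ := fun n => digit k n

/-- The simple coroots, as linear forms on the lattice generated by the simple roots. -/
def matrixCoroot (n : Fin r) : (Fin r → ℤ) →+ ℤ where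
  toFun v := ∑ m, v m * C m n
  map_zero' := by simp
  map_add' v w := by simp [add_mul, Finset.sum_add_distrib]

variable {C}

/-- The realization of a Cartan matrix given by a list of positive roots. -/
def rootListModel {L : List ℕ} (hL : IsRootList C L) {d : Fin r → ℕ} {D : ℕ} (hd : ∀ m, 0 < d m)
    (hD : ∀ m, d m ≤ D) (hD' : ∃ m, d m = D) (hd' : ∀ m n, d m * C n m = d n * C m n) :
    RootModel C (Fin r → ℤ) ℕ where
  root m := Pi.single m 1
  coroot := matrixCoroot C
  coroot_root m n := by
    simp [matrixCoroot, Pi.single_apply]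
  halfNorm m := d m / D
  halfNorm_pos m := div_pos (by exact_mod_cast hd m) (by exact_mod_cast (hd m).trans_le (hD m))
  halfNorm_le_one m := div_le_one_of_le₀ (by exact_mod_cast hD m) (Nat.cast_nonneg D)
  exists_halfNorm_eq_one := by
    obtain ⟨m, hm⟩ := hD'
    exact ⟨m, by rw [hm, div_self]; have := hd m; rw [hm] at this; exact_mod_cast this.ne'⟩
  halfNorm_mul m n := by
    have : (d m * C n m : ℝ) = d n * C m n := by exact_mod_cast hd' m n
    rw [div_mul_eq_mul_div, div_mul_eq_mul_div, this]
  height :=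
    { toFun := fun v => ∑ m, (v m : ℝ) * (d m / D)
      map_zero' := by simp
      map_add' := fun v w => by simp [add_mul, Finset.sum_add_distrib] }
  height_root m := by simp [Pi.single_apply]
  index := L.toFinset
  posRoot := digitVector r
  injOn k hk l hl h := by
    rw [← hL.2.2.2.1 k (by simpa using hk), ← hL.2.2.2.1 l (by simpa using hl)]
    refine Finset.sum_congr rfl fun n _ => ?_
    have h1 : (digit k n : ℤ) = digit l n := congrFun h n
    rw [Nat.cast_injective h1]
  exists_root m := by
    refine ⟨16 ^ (m : ℕ), by simpa using hL.2.2.1 m, funext fun n => ?_⟩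
    rw [digitVector, hL.2.1 m n, Pi.single_apply]
    split_ifs <;> rfl
  reflection_mem k hk m := by
    rcases hL.2.2.2.2.1 k (by simpa using hk) m with h | ⟨h, h'⟩
    · left
      funext n
      rw [h, digitVector, hL.2.1 m n, Pi.single_apply]
      split_ifs <;> rfl
    · right
      refine ⟨_, by simpa using h, funext fun n => ?_⟩
      rw [digitVector, h']
      simp [digitVector, digitPairing, matrixCoroot, Pi.single_apply]
  -- A simple reflection that lowers a root also lowers its base 16 numeral, so the numeral serves
  -- as the depth.
  depth := id
  exists_lower k hk := by
    obtain ⟨m, hm⟩ := hL.2.2.2.2.2 k (by simpa using hk)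
    have hm' : k = 16 ^ (m : ℕ) → digitVector r k = Pi.single m 1 := by
      intro h
      funext n
      rw [h, digitVector, hL.2.1 m n, Pi.single_apply]
      split_ifs <;> rfl
    rcases hm with h | ⟨h, h'⟩
    · exact Or.inl ⟨m, hm' h⟩
    · rcases hL.2.2.2.2.1 k (by simpa using hk) m with h1 | ⟨h1, h2⟩
      · exact Or.inl ⟨m, hm' h1⟩
      · have h3 : digitVector r (digitReflection C k m) =
            digitVector r k - digitPairing C k m • Pi.single m 1 := by
          funext n
          rw [digitVector, h2]
          simp [digitVector, Pi.single_apply]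
        have h4 : matrixCoroot C m (digitVector r k) = digitPairing C k m := rfl
        have h5 : matrixCoroot C m (Pi.single m 1) = 2 := by
          simp [matrixCoroot, Pi.single_apply, hL.1]
        have h6 : matrixCoroot C m (digitVector r (digitReflection C k m)) =
            -digitPairing C k m := by
          rw [h3, map_sub, map_zsmul, h4, h5, smul_eq_mul]
          ring
        refine Or.inr ⟨m, digitReflection C k m, List.mem_toFinset.mpr h1, h', by rw [h6]; lia, ?_⟩
        rw [h6, h3]
        simp

/-- Coefficient vectors are encoded as numerals, so the properties of the list of roots become
arithmetic statements that the kernel can decide. Heights are scaled by the common denominator D to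
remain natural numbers. -/
theorem prod_rePair_of_isRootList {L : List ℕ} (hL : IsRootList C L) {d : Fin r → ℕ} {D : ℕ}
    (hd : ∀ m, 0 < d m) (hD : ∀ m, d m ≤ D) (hD' : ∃ m, d m = D)
    (hd' : ∀ m n, d m * C n m = d n * C m n) {e : b.support ≃ Fin r}
    (he : ∀ i j, b.cartanMatrix i j = C (e i) (e j)) {S : Multiset ℕ} (hnodup : L.Nodup)
    (hS : (L.map (digitHeight d) : Multiset ℕ) = S) (f : ℝ → ℂ) :
    ∏ i ∈ posRoots b, f (rePair b i (weylVector b)) = (S.map fun n : ℕ => f (n / D)).prod := by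
  rw [(rootListModel hL hd hD hD' hd').prod_rePair_weylVector b he, ← hS]
  simp only [rootListModel]
  rw [List.prod_toFinset _ hnodup, Multiset.map_coe, Multiset.prod_coe, List.map_map]
  congr 2
  funext k
  simp only [Function.comp_apply]
  congr 1
  simp only [digitHeight, digitVector, AddMonoidHom.coe_mk, ZeroHom.coe_mk]
  push_cast
  rw [Finset.sum_div]
  exact Finset.sum_congr rfl fun m _ => by rw [mul_div_assoc]

end RootList

/-! ### The exceptional types -/

theorem qFactorial_eq_prod_range (q : ℂ) (s : ℕ) :
    qFactorial q s = ((Multiset.range s).map fun n : ℕ => qNum q ((n + 1 : ℕ) : ℂ)).prod := by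
  induction s with
  | zero => simp [qFactorial]
  | succ s ih =>
    rw [qFactorial, Finset.prod_Icc_succ_top (by lia), ← qFactorial, ih, Multiset.range_succ,
      Multiset.map_cons, Multiset.prod_cons, mul_comm]

/-- For simply laced types, the product over the exponents. -/
theorem prod_qFactorial (q : ℂ) (S : Multiset ℕ) : (S.map (qFactorial q)).prod =
    ((S.bind fun s => (Multiset.range s).map (· + 1)).map fun n : ℕ => qNum q n).prod := by
  rw [Multiset.map_bind, Multiset.prod_bind]
  congr 2
  funext s
  rw [qFactorial_eq_prod_range, Multiset.map_map]
  rfl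

/-- The number of rounds, here and for the other exceptional types, is the height of θ: each
increasing reflection raises the height by at least one, starting from one. -/
theorem isRootList_E₆ : IsRootList CartanMatrix.E₆ (rootList CartanMatrix.E₆ 11) := by
  decide +kernel

theorem isRootList_E₇ : IsRootList CartanMatrix.E₇ (rootList CartanMatrix.E₇ 17) := by
  decide +kernel

theorem isRootList_E₈ : IsRootList CartanMatrix.E₈ (rootList CartanMatrix.E₈ 29) := by
  decide +kernel

theorem isRootList_F₄ : IsRootList CartanMatrix.F₄ (rootList CartanMatrix.F₄ 11) := by
  decide +kernel

theorem isRootList_G₂ : IsRootList CartanMatrix.G₂ (rootList CartanMatrix.G₂ 5) := by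
  decide +kernel

/-- The heights of the positive roots form the union of the intervals {1, …, s} over the exponents
s. This is checked by computation in types E. -/
theorem prod_rePair_E₆ (h : HasType b .E₆) (q : ℂ) :
    ∏ i ∈ posRoots b, qNum q (rePair b i (weylVector b)) = superfactorial .E₆ q := by
  obtain ⟨e, he⟩ := h
  rw [prod_rePair_of_isRootList b isRootList_E₆ (d := fun _ => 1) (D := 1) (by decide) (by decide)
    (by decide) (by decide) he (S := DynkinType.E₆.exponents.bind fun s =>
      (Multiset.range s).map (· + 1)) (by decide +kernel) (by decide +kernel) fun y => qNum q y]
  simp only [superfactorial, prod_qFactorial]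
  simp

theorem prod_rePair_E₇ (h : HasType b .E₇) (q : ℂ) :
    ∏ i ∈ posRoots b, qNum q (rePair b i (weylVector b)) = superfactorial .E₇ q := by
  obtain ⟨e, he⟩ := h
  rw [prod_rePair_of_isRootList b isRootList_E₇ (d := fun _ => 1) (D := 1) (by decide) (by decide)
    (by decide) (by decide) he (S := DynkinType.E₇.exponents.bind fun s =>
      (Multiset.range s).map (· + 1)) (by decide +kernel) (by decide +kernel) fun y => qNum q y]
  simp only [superfactorial, prod_qFactorial]
  simp

theorem prod_rePair_E₈ (h : HasType b .E₈) (q : ℂ) :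
    ∏ i ∈ posRoots b, qNum q (rePair b i (weylVector b)) = superfactorial .E₈ q := by
  obtain ⟨e, he⟩ := h
  rw [prod_rePair_of_isRootList b isRootList_E₈ (d := fun _ => 1) (D := 1) (by decide) (by decide)
    (by decide) (by decide) he (S := DynkinType.E₈.exponents.bind fun s =>
      (Multiset.range s).map (· + 1)) (by decide +kernel) (by decide +kernel) fun y => qNum q y]
  simp only [superfactorial, prod_qFactorial]
  simp

theorem prod_rePair_F₄ (h : HasType b .F₄) (q : ℂ) :
    ∏ i ∈ posRoots b, qNum q (rePair b i (weylVector b)) = superfactorial .F₄ q := by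
  obtain ⟨e, he⟩ := h
  -- The first two simple roots are long and the others have half their squared length. The listed
  -- numbers are twice the pairings with ρ.
  rw [prod_rePair_of_isRootList b isRootList_F₄ (d := ![2, 2, 1, 1]) (D := 2) (by decide)
    (by decide) (by decide) (by decide) he
    (S := {1, 1, 2, 2, 2, 3, 4, 4, 4, 5, 5, 6, 6, 6, 7, 8, 8, 9, 10, 10, 11, 12, 14, 16})
    (by decide +kernel) (by decide +kernel) fun y => qNum q y]
  simp only [superfactorial, Multiset.insert_eq_cons, Multiset.map_cons, Multiset.prod_cons,
    Multiset.map_singleton, Multiset.prod_singleton]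
  norm_num
  ring

theorem prod_rePair_G₂ (h : HasType b .G₂) (q : ℂ) :
    ∏ i ∈ posRoots b, qNum q (rePair b i (weylVector b)) = superfactorial .G₂ q := by
  obtain ⟨e, he⟩ := h
  -- The first simple root is long and the squared length of the second is a third of it. The listed
  -- numbers are three times the pairings with ρ.
  rw [prod_rePair_of_isRootList b isRootList_G₂ (d := ![3, 1]) (D := 3) (by decide)
    (by decide) (by decide) (by decide) he (S := {1, 3, 4, 5, 6, 9})
    (by decide +kernel) (by decide +kernel) fun y => qNum q y]
  simp only [superfactorial, Multiset.insert_eq_cons, Multiset.map_cons, Multiset.prod_cons,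
    Multiset.map_singleton, Multiset.prod_singleton]
  norm_num
  ring

/-! ### Type `A` -/

/-- The vectors of the standard basis. -/
def stdVector (p : ℕ) : ℕ → ℤ := fun x => if x = p then 1 else 0

/-- A linear combination of coordinates, as a linear form with real values. -/
def coordSum (s : Finset ℕ) (c : ℕ → ℝ) : (ℕ → ℤ) →+ ℝ where
  toFun v := ∑ x ∈ s, c x * v x
  map_zero' := by simp
  map_add' v w := by simp [mul_add, Finset.sum_add_distrib]

theorem coordSum_stdVector (s : Finset ℕ) (c : ℕ → ℝ) (p : ℕ) :
    coordSum s c (stdVector p) = if p ∈ s then c p else 0 := by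
  simp [coordSum, stdVector]

/-- The difference of two coordinates, as a linear form. -/
def coordSub (p q : ℕ) : (ℕ → ℤ) →+ ℤ := Pi.evalAddMonoidHom (fun _ => ℤ) p - Pi.evalAddMonoidHom (fun _ => ℤ) q

theorem coordSub_apply (p q : ℕ) (v : ℕ → ℤ) : coordSub p q v = v p - v q := rfl

/-- The realization of the root system of type `A`. -/
def modelA (r : ℕ) (hr : 1 ≤ r) : RootModel (CartanMatrix.A r) (ℕ → ℤ) (ℕ × ℕ) where
  root m := stdVector m - stdVector (m + 1)
  coroot m := coordSub m (m + 1)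
  coroot_root m n := by
    simp only [coordSub_apply, stdVector, Pi.sub_apply, CartanMatrix.A, Matrix.of_apply, Fin.ext_iff]
    grind
  halfNorm _ := 1
  halfNorm_pos _ := one_pos
  halfNorm_le_one _ := le_rfl
  exists_halfNorm_eq_one := ⟨⟨0, hr⟩, rfl⟩
  halfNorm_mul m n := by
    simp only [CartanMatrix.A, Matrix.of_apply, Fin.ext_iff]
    grind
  -- Up to a constant vector, which the roots do not see, these are the coordinates of ρ; the root
  -- e_p - e_q gets height q - p.
  height := coordSum (Finset.range (r + 1)) fun x => -x
  height_root m := by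
    rw [map_sub, coordSum_stdVector, coordSum_stdVector, if_pos, if_pos]
    · push_cast; ring
    · rw [Finset.mem_range]; lia
    · rw [Finset.mem_range]; lia
  index := (Finset.range (r + 1) ×ˢ Finset.range (r + 1)).filter fun k => k.1 < k.2
  posRoot k := stdVector k.1 - stdVector k.2
  injOn := by
    rintro ⟨p, q⟩ hk ⟨p', q'⟩ hl h
    simp at hk hl
    have h1 := congrFun h p
    have h2 := congrFun h q
    simp [stdVector] at h1 h2
    grind
  exists_root m := ⟨(m, m + 1), by simp, rfl⟩
  reflection_mem := by
    rintro ⟨p, q⟩ hk m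
    simp only [Finset.mem_filter, Finset.mem_product, Finset.mem_range] at hk
    by_cases h : p = m ∧ q = m + 1
    · left; simp [h]
    right
    -- The simple reflection acts on the standard basis as a transposition of adjacent indices.
    let π : ℕ → ℕ := fun x => if x = m then m + 1 else if x = m + 1 then m else x
    have hπ : ∀ x, stdVector (π x) =
        stdVector x - coordSub m (m + 1) (stdVector x) • (stdVector m - stdVector (m + 1)) := by
      intro x
      funext y
      simp only [π, coordSub_apply, stdVector, Pi.sub_apply, Pi.smul_apply, smul_eq_mul]
      grind
    refine ⟨(π p, π q), ?_, ?_⟩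
    · have := m.2
      simp only [Finset.mem_filter, Finset.mem_product, Finset.mem_range, π]
      grind
    · simp only [hπ, map_sub, sub_smul]
      abel
  depth k := k.2 - k.1
  exists_lower := by
    rintro ⟨p, q⟩ hk
    simp only [Finset.mem_filter, Finset.mem_product, Finset.mem_range] at hk
    by_cases h : q = p + 1
    · exact Or.inl ⟨⟨p, by lia⟩, by simp [h]⟩
    · obtain ⟨q, rfl⟩ : ∃ q', q = q' + 1 := ⟨q - 1, by lia⟩
      refine Or.inr ⟨⟨q, by lia⟩, (p, q), ?_, ?_, ?_, ?_⟩
      · simp; lia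
      · simp only; lia
      · simp only [coordSub_apply, stdVector, Pi.sub_apply]
        grind
      · funext y
        simp only [coordSub_apply, stdVector, Pi.sub_apply, Pi.smul_apply, smul_eq_mul]
        grind

theorem prod_filter_lt {n : ℕ} (B : ℕ → ℕ) (hB : ∀ p, B p ≤ n) (f : ℕ × ℕ → ℂ) :
    ∏ k ∈ (Finset.range n ×ˢ Finset.range n).filter (fun k => k.1 < k.2 ∧ k.2 < B k.1), f k =
      ∏ p ∈ Finset.range n, ∏ q ∈ Finset.Ico (p + 1) (B p), f (p, q) := by
  rw [Finset.prod_filter, Finset.prod_product]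
  refine Finset.prod_congr rfl fun p hp => ?_
  rw [← Finset.prod_filter]
  refine Finset.prod_congr ?_ fun _ _ => rfl
  ext q
  have := hB p
  simp only [Finset.mem_filter, Finset.mem_range, Finset.mem_Ico]
  lia

/-- The roots e_p - e_q with fixed p have heights 1, …, r - p, which gives one quantum factorial for
each exponent. -/
theorem prod_rePair_A {r : ℕ} {hr : 1 ≤ r} (h : HasType b (.A r hr)) (q : ℂ) :
    ∏ i ∈ posRoots b, qNum q (rePair b i (weylVector b)) = superfactorial (.A r hr) q := by
  obtain ⟨e, he⟩ := h
  rw [(modelA r hr).prod_rePair_weylVector b he fun y : ℝ => qNum q y]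
  have h1 : (modelA r hr).index = (Finset.range (r + 1) ×ˢ Finset.range (r + 1)).filter
      (fun k => k.1 < k.2 ∧ k.2 < r + 1) := by
    ext k
    simp only [modelA, Finset.mem_filter, Finset.mem_product, Finset.mem_range]
    lia
  rw [h1, prod_filter_lt (fun _ => r + 1) (fun _ => le_rfl), Finset.prod_range_succ]
  simp only [superfactorial, DynkinType.exponents, Multiset.map_map, Function.comp_def,
    Finset.Ico_self, Finset.prod_empty, mul_one]
  change _ = ∏ i ∈ Finset.range r, _
  rw [← Finset.prod_range_reflect]
  refine Finset.prod_congr rfl fun p hp => ?_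
  rw [Finset.mem_range] at hp
  rw [qFactorial]
  refine Finset.prod_bij' (fun n _ => n - (r - 1 - p)) (fun n _ => n + (r - 1 - p)) ?_ ?_ ?_ ?_ ?_
  · intro n hn; simp only [Finset.mem_Ico, Finset.mem_Icc] at hn ⊢; lia
  · intro n hn; simp only [Finset.mem_Ico, Finset.mem_Icc] at hn ⊢; lia
  · intro n hn; simp only [Finset.mem_Ico] at hn; lia
  · intro n hn; lia
  · intro n hn
    simp only [Finset.mem_Ico] at hn
    simp only [modelA, map_sub, coordSum_stdVector, Finset.mem_range]
    rw [if_pos (by lia), if_pos (by lia)]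
    push_cast [Nat.cast_sub (show r - 1 - p ≤ n by lia)]
    congr 1
    ring

/-! ### Types `B`, `C` and `D` -/

/-- The vectors of the standard basis, and their opposites: `foldVector n (n - 1 - p)` is the
opposite of `foldVector n p`. -/
def foldVector (n p : ℕ) : ℕ → ℤ := fun x =>
  (if x = p then 1 else 0) - if x + p + 1 = n then 1 else 0

theorem coordSum_foldVector (n r : ℕ) (c : ℕ → ℝ) {p : ℕ} (hp : p < n) :
    coordSum (Finset.range r) c (foldVector n p) =
      (if p < r then c p else 0) - if n - 1 - p < r then c (n - 1 - p) else 0 := by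
  have h : foldVector n p = stdVector p - stdVector (n - 1 - p) := by
    funext x
    simp only [foldVector, stdVector, Pi.sub_apply]
    congr 2
    rw [eq_iff_iff]
    lia
  rw [h, map_sub, coordSum_stdVector, coordSum_stdVector]
  simp only [Finset.mem_range]

theorem foldVector_reverse {n p : ℕ} (hp : p < n) :
    foldVector n (n - 1 - p) = -foldVector n p := by
  funext x
  simp only [foldVector, Pi.neg_apply]
  grind

/-- The indices of the positive roots, in the classical types. -/
def foldIndex (n B : ℕ) : Finset (ℕ × ℕ) :=
  (Finset.range n ×ˢ Finset.range n).filter fun k => k.1 < k.2 ∧ k.2 < B - k.1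

theorem mem_foldIndex {n B p q : ℕ} (hB : B ≤ n) : (p, q) ∈ foldIndex n B ↔ p < q ∧ p + q < B := by
  simp only [foldIndex, Finset.mem_filter, Finset.mem_product, Finset.mem_range]
  lia

/-- The index of the root with given endpoints. -/
def foldPair (n B p q : ℕ) : ℕ × ℕ :=
  if p + q < B then (p, q) else (n - 1 - q, n - 1 - p)

/-- A root has two expressions as a difference, exchanged by reversing and negating both vectors. -/
theorem foldVector_foldPair {n B p q : ℕ} (hp : p < n) (hq : q < n) :
    foldVector n (foldPair n B p q).1 - foldVector n (foldPair n B p q).2 =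
      foldVector n p - foldVector n q := by
  rw [foldPair]
  split_ifs
  · rfl
  · simp only [foldVector_reverse hp, foldVector_reverse hq]
    abel

/-- The first nonzero coordinate of the difference determines p, and then q follows. -/
theorem foldVector_injOn {n B : ℕ} (hB : B ≤ n) :
    Set.InjOn (fun k : ℕ × ℕ => foldVector n k.1 - foldVector n k.2) (foldIndex n B) := by
  have h1 : ∀ {p q y : ℕ}, p < q → p + q < n → y < p → (foldVector n p - foldVector n q) y = 0 := by
    intro p q y h1 h2 h3
    simp only [foldVector, Pi.sub_apply]
    rw [if_neg (by lia), if_neg (by lia), if_neg (by lia), if_neg (by lia)]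
    rfl
  have h2 : ∀ {p q : ℕ}, p < q → p + q < n → (foldVector n p - foldVector n q) p ≠ 0 := by
    intro p q h1 h2
    simp only [foldVector, Pi.sub_apply]
    rw [if_pos trivial, if_neg (by lia), if_neg (by lia)]
    split_ifs <;> norm_num
  rintro ⟨p, q⟩ hk ⟨p', q'⟩ hl h
  rw [Finset.mem_coe, mem_foldIndex hB] at hk hl
  simp only at h
  rcases lt_trichotomy p p' with h3 | rfl | h3
  · exact absurd (h ▸ h1 hl.1 (by lia) h3) (h2 hk.1 (by lia))
  · have h4 := congrFun (sub_right_injective h) q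
    have h5 := congrFun (sub_right_injective h) q'
    simp only [foldVector] at h4 h5
    grind
  · exact absurd (h ▸ h1 hk.1 (by lia) h3) (h2 hl.1 (by lia))

/-- The realization of a Cartan matrix of one of the types `B`, `C` and `D`: the simple roots are
the differences of the vectors `foldVector n (u m)` and `foldVector n (w m)`, the `m`-th simple
coroot takes the values `c m`, and the `m`-th simple reflection permutes the vectors `foldVector n p`
through `π m`. -/
def foldModel {r n B : ℕ} {C : Matrix (Fin r) (Fin r) ℤ} (hB : B ≤ n) (u w : Fin r → ℕ)
    (coroot : Fin r → (ℕ → ℤ) →+ ℤ) (c : Fin r → ℕ → ℤ) (π : Fin r → ℕ → ℕ)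
    (hc : ∀ m x, x < n → coroot m (foldVector n x) = c m x)
    (huw : ∀ m, u m < w m ∧ u m + w m < B)
    (hC : ∀ m m', c m' (u m) - c m' (w m) = C m m')
    (hπn : ∀ m x, x < n → π m x < n)
    (hπ : ∀ m x, x < n → foldVector n (π m x) =
      foldVector n x - c m x • (foldVector n (u m) - foldVector n (w m)))
    (hπB : ∀ p q, p < q → p + q < B → ∀ m, (p = u m ∧ q = w m) ∨
      foldPair n B (π m p) (π m q) ∈ foldIndex n B)
    (hlow : ∀ p q, p < q → p + q < B → (∃ m, p = u m ∧ q = w m) ∨ ∃ m p' q', p' < q' ∧ p' + q' < B ∧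
      q' - p' < q - p ∧ c m p' < c m q' ∧ π m p' = p ∧ π m q' = q)
    (d : Fin r → ℝ) (hd : ∀ m, 0 < d m) (hd1 : ∀ m, d m ≤ 1) (hd1' : ∃ m, d m = 1)
    (hdC : ∀ m m', d m * C m' m = d m' * C m m') (ρ : ℕ → ℝ)
    (hρ : ∀ m, coordSum (Finset.range r) ρ (foldVector n (u m) - foldVector n (w m)) = d m) :
    RootModel C (ℕ → ℤ) (ℕ × ℕ) where
  root m := foldVector n (u m) - foldVector n (w m)
  coroot := coroot
  coroot_root m m' := by
    have := huw m
    rw [map_sub, hc _ _ (by lia), hc _ _ (by lia), hC]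
  halfNorm := d
  halfNorm_pos := hd
  halfNorm_le_one := hd1
  exists_halfNorm_eq_one := hd1'
  halfNorm_mul := hdC
  height := coordSum (Finset.range r) ρ
  height_root := hρ
  index := foldIndex n B
  posRoot k := foldVector n k.1 - foldVector n k.2
  injOn := foldVector_injOn hB
  exists_root m := ⟨(u m, w m), (mem_foldIndex hB).mpr (huw m), rfl⟩
  reflection_mem := by
    rintro ⟨p, q⟩ hk m
    rw [mem_foldIndex hB] at hk
    rcases hπB p q hk.1 hk.2 m with ⟨rfl, rfl⟩ | h
    · exact Or.inl rfl
    · refine Or.inr ⟨_, h, ?_⟩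
      rw [foldVector_foldPair (hπn m _ (by lia)) (hπn m _ (by lia)), hπ _ _ (by lia),
        hπ _ _ (by lia), map_sub, hc _ _ (by lia), hc _ _ (by lia), sub_smul]
      abel
  depth k := k.2 - k.1
  exists_lower := by
    rintro ⟨p, q⟩ hk
    rw [mem_foldIndex hB] at hk
    rcases hlow p q hk.1 hk.2 with ⟨m, rfl, rfl⟩ | ⟨m, p', q', h1, h2, h3, h4, h5, h6⟩
    · exact Or.inl ⟨m, rfl⟩
    · refine Or.inr ⟨m, (p', q'), (mem_foldIndex hB).mpr ⟨h1, h2⟩, h3, ?_, ?_⟩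
      · rw [map_sub, hc _ _ (by lia), hc _ _ (by lia)]
        lia
      · simp only
        rw [← h5, ← h6, hπ _ _ (by lia), hπ _ _ (by lia), map_sub, hc _ _ (by lia),
          hc _ _ (by lia), sub_smul]
        abel

/-- A simple reflection, other than the last one, as a permutation. -/
def foldSwap (n m x : ℕ) : ℕ :=
  if x = m then m + 1 else if x = m + 1 then m else
    if x + m + 1 = n then x - 1 else if x + m + 2 = n then x + 1 else x

/-- The values of a simple coroot, other than the last one. -/
def foldCoroot (n m x : ℕ) : ℤ :=
  if x = m then 1 else if x = m + 1 then -1 else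
    if x + m + 1 = n then -1 else if x + m + 2 = n then 1 else 0

theorem foldCoroot_sub_foldCoroot_succ {n m x : ℕ} (h : x + m + 3 < n) :
    foldCoroot n m x - foldCoroot n m (x + 1) =
      if x = m then 2 else if x + 1 = m ∨ m + 1 = x then -1 else 0 := by
  simp only [foldCoroot]
  split_ifs <;> lia

theorem foldCoroot_sub_foldCoroot {r m : ℕ} (hr : 3 ≤ r) (hm : m + 1 < r) :
    foldCoroot (2 * r) m (r - 2) - foldCoroot (2 * r) m r = if m + 3 = r then -1 else 0 := by
  simp only [foldCoroot]
  split_ifs <;> lia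

theorem coordSub_foldVector {n m x : ℕ} (hm : 2 * m + 3 < n) :
    coordSub m (m + 1) (foldVector n x) = foldCoroot n m x := by
  simp only [coordSub_apply, foldVector, foldCoroot]
  grind

theorem foldVector_foldSwap {n m x : ℕ} (hm : 2 * m + 3 < n) :
    foldVector n (foldSwap n m x) = foldVector n x -
      foldCoroot n m x • (foldVector n m - foldVector n (m + 1)) := by
  rw [foldCoroot, foldSwap]
  split_ifs with h1 h2 h3 h4
  · subst h1; module
  · subst h2; module
  · have h5 := foldVector_reverse (n := n) (p := m) (by lia)
    have h6 := foldVector_reverse (n := n) (p := m + 1) (by lia)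
    rw [show n - 1 - m = x by lia] at h5
    rw [show n - 1 - (m + 1) = x - 1 by lia] at h6
    rw [h5, h6]; module
  · have h5 := foldVector_reverse (n := n) (p := m) (by lia)
    have h6 := foldVector_reverse (n := n) (p := m + 1) (by lia)
    rw [show n - 1 - m = x + 1 by lia] at h5
    rw [show n - 1 - (m + 1) = x by lia] at h6
    rw [h5, h6]; module
  · module

theorem foldSwap_lt {n m x : ℕ} (hm : 2 * m + 3 < n) (hx : x < n) : foldSwap n m x < n := by
  rw [foldSwap]
  split_ifs <;> lia

theorem foldPair_foldSwap_mem {n B m p q : ℕ} (hB : B ≤ n) (hB' : n ≤ B + 1) (hm : 2 * m + 3 < n)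
    (hpq : p < q) (hpqB : p + q < B) :
    (p = m ∧ q = m + 1) ∨ foldPair n B (foldSwap n m p) (foldSwap n m q) ∈ foldIndex n B := by
  by_cases h : p = m ∧ q = m + 1
  · exact Or.inl h
  right
  rw [foldPair, foldSwap, foldSwap]
  split_ifs <;> rw [mem_foldIndex hB] <;> lia

theorem foldVector_of_two_mul {n p : ℕ} (h : 2 * p + 1 = n) : foldVector n p = 0 := by
  funext x
  simp only [foldVector, Pi.zero_apply]
  grind

/-- The realization of the root system of type `B`. -/
def modelB (r : ℕ) (hr : 2 ≤ r) : RootModel (CartanMatrix.B r) (ℕ → ℤ) (ℕ × ℕ) :=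
  -- Here n is odd, so the middle vector is zero and the differences with it are the short roots
  -- e_p. The bound p + q < 2r leaves out 2e_p.
  foldModel (n := 2 * r + 1) (B := 2 * r) (by lia) (fun m => m) (fun m => m + 1)
    -- Coordinate r + 1 is the opposite of coordinate r - 1, so the last coroot is twice a
    -- coordinate.
    (fun m => coordSub m (if m + 1 < r then m + 1 else r + 1))
    (fun m x => if m + 1 < r then foldCoroot (2 * r + 1) m x else
      if x + 1 = r then 2 else if x = r + 1 then -2 else 0)
    (fun m x => if m + 1 < r then foldSwap (2 * r + 1) m x else
      if x + 1 = r then r + 1 else if x = r + 1 then r - 1 else x)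
    (fun m x hx => by
      split_ifs with h
      · exact coordSub_foldVector (by lia)
      · simp only [coordSub_apply, foldVector]; grind
      · simp only [coordSub_apply, foldVector]; grind
      · simp only [coordSub_apply, foldVector]; grind)
    (fun m => by lia)
    (fun m m' => by
      simp only [CartanMatrix.B, Matrix.of_apply, Fin.ext_iff, foldCoroot]
      grind)
    (fun m x hx => by
      split_ifs
      · exact foldSwap_lt (by lia) hx
      all_goals lia)
    (fun m x hx => by
      split_ifs with h h1 h2
      · exact foldVector_foldSwap (by lia)
      · have h3 := foldVector_reverse (n := 2 * r + 1) (p := r - 1) (by lia)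
        rw [show 2 * r + 1 - 1 - (r - 1) = r + 1 by lia] at h3
        rw [foldVector_of_two_mul (p := m + 1) (by lia), h3, show (m : ℕ) = r - 1 by lia,
          show x = r - 1 by lia]
        module
      · have h3 := foldVector_reverse (n := 2 * r + 1) (p := r - 1) (by lia)
        rw [show 2 * r + 1 - 1 - (r - 1) = r + 1 by lia] at h3
        rw [foldVector_of_two_mul (p := m + 1) (by lia), h2, h3, show (m : ℕ) = r - 1 by lia]
        module
      · module)
    (fun p q hpq hpqB m => by
      split_ifs with h
      · exact foldPair_foldSwap_mem (by lia) (by lia) (by lia) hpq hpqB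
      all_goals
        rw [or_iff_not_imp_left]
        intro h'
        rw [foldPair]
        split_ifs <;> rw [mem_foldIndex (by lia)] <;> lia)
    (fun p q hpq hpqB => by
      by_cases h : q = p + 1
      · exact Or.inl ⟨⟨p, by lia⟩, by simp [h]⟩
      right
      rcases lt_trichotomy q r with h3 | h3 | h3
      · refine ⟨⟨q - 1, by lia⟩, p, q - 1, ?_⟩
        simp only [foldCoroot, foldSwap]
        grind
      · refine ⟨⟨p, by lia⟩, p + 1, r, ?_⟩
        simp only [foldCoroot, foldSwap]
        grind
      · by_cases h4 : q = r + 1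
        · refine ⟨⟨r - 1, by lia⟩, p, r - 1, ?_⟩
          simp only [foldCoroot, foldSwap]
          grind
        · refine ⟨⟨2 * r - q, by lia⟩, p, q - 1, ?_⟩
          simp only [foldCoroot, foldSwap]
          grind)
    (fun m => if m + 1 < r then 1 else 1 / 2)
    (fun m => by split_ifs <;> norm_num)
    (fun m => by split_ifs <;> norm_num)
    ⟨⟨0, by lia⟩, if_pos (by simp; lia)⟩
    (fun m n => by
      simp only [CartanMatrix.B, Matrix.of_apply, Fin.ext_iff]
      split_ifs <;> first | (exfalso; lia) | norm_num)
    (fun x => r - 1 / 2 - x)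
    (fun m => by
      have := m.2
      rw [map_sub, coordSum_foldVector _ _ _ (by lia), coordSum_foldVector _ _ _ (by lia)]
      by_cases h : (m : ℕ) + 1 < r
      · rw [if_pos m.2, if_neg (by lia), if_pos h, if_neg (by lia), if_pos h]
        push_cast
        ring
      · have h2 : (r : ℝ) = m + 1 := by exact_mod_cast (show r = m + 1 by lia)
        rw [if_pos m.2, if_neg (by lia), if_neg h, if_neg (by lia), if_neg h, h2]
        ring)

/-- The realization of the root system of type `C`. -/
def modelC (r : ℕ) (hr : 2 ≤ r) : RootModel (CartanMatrix.C r) (ℕ → ℤ) (ℕ × ℕ) :=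
  foldModel (n := 2 * r) (B := 2 * r) (by lia) (fun m => m) (fun m => m + 1)
    -- Coordinate 2r vanishes on all the vectors in use, so the last coroot reads a single
    -- coordinate.
    (fun m => coordSub m (if m + 1 < r then m + 1 else 2 * r))
    (fun m x => if m + 1 < r then foldCoroot (2 * r) m x else
      if x + 1 = r then 1 else if x = r then -1 else 0)
    (fun m x => if m + 1 < r then foldSwap (2 * r) m x else
      if x + 1 = r then r else if x = r then r - 1 else x)
    (fun m x hx => by
      split_ifs with h
      · exact coordSub_foldVector (by lia)
      · simp only [coordSub_apply, foldVector]; grind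
      · simp only [coordSub_apply, foldVector]; grind
      · simp only [coordSub_apply, foldVector]; grind)
    (fun m => by lia)
    (fun m m' => by
      simp only [CartanMatrix.C, Matrix.of_apply, Fin.ext_iff, foldCoroot]
      grind)
    (fun m x hx => by
      split_ifs
      · exact foldSwap_lt (by lia) hx
      all_goals lia)
    (fun m x hx => by
      split_ifs with h h1 h2
      · exact foldVector_foldSwap (by lia)
      · rw [show (m : ℕ) = x by lia, show r = x + 1 by lia]
        module
      · rw [show (m : ℕ) = r - 1 by lia, h2, show r - 1 + 1 = r by lia]
        module
      · module)
    (fun p q hpq hpqB m => by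
      split_ifs with h
      · exact foldPair_foldSwap_mem (by lia) (by lia) (by lia) hpq hpqB
      all_goals
        rw [or_iff_not_imp_left]
        intro h'
        rw [foldPair]
        split_ifs <;> rw [mem_foldIndex (by lia)] <;> lia)
    (fun p q hpq hpqB => by
      by_cases h : q = p + 1
      · exact Or.inl ⟨⟨p, by lia⟩, by simp [h]⟩
      right
      rcases lt_trichotomy q r with h3 | h3 | h3
      · refine ⟨⟨q - 1, by lia⟩, p, q - 1, ?_⟩
        simp only [foldCoroot, foldSwap]
        grind
      · refine ⟨⟨r - 1, by lia⟩, p, r - 1, ?_⟩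
        simp only [foldCoroot, foldSwap]
        grind
      · by_cases h4 : p + q + 1 = 2 * r
        · refine ⟨⟨p, by lia⟩, p + 1, q - 1, ?_⟩
          simp only [foldCoroot, foldSwap]
          grind
        · refine ⟨⟨2 * r - 1 - q, by lia⟩, p, q - 1, ?_⟩
          simp only [foldCoroot, foldSwap]
          grind)
    (fun m => if m + 1 < r then 1 / 2 else 1)
    (fun m => by split_ifs <;> norm_num)
    (fun m => by split_ifs <;> norm_num)
    ⟨⟨r - 1, by lia⟩, if_neg (by simp only; lia)⟩
    (fun m n => by
      simp only [CartanMatrix.C, Matrix.of_apply, Fin.ext_iff]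
      split_ifs <;> first | (exfalso; lia) | norm_num)
    -- The form is half the standard one, so that the long roots 2e_p have squared length two.
    (fun x => (r - x) / 2)
    (fun m => by
      have := m.2
      rw [map_sub, coordSum_foldVector _ _ _ (by lia), coordSum_foldVector _ _ _ (by lia)]
      by_cases h : (m : ℕ) + 1 < r
      · rw [if_pos m.2, if_neg (by lia), if_pos h, if_neg (by lia), if_pos h]
        push_cast
        ring
      · have h2 : (r : ℝ) = m + 1 := by exact_mod_cast (show r = m + 1 by lia)
        rw [if_pos m.2, if_neg (by lia), if_neg h, if_pos (by lia), if_neg h,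
          show 2 * r - 1 - ((m : ℕ) + 1) = m by lia, h2]
        ring)

/-- The realization of the root system of type `D`. -/
def modelD (r : ℕ) (hr : 3 ≤ r) : RootModel (CartanMatrix.D r) (ℕ → ℤ) (ℕ × ℕ) :=
  -- The vector of index r is the opposite of that of index r - 1, so the last simple root e_{r-2} +
  -- e_{r-1} is again a difference. The bound 2r - 1 leaves out the vectors 2e_p.
  foldModel (n := 2 * r) (B := 2 * r - 1) (by lia) (fun m => if m + 1 < r then m else r - 2)
    (fun m => if m + 1 < r then m + 1 else r)
    (fun m => coordSub (if m + 1 < r then m else r - 2) (if m + 1 < r then m + 1 else r))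
    (fun m x => if m + 1 < r then foldCoroot (2 * r) m x else
      if x + 2 = r ∨ x + 1 = r then 1 else if x = r ∨ x = r + 1 then -1 else 0)
    (fun m x => if m + 1 < r then foldSwap (2 * r) m x else
      if x + 2 = r ∨ x + 1 = r then x + 2 else if x = r ∨ x = r + 1 then x - 2 else x)
    (fun m x hx => by
      split_ifs with h
      · exact coordSub_foldVector (by lia)
      · simp only [coordSub_apply, foldVector]; grind
      · simp only [coordSub_apply, foldVector]; grind
      · simp only [coordSub_apply, foldVector]; grind)
    (fun m => by split_ifs <;> lia)
    (fun m m' => by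
      simp only [CartanMatrix.D, Matrix.of_apply, Fin.ext_iff]
      by_cases h : (m : ℕ) + 1 < r <;> by_cases h' : (m' : ℕ) + 1 < r <;> simp only [h, h',
        if_true, if_false]
      · rw [foldCoroot_sub_foldCoroot_succ (by lia)]
        grind
      · grind
      · rw [foldCoroot_sub_foldCoroot (by lia) (by lia)]
        grind
      · grind)
    (fun m x hx => by
      split_ifs
      · exact foldSwap_lt (by lia) hx
      all_goals lia)
    (fun m x hx => by
      split_ifs with h h1 h2
      · exact foldVector_foldSwap (by lia)
      · have h3 := foldVector_reverse (n := 2 * r) (p := r - 2) (by lia)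
        have h4 := foldVector_reverse (n := 2 * r) (p := r) (by lia)
        rw [show 2 * r - 1 - (r - 2) = r + 1 by lia] at h3
        rw [show 2 * r - 1 - r = r - 1 by lia] at h4
        rcases h1 with h1 | h1
        · rw [show x = r - 2 by lia, show r - 2 + 2 = r by lia]
          module
        · rw [show x = r - 1 by lia, show r - 1 + 2 = r + 1 by lia, h3, h4]
          module
      · have h3 := foldVector_reverse (n := 2 * r) (p := r - 2) (by lia)
        have h4 := foldVector_reverse (n := 2 * r) (p := r) (by lia)
        rw [show 2 * r - 1 - (r - 2) = r + 1 by lia] at h3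
        rw [show 2 * r - 1 - r = r - 1 by lia] at h4
        rcases h2 with h2 | h2
        · rw [h2]
          module
        · rw [h2, show r + 1 - 2 = r - 1 by lia, h3, h4]
          module
      · module)
    (fun p q hpq hpqB m => by
      split_ifs with h
      · exact foldPair_foldSwap_mem (by lia) (by lia) (by lia) hpq hpqB
      all_goals
        rw [or_iff_not_imp_left]
        intro h'
        rw [foldPair]
        split_ifs <;> rw [mem_foldIndex (by lia)] <;> lia)
    (fun p q hpq hpqB => by
      by_cases h : q < r
      · by_cases h1 : q = p + 1
        · exact Or.inl ⟨⟨p, by lia⟩, by simp only; rw [if_pos (by lia), if_pos (by lia)]; simp [h1]⟩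
        · refine Or.inr ⟨⟨q - 1, by lia⟩, p, q - 1, ?_⟩
          simp only [foldCoroot, foldSwap]
          grind
      by_cases h1 : q = r
      · by_cases h2 : p + 2 = r
        · exact Or.inl ⟨⟨r - 1, by lia⟩, by
            simp only; rw [if_neg (by lia), if_neg (by lia)]; lia⟩
        · refine Or.inr ⟨⟨p, by lia⟩, p + 1, q, ?_⟩
          simp only [foldCoroot, foldSwap]
          grind
      · refine Or.inr ⟨⟨2 * r - 1 - q, by lia⟩, p, q - 1, ?_⟩
        simp only [foldCoroot, foldSwap]
        grind)
    (fun _ => 1)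
    (fun _ => one_pos)
    (fun _ => le_rfl)
    ⟨⟨0, by lia⟩, rfl⟩
    (fun m n => by
      simp only [CartanMatrix.D, Matrix.of_apply, Fin.ext_iff]
      split_ifs <;> first | (exfalso; lia) | norm_num)
    (fun x => r - 1 - x)
    (fun m => by
      have := m.2
      by_cases h : (m : ℕ) + 1 < r
      · rw [if_pos h, if_pos h, map_sub, coordSum_foldVector _ _ _ (by lia),
          coordSum_foldVector _ _ _ (by lia)]
        rw [if_pos m.2, if_neg (by lia), if_pos h, if_neg (by lia)]
        push_cast
        ring
      · rw [if_neg h, if_neg h, map_sub, coordSum_foldVector _ _ _ (by lia),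
          coordSum_foldVector _ _ _ (by lia), if_pos (by lia), if_neg (by lia), if_neg (by lia),
          if_pos (by lia), Nat.cast_sub (by lia), show 2 * r - 1 - r = r - 1 by lia,
          Nat.cast_sub (by lia)]
        push_cast
        ring)

/-- Only the rows p < r are nonempty; they are reversed so that row r - 1 - i corresponds to the
exponent 2i + 1. -/
theorem prod_foldIndex {n B r : ℕ} (hB : B ≤ n) (hr : r ≤ n) (hBr : B ≤ 2 * r + 1)
    (f : ℕ × ℕ → ℂ) :
    ∏ k ∈ foldIndex n B, f k = ∏ i ∈ Finset.range r,
      ∏ q ∈ Finset.Ico (r - 1 - i + 1) (B - (r - 1 - i)), f (r - 1 - i, q) := by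
  rw [foldIndex, prod_filter_lt (fun p => B - p) (fun p => by lia),
    Finset.prod_range_reflect fun p => ∏ q ∈ Finset.Ico (p + 1) (B - p), f (p, q)]
  symm
  refine Finset.prod_subset (Finset.range_subset_range.mpr hr) fun p _ hp => ?_
  rw [Finset.mem_range] at hp
  rw [Finset.Ico_eq_empty (by lia), Finset.prod_empty]

/-- With s = 2i + 1, row r - 1 - i contains the short root e_p, of height s/2, and long roots whose
heights are 1, …, s - 1, each once. -/
theorem prod_rePair_B {r : ℕ} {hr : 2 ≤ r} (h : HasType b (.B r hr)) (q : ℂ) :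
    ∏ i ∈ posRoots b, qNum q (rePair b i (weylVector b)) = superfactorial (.B r hr) q := by
  obtain ⟨e, he⟩ := h
  rw [(modelB r hr).prod_rePair_weylVector b he fun y : ℝ => qNum q y]
  simp only [modelB, foldModel]
  rw [prod_foldIndex (r := r) (by lia) (by lia) (by lia)]
  simp only [superfactorial, DynkinType.exponents, Multiset.map_map, Function.comp_def]
  change _ = ∏ i ∈ Finset.range r, _
  refine Finset.prod_congr rfl fun i hi => ?_
  rw [Finset.mem_range] at hi
  obtain ⟨p, rfl⟩ : ∃ p, r = i + p + 1 := ⟨r - i - 1, by lia⟩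
  rw [show i + p + 1 - 1 - i = p by lia, show 2 * (i + p + 1) - p = 2 * i + p + 2 by lia,
    ← Finset.mul_prod_erase _ _ (show i + p + 1 ∈ Finset.Ico (p + 1) (2 * i + p + 2) by
      simp; lia), qFactorialB, qFactorial]
  simp only [map_sub]
  congr 1
  · rw [coordSum_foldVector _ _ _ (by lia), coordSum_foldVector _ _ _ (by lia), if_pos (by lia),
      if_neg (by lia), if_neg (by lia), if_neg (by lia)]
    push_cast
    congr 1
    ring
  · refine Finset.prod_bij' (fun x _ => if x < i + p + 1 then x - p else x - p - 1)
      (fun y _ => if y ≤ i then y + p else y + p + 1) ?_ ?_ ?_ ?_ ?_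
    · intro x hx
      simp only [Finset.mem_erase, Finset.mem_Ico, Finset.mem_Icc] at hx ⊢
      split_ifs <;> lia
    · intro y hy
      simp only [Finset.mem_erase, Finset.mem_Ico, Finset.mem_Icc] at hy ⊢
      split_ifs <;> lia
    · intro x hx
      simp only [Finset.mem_erase, Finset.mem_Ico] at hx
      split_ifs <;> lia
    · intro y hy
      simp only [Finset.mem_Icc] at hy
      split_ifs <;> lia
    · intro x hx
      simp only [Finset.mem_erase, Finset.mem_Ico] at hx
      rw [coordSum_foldVector _ _ _ (by lia), coordSum_foldVector _ _ _ (by lia),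
        if_pos (show p < i + p + 1 by lia),
        if_neg (show ¬ 2 * (i + p + 1) + 1 - 1 - p < i + p + 1 by lia)]
      split_ifs with h1 h2 h3
      · lia
      · push_cast [Nat.cast_sub (show p ≤ x by lia)]
        congr 1
        ring
      · push_cast [Nat.cast_sub (show p ≤ x by lia), Nat.cast_sub (show 1 ≤ x - p by lia),
          Nat.cast_sub (show x ≤ 2 * (i + p + 1) by lia), Nat.add_sub_cancel]
        congr 1
        ring
      · lia

/-- With s = 2i + 1, the short roots in row r - 1 - i have heights j/2 for j ≤ s except j = i + 1,
and the long root 2e_p has height i + 1 = (s + 1)/2. The bijection sends the long root to the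
exceptional index. -/
theorem prod_rePair_C {r : ℕ} {hr : 2 ≤ r} (h : HasType b (.C r hr)) (q : ℂ) :
    ∏ i ∈ posRoots b, qNum q (rePair b i (weylVector b)) = superfactorial (.C r hr) q := by
  obtain ⟨e, he⟩ := h
  rw [(modelC r hr).prod_rePair_weylVector b he fun y : ℝ => qNum q y]
  simp only [modelC, foldModel]
  rw [prod_foldIndex (r := r) (by lia) (by lia) (by lia)]
  simp only [superfactorial, DynkinType.exponents, Multiset.map_map, Function.comp_def]
  change _ = ∏ i ∈ Finset.range r, _
  refine Finset.prod_congr rfl fun i hi => ?_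
  rw [Finset.mem_range] at hi
  obtain ⟨p, rfl⟩ : ∃ p, r = i + p + 1 := ⟨r - i - 1, by lia⟩
  rw [show i + p + 1 - 1 - i = p by lia, show 2 * (i + p + 1) - p = 2 * i + p + 2 by lia,
    qFactorialC]
  simp only [map_sub]
  refine Finset.prod_bij' (fun x _ => if x < i + p + 1 then x - p else
      if x = 2 * i + p + 1 then i + 1 else x - p + 1)
    (fun y _ => if y ≤ i then y + p else if y = i + 1 then 2 * i + p + 1 else y + p - 1)
    ?_ ?_ ?_ ?_ ?_
  · intro x hx
    simp only [Finset.mem_Ico, Finset.mem_Icc] at hx ⊢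
    split_ifs <;> lia
  · intro y hy
    simp only [Finset.mem_Ico, Finset.mem_Icc] at hy ⊢
    split_ifs <;> lia
  · intro x hx
    simp only [Finset.mem_Ico] at hx
    split_ifs <;> lia
  · intro y hy
    simp only [Finset.mem_Icc] at hy
    split_ifs <;> lia
  · intro x hx
    simp only [Finset.mem_Ico] at hx
    rw [coordSum_foldVector _ _ _ (by lia), coordSum_foldVector _ _ _ (by lia),
      if_pos (show p < i + p + 1 by lia),
      if_neg (show ¬ 2 * (i + p + 1) - 1 - p < i + p + 1 by lia)]
    by_cases h1 : x < i + p + 1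
    · rw [if_pos h1, if_pos h1, if_neg (by lia), if_neg (by lia)]
      push_cast [Nat.cast_sub (show p ≤ x by lia)]
      congr 1
      ring
    rw [if_neg h1, if_neg h1, if_pos (by lia)]
    by_cases h2 : x = 2 * i + p + 1
    · rw [if_pos h2, if_pos (by lia), show 2 * (i + p + 1) - 1 - x = p by lia]
      push_cast
      congr 1
      ring
    · obtain ⟨y, hy⟩ : ∃ y, x + y = 2 * (i + p + 1) - 1 := ⟨2 * (i + p + 1) - 1 - x, by lia⟩
      rw [if_neg h2, if_neg (by lia), ← hy, Nat.add_sub_cancel_left]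
      have h3 : (x : ℂ) + y = 2 * (i + p + 1) - 1 := by
        rw [eq_sub_iff_add_eq]
        exact_mod_cast (show x + y + 1 = 2 * (i + p + 1) by lia)
      push_cast [Nat.cast_sub (show p ≤ x by lia)]
      congr 1
      linear_combination -h3 / 2

/-- Each nonempty row contains one height twice, from e_p - e_{r-1} and e_p + e_{r-1}. Removing the
second from every row leaves the factorials of the odd exponents, and the removed heights 1, …, r -
1 make up the extra exponent r - 1. -/
theorem prod_rePair_D {r : ℕ} {hr : 3 ≤ r} (h : HasType b (.D r hr)) (q : ℂ) :
    ∏ i ∈ posRoots b, qNum q (rePair b i (weylVector b)) = superfactorial (.D r hr) q := by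
  obtain ⟨e, he⟩ := h
  rw [(modelD r hr).prod_rePair_weylVector b he fun y : ℝ => qNum q y]
  simp only [modelD, foldModel]
  rw [prod_foldIndex (r := r) (by lia) (by lia) (by lia)]
  simp only [superfactorial, DynkinType.exponents, Multiset.map_cons, Multiset.prod_cons,
    Multiset.map_map, Function.comp_def]
  change _ = _ * ∏ i ∈ Finset.range (r - 1), _
  obtain ⟨r, rfl⟩ : ∃ r', r = r' + 1 := ⟨r - 1, by lia⟩
  rw [Nat.add_sub_cancel, Finset.prod_range_succ', Nat.sub_zero, Finset.Ico_eq_empty (by lia),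
    Finset.prod_empty, mul_one, qFactorial_eq_prod_range]
  change _ = (∏ n ∈ Finset.range r, _) * _
  rw [← Finset.prod_mul_distrib]
  refine Finset.prod_congr rfl fun i hi => ?_
  rw [Finset.mem_range] at hi
  obtain ⟨p, rfl⟩ : ∃ p, r = i + p + 1 := ⟨r - i - 1, by lia⟩
  rw [show i + p + 1 - (i + 1) = p by lia, ← Finset.mul_prod_erase _ _
    (show i + p + 2 ∈ Finset.Ico (p + 1) (2 * (i + p + 1 + 1) - 1 - p) by simp; lia), qFactorial]
  simp only [map_sub]
  congr 1
  · rw [coordSum_foldVector _ _ _ (by lia), coordSum_foldVector _ _ _ (by lia), if_pos (by lia),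
      if_neg (by lia), if_neg (by lia), if_pos (by lia),
      show 2 * (i + p + 1 + 1) - 1 - (i + p + 2) = i + p + 1 by lia]
    push_cast
    congr 1
    ring
  · refine Finset.prod_bij' (fun x _ => if x < i + p + 2 then x - p else x - p - 1)
      (fun y _ => if y ≤ i + 1 then y + p else y + p + 1) ?_ ?_ ?_ ?_ ?_
    · intro x hx
      simp only [Finset.mem_erase, Finset.mem_Ico, Finset.mem_Icc] at hx ⊢
      split_ifs <;> lia
    · intro y hy
      simp only [Finset.mem_erase, Finset.mem_Ico, Finset.mem_Icc] at hy ⊢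
      split_ifs <;> lia
    · intro x hx
      simp only [Finset.mem_erase, Finset.mem_Ico] at hx
      split_ifs <;> lia
    · intro y hy
      simp only [Finset.mem_Icc] at hy
      split_ifs <;> lia
    · intro x hx
      simp only [Finset.mem_erase, Finset.mem_Ico] at hx
      rw [coordSum_foldVector _ _ _ (by lia), coordSum_foldVector _ _ _ (by lia),
        if_pos (show p < i + p + 1 + 1 by lia),
        if_neg (show ¬ 2 * (i + p + 1 + 1) - 1 - p < i + p + 1 + 1 by lia)]
      by_cases h1 : x < i + p + 2
      · rw [if_pos h1, if_pos h1, if_neg (by lia)]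
        push_cast [Nat.cast_sub (show p ≤ x by lia)]
        congr 1
        ring
      · obtain ⟨y, hy⟩ : ∃ y, x + y = 2 * (i + p + 1 + 1) - 1 :=
          ⟨2 * (i + p + 1 + 1) - 1 - x, by lia⟩
        rw [if_neg h1, if_neg h1, if_pos (by lia), ← hy, Nat.add_sub_cancel_left]
        have h3 : (x : ℂ) + y = 2 * (i + p + 1 + 1) - 1 := by
          rw [eq_sub_iff_add_eq]
          exact_mod_cast (show x + y + 1 = 2 * (i + p + 1 + 1) by lia)
        push_cast [Nat.cast_sub (show p ≤ x by lia), Nat.cast_sub (show 1 ≤ x - p by lia)]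
        congr 1
        linear_combination -h3

/-- The product of the `q`-numbers of the heights of the positive coroots is the superfactorial. -/
theorem prod_rePair_eq_superfactorial {X : DynkinType} (h : HasType b X) (q : ℂ) :
    ∏ i ∈ posRoots b, qNum q (rePair b i (weylVector b)) = superfactorial X q := by
  cases X with
  | A => exact prod_rePair_A b h q
  | B => exact prod_rePair_B b h q
  | C => exact prod_rePair_C b h q
  | D => exact prod_rePair_D b h q
  | E₆ => exact prod_rePair_E₆ b h q
  | E₇ => exact prod_rePair_E₇ b h q
  | E₈ => exact prod_rePair_E₈ b h q
  | F₄ => exact prod_rePair_F₄ b h q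
  | G₂ => exact prod_rePair_G₂ b h q

end GlobalDim

end

/-! ### The global dimension formula -/

theorem mainTheorem3 {L : Type*} [LieRing L] [LieAlgebra ℂ L] [FiniteDimensional ℂ L]
    [LieAlgebra.IsSimple ℂ L] (H : LieSubalgebra ℂ L) [H.IsCartanSubalgebra]
    (b : (LieAlgebra.IsKilling.rootSystem H).Base)
    (X : GlobalDim.DynkinType) (hX : GlobalDim.HasType b X) (k : ℕ)
    (r γ g : ℕ) (hr : r = Module.finrank ℂ H) (hγ : γ = GlobalDim.coxeterNumber b)
    (hg : g = GlobalDim.dualCoxeterNumber b)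
    (Δ q : ℂ) (hΔ : Δ = GlobalDim.fundDet b)
    (hq : q = Complex.exp (Complex.I * Real.pi / (g + k))) :
    (GlobalDim.simpleObjects b k).Finite ∧
      GlobalDim.globalDim b k =
        ((g + k : ℕ) : ℂ) ^ r /
          (2 ^ (r * γ) * Δ * ((Real.sin (Real.pi / (g + k)) : ℝ) : ℂ) ^ (r * γ) *
            GlobalDim.superfactorial X q ^ 2) := by
  -- The weight space is the dual of the Cartan subalgebra, with the simple roots as a basis.
  have h1 : Module.finrank ℂ H = Fintype.card b.support := by
    rw [← Subspace.dual_finrank_eq, Module.finrank_eq_card_basis b.toWeightBasis]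
  subst hγ hg hΔ
  rw [h1] at hr
  subst hr
  refine ⟨GlobalDim.finite_simpleObjects b k, ?_⟩
  have h2 : GlobalDim.rootOfUnity b k = q := hq.symm
  rw [GlobalDim.globalDim_eq_prod_posRoots, h2, GlobalDim.prod_rePair_eq_superfactorial b hX,
    GlobalDim.two_mul_card_posRoots, mul_pow, Nat.cast_add (R := ℝ)]
  congr 1
  ring
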